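/- Let $k$ be a finite field with $q$ elements, put $v=q^{1/2}$, and let $Q$ be a finite connected quiver (finitely many vertices, at least one, and finitely many arrows). Let $\mathcal H(Q)$ be the Hall algebra of $Q$ over $k$: it is the free $\mathbb Z[v,v^{-1}]$-module on the isomorphism classes $[X]$ of finite-dimensional representations of $Q$ over $k$ (equivalently, finite-dimensional left modules over the path algebra $kQ$), with multiplication $[M]\diamond[N]=\sum_{[X]}F^X_{M,N}[X]$, where $F^X_{M,N}$ is the number of subrepresentations $U$ of $X$ with $U\cong N$ and $X/U\cong M$. For a representation $M$ let $s(M)$ be its number of indecomposable direct summands; for an integer $r\ge 1$ let $D_r(Q)$ be the $\mathbb Z[v,v^{-1}]$-span of the classes $[M]$ with $s(M)\ge r+1$, and put $D(Q)=D_1(Q)$. "Ideal" means two-sided ideal, and "subring" means a subring not required to contain the unit element. Consider the following quivers: $L_m$ ($m\ge 1$), with vertices $1,\dots,m$ and arrows $1\to 2\to\cdots\to m$; $\Delta_n$ ($n\ge 0$), the oriented cycle $0\to 1\to\cdots\to n\to 0$ (a single loop when $n=0$); $V_{m,x}$ ($m\ge 3$, $2\le x\le m-1$), with vertices $1,\dots,m$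 and arrows $1\to 2\to\cdots\to x\leftarrow\cdots\leftarrow m-1\leftarrow m$; and $\Lambda_{n,y}$ ($n\ge 3$, $2\le y\le n-1$), with vertices $1,\dots,n$ and arrows $1\leftarrow 2\leftarrow\cdots\leftarrow y\to\cdots\to n-1\to n$. (i) The following are equivalent: (a) $D(Q)$ is an ideal of $\mathcal H(Q)$; (b) $D_r(Q)$ is an ideal of $\mathcal H(Q)$ for all $r\ge 1$; (c) $Q$ is isomorphic to some $L_m$ or some $\Delta_n$. (ii) The following are equivalent: (a) $D(Q)$ is a subring of $\mathcal H(Q)$; (b) $D_r(Q)$ is a subring of $\mathcal H(Q)$ for all $r\ge 1$; (c) $Q$ is isomorphic to some $L_m$, $\Delta_n$, $V_{m,x}$ or $\Lambda_{n,y}$. -/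

import Mathlib

universe u v w

/-! ### Finite-dimensional representations of a quiver -/

/-- A finite-dimensional representation over `k` of the quiver with vertex set `V`. -/
structure QuiverRep (k : Type u) [Field k] (V : Type w) [Quiver.{v} V] where
  /-- the vector space at a vertex -/
  obj : V → Type u
  [grp : ∀ a, AddCommGroup (obj a)]
  [mod : ∀ a, Module k (obj a)]
  [fin : ∀ a, FiniteDimensional k (obj a)]
  /-- the linear map along an arrow -/
  map : ∀ {a b : V}, (a ⟶ b) → obj a →ₗ[k] obj b

namespace QuiverRep

attribute [instance] QuiverRep.grp QuiverRep.mod QuiverRep.fin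

variable {k : Type u} [Field k] {V : Type w} [Quiver.{v} V]

/-- An isomorphism of representations: linear isomorphisms at all vertices, commuting with the
maps along all arrows. -/
structure Iso (X Y : QuiverRep k V) where
  /-- the linear isomorphism at a vertex -/
  equiv : ∀ a, X.obj a ≃ₗ[k] Y.obj a
  comm : ∀ {a b : V} (f : a ⟶ b) (x : X.obj a), equiv b (X.map f x) = Y.map f (equiv a x)

/-- The identity isomorphism. -/
def Iso.refl (X : QuiverRep k V) : Iso X X where
  equiv _ := LinearEquiv.refl k _
  comm _ _ := rfl

/-- The inverse isomorphism. -/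
def Iso.symm {X Y : QuiverRep k V} (e : Iso X Y) : Iso Y X where
  equiv a := (e.equiv a).symm
  comm {a b} f y := by
    rw [LinearEquiv.symm_apply_eq, e.comm, LinearEquiv.apply_symm_apply]

/-- The composite of two isomorphisms. -/
def Iso.trans {X Y Z : QuiverRep k V} (e : Iso X Y) (e' : Iso Y Z) : Iso X Z where
  equiv a := (e.equiv a).trans (e'.equiv a)
  comm f x := by simp [e.comm, e'.comm]

/-- A subrepresentation: a subspace at every vertex, stable under the maps along the arrows. -/
structure Sub (X : QuiverRep k V) where
  /-- the subspace at a vertex -/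
  carrier : ∀ a, Submodule k (X.obj a)
  map_mem : ∀ {a b : V} (f : a ⟶ b) (x : X.obj a), x ∈ carrier a → X.map f x ∈ carrier b

/-- A subrepresentation, regarded as a representation. -/
def Sub.rep {X : QuiverRep k V} (U : Sub X) : QuiverRep k V where
  obj a := U.carrier a
  map f := (X.map f).restrict (U.map_mem f)

/-- The quotient of a representation by a subrepresentation. -/
def Sub.quot {X : QuiverRep k V} (U : Sub X) : QuiverRep k V where
  obj a := X.obj a ⧸ U.carrier a
  map {a b} f := (U.carrier a).mapQ (U.carrier b) (X.map f) (U.map_mem f)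

/-- A representation is indecomposable if it is nonzero and is not the direct sum of two nonzero
subrepresentations. -/
def IsIndecomposable (X : QuiverRep k V) : Prop :=
  (∃ a, Nontrivial (X.obj a)) ∧
    ∀ U W : Sub X, (∀ a, IsCompl (U.carrier a) (W.carrier a)) →
      (∀ a, U.carrier a = ⊥) ∨ (∀ a, W.carrier a = ⊥)

/-- `X` is the (internal) direct sum of `n` indecomposable subrepresentations. -/
def HasDecomposition (X : QuiverRep k V) (n : ℕ) : Prop :=
  ∃ U : Fin n → Sub X, (∀ i, (U i).rep.IsIndecomposable) ∧
    ∀ a, DirectSum.IsInternal (fun i => (U i).carrier a)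

/-- The number `s(X)` of indecomposable direct summands of `X`. (By the Krull-Schmidt theorem
there is exactly one `n` with `X.HasDecomposition n` when the quiver has finitely many vertices.) -/
noncomputable def numSummands (X : QuiverRep k V) : ℕ :=
  sInf {n | X.HasDecomposition n}

/-- The Hall number `F^X_{M,N}`: the number of subrepresentations `U` of `X` with `U ≅ N` and
`X/U ≅ M`. -/
noncomputable def hallNumber (X M N : QuiverRep k V) : ℕ :=
  Nat.card {U : Sub X // Nonempty (Iso U.rep N) ∧ Nonempty (Iso U.quot M)}

variable (k V) in
/-- Isomorphism of representations, as an equivalence relation. -/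
instance isoSetoid : Setoid (QuiverRep k V) where
  r X Y := Nonempty (Iso X Y)
  iseqv := ⟨fun X => ⟨Iso.refl X⟩, fun ⟨e⟩ => ⟨e.symm⟩, fun ⟨e⟩ ⟨e'⟩ => ⟨e.trans e'⟩⟩

variable (k V) in
/-- Isomorphism classes `[X]` of finite-dimensional representations. -/
def IsoClass : Type _ := Quotient (isoSetoid k V)

/-- A chosen representative of an isomorphism class. -/
noncomputable def IsoClass.out (c : IsoClass k V) : QuiverRep k V := Quotient.out c

/-- The dimensions at the vertices are additive on `0 → U → X → X/U → 0`. -/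
theorem finrank_of_sub {X M N : QuiverRep k V} (U : Sub X) (e : Iso U.rep N)
    (e' : Iso U.quot M) (a : V) :
    Module.finrank k (X.obj a) = Module.finrank k (M.obj a) + Module.finrank k (N.obj a) := by
  have h1 : Module.finrank k (U.carrier a) = Module.finrank k (N.obj a) :=
    (e.equiv a).finrank_eq
  have h2 : Module.finrank k (X.obj a ⧸ U.carrier a) = Module.finrank k (M.obj a) :=
    (e'.equiv a).finrank_eq
  rw [← h1, ← h2, Submodule.finrank_quotient_add_finrank]

/-- The representation on the coordinate spaces `k ^ d a` given by a family of linear maps. -/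
def std (d : V → ℕ) (φ : ∀ a b : V, (a ⟶ b) → ((Fin (d a) → k) →ₗ[k] (Fin (d b) → k))) :
    QuiverRep k V where
  obj a := Fin (d a) → k
  map {a b} f := φ a b f

/-- Over a finite field and for a finite quiver there are only finitely many isomorphism classes
of representations with a given dimension vector. -/
theorem finite_isoClass [Finite k] [Finite V] [∀ a b : V, Finite (a ⟶ b)] (d : V → ℕ) :
    {c : IsoClass k V | ∀ a, Module.finrank k (c.out.obj a) = d a}.Finite := by
  have hfin : ∀ a b : V, Finite ((Fin (d a) → k) →ₗ[k] (Fin (d b) → k)) := fun a b =>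
    DFunLike.finite _
  refine (Set.finite_range
    (fun φ : (∀ a b : V, (a ⟶ b) → ((Fin (d a) → k) →ₗ[k] (Fin (d b) → k))) =>
      (Quotient.mk (isoSetoid k V) (std d φ) : IsoClass k V))).subset ?_
  intro (c : IsoClass k V) hc
  have e : ∀ a, c.out.obj a ≃ₗ[k] (Fin (d a) → k) := fun a =>
    LinearEquiv.ofFinrankEq _ _ ((hc a).trans (Module.finrank_fin_fun k).symm)
  refine ⟨fun a b f => (e b).toLinearMap ∘ₗ c.out.map f ∘ₗ (e a).symm.toLinearMap, ?_⟩
  have h : Quotient.mk (isoSetoid k V) c.out = c := Quotient.out_eq c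
  refine Eq.trans (Quotient.sound (Nonempty.intro (Iso.symm ?_))) h
  refine { equiv := e, comm := fun {a b} f x => ?_ }
  change (e b) (c.out.map f x) = (e b) (c.out.map f ((e a).symm ((e a) x)))
  rw [LinearEquiv.symm_apply_apply]

/-- Only finitely many coefficients of a Hall product are nonzero. -/
theorem finite_support_hallNumber [Finite k] [Finite V] [∀ a b : V, Finite (a ⟶ b)]
    {R : Type*} [Semiring R] (M N : QuiverRep k V) :
    (Function.support fun c : IsoClass k V => (hallNumber c.out M N : R)).Finite := by
  refine (finite_isoClass (k := k) (V := V)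
    (fun a => Module.finrank k (M.obj a) + Module.finrank k (N.obj a))).subset ?_
  intro c hc a
  have h0 : hallNumber c.out M N ≠ 0 := fun h => hc (by simp [h])
  obtain ⟨U, ⟨e⟩, ⟨e'⟩⟩ := (Nat.card_ne_zero.1 h0).1
  exact finrank_of_sub U e e' a

end QuiverRep

/-! ### The Hall algebra of a finite quiver over a finite field -/

/-- The coefficient ring `ℤ[v, v⁻¹] ⊆ ℝ`, where `v = q ^ (1/2)` and `q` is the number of elements
of `k`. -/
abbrev HallCoeff (k : Type u) : Subalgebra ℤ ℝ :=
  Algebra.adjoin ℤ {Real.sqrt (Nat.card k), (Real.sqrt (Nat.card k))⁻¹}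

/-- The free `ℤ[v, v⁻¹]`-module on the isomorphism classes of finite-dimensional
representations. -/
def HallAlgebra (k : Type u) [Field k] (V : Type w) [Quiver.{v} V] : Type _ :=
  QuiverRep.IsoClass k V →₀ HallCoeff k

namespace HallAlgebra

section Module

variable (k : Type u) [Field k] (V : Type w) [Quiver.{v} V]

noncomputable instance : AddCommGroup (HallAlgebra k V) :=
  inferInstanceAs (AddCommGroup (QuiverRep.IsoClass k V →₀ HallCoeff k))

noncomputable instance : Module (HallCoeff k) (HallAlgebra k V) :=
  inferInstanceAs (Module (HallCoeff k) (QuiverRep.IsoClass k V →₀ HallCoeff k))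

variable {k V}

/-- The coefficients of an element of the Hall algebra. -/
noncomputable def coeffs : HallAlgebra k V ≃ₗ[HallCoeff k] (QuiverRep.IsoClass k V →₀ HallCoeff k) :=
  LinearEquiv.refl (HallCoeff k) (QuiverRep.IsoClass k V →₀ HallCoeff k)

/-- The basis element `[M]`. -/
noncomputable def cls (M : QuiverRep.IsoClass k V) : HallAlgebra k V :=
  coeffs.symm (Finsupp.single M 1)

end Module

variable {k : Type u} [Field k] [Finite k] {V : Type w} [Quiver.{v} V] [Finite V]
  [∀ a b : V, Finite (a ⟶ b)]

/-- The product of two basis elements, `[M] ⋄ [N] = ∑_[X] F^X_{M,N} [X]`. -/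
noncomputable def clsMul (M N : QuiverRep.IsoClass k V) : HallAlgebra k V :=
  coeffs.symm (Finsupp.ofSupportFinite
    (fun X : QuiverRep.IsoClass k V => (QuiverRep.hallNumber X.out M.out N.out : HallCoeff k))
    (QuiverRep.finite_support_hallNumber M.out N.out))

variable (k V) in
/-- The bilinear extension of the product of basis elements. -/
noncomputable def mulHom :
    HallAlgebra k V →ₗ[HallCoeff k] HallAlgebra k V →ₗ[HallCoeff k] HallAlgebra k V :=
  (Finsupp.linearCombination (HallCoeff k) fun M : QuiverRep.IsoClass k V =>
    (Finsupp.linearCombination (HallCoeff k) fun N : QuiverRep.IsoClass k V => clsMul M N) ∘ₗ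
      coeffs.toLinearMap) ∘ₗ coeffs.toLinearMap

/-- The multiplication of the Hall algebra. -/
noncomputable instance : Mul (HallAlgebra k V) := ⟨fun x y => mulHom k V x y⟩

noncomputable instance : NonUnitalNonAssocRing (HallAlgebra k V) where
  left_distrib x y z := map_add (mulHom k V x) y z
  right_distrib x y z := by
    change mulHom k V (x + y) z = _
    rw [map_add]; rfl
  zero_mul x := by
    change mulHom k V 0 x = 0
    rw [map_zero]; rfl
  mul_zero x := map_zero (mulHom k V x)

theorem cls_mul_cls (M N : QuiverRep.IsoClass k V) : cls M * cls N = clsMul M N := by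
  change mulHom k V (cls M) (cls N) = _
  simp [mulHom, cls]

variable (k V) in
/-- `D_r(Q)`: the `ℤ[v, v⁻¹]`-span of the classes `[M]` with `s(M) ≥ r + 1`. -/
noncomputable def D (r : ℕ) : Submodule (HallCoeff k) (HallAlgebra k V) :=
  Submodule.span (HallCoeff k)
    {x | ∃ M : QuiverRep.IsoClass k V, r + 1 ≤ M.out.numSummands ∧ x = cls M}

/-- The subspace `D` is a (two-sided) ideal of the Hall algebra. -/
def IsIdeal (D : Submodule (HallCoeff k) (HallAlgebra k V)) : Prop :=
  ∀ d ∈ D, ∀ h : HallAlgebra k V, h * d ∈ D ∧ d * h ∈ D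

/-- The subspace `D` is a subring (not necessarily containing the unit element) of the Hall
algebra. -/
def IsSubring (D : Submodule (HallCoeff k) (HallAlgebra k V)) : Prop :=
  ∀ x ∈ D, ∀ y ∈ D, x * y ∈ D

end HallAlgebra

/-! ### The quivers `L`, `Δ`, `V`, `Λ`

In each of `LQuiver`, `VQuiver`, `WedgeQuiver` the element `i : Fin m` is the vertex with label
`i + 1`. -/

/-- The linearly oriented quiver `L_m`: `1 → 2 → ⋯ → m`. -/
def LQuiver (m : ℕ) : Type := Fin m

instance (m : ℕ) : Quiver.{0} (LQuiver m) where
  Hom i j := PLift (j.val = i.val + 1)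

/-- The oriented cycle `Δ_n` with the `n + 1` vertices `0 → 1 → ⋯ → n → 0` (a loop for
`n = 0`). -/
def DeltaQuiver (n : ℕ) : Type := Fin (n + 1)

instance (n : ℕ) : Quiver.{0} (DeltaQuiver n) where
  Hom i j := PLift (j.val = (i.val + 1) % (n + 1))

/-- The quiver `V_{m,x}`: `1 → 2 → ⋯ → x ← ⋯ ← m - 1 ← m`. -/
def VQuiver (m _x : ℕ) : Type := Fin m

instance (m x : ℕ) : Quiver.{0} (VQuiver m x) where
  Hom i j := PLift ((j.val = i.val + 1 ∧ j.val + 1 ≤ x) ∨ (i.val = j.val + 1 ∧ x ≤ j.val + 1))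

/-- The quiver `Λ_{n,y}`: `1 ← 2 ← ⋯ ← y → ⋯ → n - 1 → n`. -/
def WedgeQuiver (n _y : ℕ) : Type := Fin n

instance (n y : ℕ) : Quiver.{0} (WedgeQuiver n y) where
  Hom i j := PLift ((i.val = j.val + 1 ∧ i.val + 1 ≤ y) ∨ (j.val = i.val + 1 ∧ y ≤ i.val + 1))

/-- The quivers on `V` and `W` are isomorphic: there is a bijection between the vertices, and for
any two vertices a bijection between the arrows from the first to the second. -/
def QuiverIso (V : Type*) [Quiver V] (W : Type*) [Quiver W] : Prop :=
  ∃ e : V ≃ W, ∀ a b : V, Nonempty ((a ⟶ b) ≃ (e a ⟶ e b))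

section Shapes

variable (V : Type w) [Quiver.{v} V]

/-- The quiver is of the form `L_m`, `m ≥ 1`. -/
def IsOfFormL : Prop := ∃ m : ℕ, 1 ≤ m ∧ QuiverIso V (LQuiver m)

/-- The quiver is of the form `Δ_n`, `n ≥ 0`. -/
def IsOfFormDelta : Prop := ∃ n : ℕ, QuiverIso V (DeltaQuiver n)

/-- The quiver is of the form `V_{m,x}`, `m ≥ 3`, `2 ≤ x ≤ m - 1`. -/
def IsOfFormV : Prop := ∃ m x : ℕ, 2 ≤ x ∧ x + 1 ≤ m ∧ QuiverIso V (VQuiver m x)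

/-- The quiver is of the form `Λ_{n,y}`, `n ≥ 3`, `2 ≤ y ≤ n - 1`. -/
def IsOfFormWedge : Prop := ∃ n y : ℕ, 2 ≤ y ∧ y + 1 ≤ n ∧ QuiverIso V (WedgeQuiver n y)

/-- The quiver is connected: it is nonempty, and any two vertices are joined by a zigzag of
arrows. -/
def IsConnectedQuiver : Prop :=
  Nonempty V ∧ Subsingleton (Quiver.WeaklyConnectedComponent V)

end Shapes

/-! The class [X] occurs in [M] ⋄ [N] exactly when X has a subrepresentation U ≅ N with X/U ≅ M. So
every D_r is an ideal if neither U nor X/U ever has more summands than X, and a subring if one of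
these two inequalities always holds. Conversely, an indecomposable X with some U such that U or X/U
is decomposable shows that D_1 is not an ideal; if U and X/U are both decomposable, D_1 is not even
a subring.

The inequalities are proved in the modular lattice `Sub X`. Call a representation uniform if any two
nonzero subrepresentations meet. If all indecomposables are uniform (`IndecUniform`), then X is a
sum of s(X) uniform pieces, and a Steinitz exchange (`card_le_card_of_supIndep_of_uniform`) bounds
every independent family of nonzero subrepresentations by s(X), whence s(U) ≤ s(X). The same
argument in the dual lattice treats X/U; vector space duality turns its hypothesis into
`IndecUniform` for the opposite quiver. L and Δ are closed under passing to the opposite, and Λ is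
the opposite of V, so it remains to prove uniformity for two branches running into a sink (L and V)
and for cycles (Δ).

For this, let Φ be the sum of all arrow maps, acting on the product of the spaces. If Φ is nilpotent
and kills a nonzero vector at a vertex with a unique history, then a longest chain ending at such a
vector splits off (`isCompl_cyclicSpan_coreKer`), so an indecomposable X is this single chain. On
two branches the remaining case has injective maps: X is then a space with two chains of subspaces,
which always has a compatible splitting line (`exists_mem_or_le_ker_of_isChain`). On a cycle
Fitting's lemma leaves the case of bijective Φ: X is then a space with an endomorphism, an
indecomposable torsion module over the principal ideal domain k[T], hence cyclic primary.

For the converse, explicit representations are built on small configurations. Two arrows out of a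
vertex (or, dually, into one) obstruct the ideal property. Three arrows into a vertex, two arrows in
and one out, or a path from a source with a second outgoing arrow to a sink with a second incoming
arrow obstruct the subring property. Connected finite quivers avoiding these configurations and
their duals are exactly the listed ones. -/

/-! ### Decompositions in modular lattices -/

section ModularLattice

variable {L : Type*} [Lattice L] [BoundedOrder L]

/-- An element of a lattice is indecomposable if it is not `⊥` and is not the join of two disjoint
elements different from `⊥`. -/
def IndecElement (a : L) : Prop :=
  a ≠ ⊥ ∧ ∀ b c : L, Disjoint b c → b ⊔ c = a → b = ⊥ ∨ c = ⊥

/-- An element of a lattice is uniform if it is not `⊥` and any two elements below it that are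
different from `⊥` meet. -/
def UniformElement (a : L) : Prop :=
  a ≠ ⊥ ∧ ∀ b c : L, b ≤ a → c ≤ a → Disjoint b c → b = ⊥ ∨ c = ⊥

/-- A finite independent set of indecomposable elements with join `a`. -/
def IsDecomposition (S : Finset L) (a : L) : Prop :=
  S.SupIndep id ∧ S.sup id = a ∧ ∀ s ∈ S, IndecElement s

theorem IndecElement.map_orderIso {L' : Type*} [Lattice L'] [BoundedOrder L'] (e : L ≃o L') {a : L}
    (h : IndecElement a) : IndecElement (e a) := by
  refine ⟨fun h0 => h.1 (by simpa using h0), fun b c hbc hs => ?_⟩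
  have := h.2 (e.symm b) (e.symm c) ((disjoint_map_orderIso_iff e.symm).2 hbc)
    (by rw [← map_sup, hs, OrderIso.symm_apply_apply])
  simpa using this

theorem UniformElement.map_orderIso {L' : Type*} [Lattice L'] [BoundedOrder L'] (e : L ≃o L')
    {a : L} (h : UniformElement a) : UniformElement (e a) := by
  refine ⟨fun h0 => h.1 (by simpa using h0), fun b c hb hc hbc => ?_⟩
  have := h.2 (e.symm b) (e.symm c) ((OrderIso.symm_apply_le e).2 hb)
    ((OrderIso.symm_apply_le e).2 hc) ((disjoint_map_orderIso_iff e.symm).2 hbc)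
  simpa using this

theorem exists_isDecomposition [IsModularLattice L] [WellFoundedLT L] (a : L) :
    ∃ S : Finset L, IsDecomposition S a := by
  classical
  induction a using WellFoundedLT.induction with
  | ind a ih =>
    by_cases h0 : a = ⊥
    · exact ⟨∅, by simp, by simp [h0], by simp⟩
    by_cases hi : IndecElement a
    · exact ⟨{a}, by simp, by simp, by simpa using hi⟩
    simp only [IndecElement, not_and, not_forall, not_or] at hi
    obtain ⟨b, c, hbc, rfl, hb, hc⟩ := hi h0
    have hlb : b < b ⊔ c := lt_of_le_of_ne le_sup_left fun h =>
      hc (hbc.symm.eq_bot_of_le (by rw [h]; exact le_sup_right))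
    have hlc : c < b ⊔ c := lt_of_le_of_ne le_sup_right fun h =>
      hb (hbc.eq_bot_of_le (by rw [h]; exact le_sup_left))
    obtain ⟨S, hS1, hS2, hS3⟩ := ih b hlb
    obtain ⟨T, hT1, hT2, hT3⟩ := ih c hlc
    refine ⟨S ∪ T, hS1.union hT1 (by rwa [hS2, hT2]), by rw [Finset.sup_union, hS2, hT2], ?_⟩
    intro s hs
    exact (Finset.mem_union.1 hs).elim (hS3 s) (hT3 s)

/-- Essentiality is preserved by adding a disjoint summand `u`. By modularity `a` is disjoint from
`u ⊔ z`, so `u ⊔ z` misses `x` by essentiality, and a second use of modularity makes `z` disjoint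
from `x ⊔ u`, in which it lies. -/
theorem eq_bot_of_disjoint_sup_of_essential [IsModularLattice L] {x u a z : L} (hxu : Disjoint x u)
    (hax : a ≤ x) (hess : ∀ y ≤ x, Disjoint y a → y = ⊥) (hz : z ≤ x ⊔ u)
    (hd : Disjoint z (a ⊔ u)) : z = ⊥ := by
  have h1 : Disjoint a (u ⊔ z) :=
    Disjoint.disjoint_sup_right_of_disjoint_sup_left (hxu.mono_left hax) hd.symm
  have h2 : (u ⊔ z) ⊓ x = ⊥ :=
    hess _ inf_le_right (h1.symm.mono_left inf_le_left)
  have h3 : Disjoint z (u ⊔ x) := by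
    refine Disjoint.disjoint_sup_right_of_disjoint_sup_left (hd.mono_right le_sup_right) ?_
    rw [sup_comm]
    exact disjoint_iff.2 h2
  exact h3.eq_bot_of_le (by rwa [sup_comm])

/-- An element that meets every member of an independent set of uniform elements meets everything
different from `⊥` below their join. -/
theorem eq_bot_of_disjoint_of_meets_uniform [IsModularLattice L] {S : Finset L} {n : L}
    (hS : S.SupIndep id) (hu : ∀ s ∈ S, UniformElement s) (hn : ∀ s ∈ S, ¬ Disjoint s n) :
    ∀ z ≤ S.sup id, Disjoint z n → z = ⊥ := by
  classical
  induction S using Finset.induction with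
  | empty => intro z hz _; simpa using hz
  | insert u S hus ih =>
    intro z hz hzn
    have ih' := ih (hS.subset (Finset.subset_insert _ _))
      (fun s hs => hu s (Finset.mem_insert_of_mem hs))
      (fun s hs => hn s (Finset.mem_insert_of_mem hs))
    have hd : Disjoint (S.sup id) u :=
      (hS (Finset.subset_insert u S) (Finset.mem_insert_self u S) hus).symm
    have hess : ∀ y ≤ u, Disjoint y (u ⊓ n) → y = ⊥ := fun y hy hyn =>
      ((hu u (Finset.mem_insert_self _ _)).2 _ _ hy inf_le_left hyn).resolve_right fun h =>
        hn u (Finset.mem_insert_self _ _) (disjoint_iff.2 h)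
    have hess' : ∀ y ≤ S.sup id, Disjoint y (S.sup id ⊓ n) → y = ⊥ := fun y hy hyn =>
      ih' y hy (disjoint_iff.2 (by
        rw [disjoint_iff, ← inf_assoc, inf_eq_left.2 hy] at hyn; exact hyn))
    rw [Finset.sup_insert, id, sup_comm] at hz
    -- The two summands are shrunk one at a time: `S.sup id` to its meet with `n` here, and then `u`
    -- to `u ⊓ n`. Both meets lie below `n`, from which `z` is disjoint.
    refine eq_bot_of_disjoint_sup_of_essential hd inf_le_left hess' hz ?_
    rw [disjoint_iff]
    refine eq_bot_of_disjoint_sup_of_essential (x := u) (u := S.sup id ⊓ n) (a := u ⊓ n)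
      (hd.symm.mono_right inf_le_left) inf_le_left hess (inf_le_right.trans_eq (sup_comm _ _)) ?_
    exact hzn.mono inf_le_left (sup_le inf_le_right inf_le_right)

/-- If `⊤` is the join of an independent set of `r` uniform elements, then independent sets of
elements different from `⊥` have at most `r` members. -/
theorem card_le_card_of_supIndep_of_uniform [IsModularLattice L] {S Y : Finset L}
    (hS : S.SupIndep id) (htop : S.sup id = ⊤) (hu : ∀ s ∈ S, UniformElement s)
    (hY : Y.SupIndep id) (hb : ⊥ ∉ Y) : Y.card ≤ S.card := by
  classical
  induction hk : (Y \ S).card generalizing Y with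
  | zero =>
    exact Finset.card_le_card (Finset.sdiff_eq_empty_iff_subset.1 (Finset.card_eq_zero.1 hk))
  | succ k ih =>
    obtain ⟨y, hy⟩ := Finset.card_pos.1 (by omega : 0 < (Y \ S).card)
    obtain ⟨hyY, hyS⟩ := Finset.mem_sdiff.1 hy
    have hyd : Disjoint y ((Y.erase y).sup id) :=
      hY (Finset.erase_subset _ _) hyY (Finset.notMem_erase _ _)
    -- Exchange step: if every member of `S` met the join of `Y` without `y`, that join would be
    -- essential in `⊤`, but `y` is disjoint from it. Trading `y` for `s` keeps the size and brings
    -- `Y` closer to `S`.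
    obtain ⟨s, hs, hsd⟩ : ∃ s ∈ S, Disjoint s ((Y.erase y).sup id) := by
      by_contra! hcon
      refine hb ?_
      rw [← eq_bot_of_disjoint_of_meets_uniform hS hu hcon y (by rw [htop]; exact le_top) hyd]
      exact hyY
    have hsY : s ∉ Y.erase y := fun h =>
      (hu s hs).1 (hsd.eq_bot_of_le (Finset.le_sup (f := id) h))
    have hcard : (insert s (Y.erase y)).card = Y.card := by
      rw [Finset.card_insert_of_notMem hsY, Finset.card_erase_add_one hyY]
    rw [← hcard]
    refine ih ((hY.subset (Finset.erase_subset _ _)).insert hsd) ?_ ?_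
    · simp only [Finset.mem_insert, not_or]
      exact ⟨fun h => (hu s hs).1 h.symm, fun h => hb (Finset.mem_of_mem_erase h)⟩
    · have : insert s (Y.erase y) \ S = (Y \ S).erase y := by
        ext t
        simp only [Finset.mem_sdiff, Finset.mem_insert, Finset.mem_erase]
        constructor
        · rintro ⟨rfl | h, h'⟩
          · exact absurd hs h'
          · exact ⟨h.1, h.2, h'⟩
        · rintro ⟨h, h', h''⟩
          exact ⟨Or.inr ⟨h, h'⟩, h''⟩
      rw [this, Finset.card_erase_of_mem hy, hk]
      rfl

/-- The members of the decomposition of the dual lattice that corresponds to a decomposition. -/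
theorem inf_sup_erase_eq_sup_sdiff [IsModularLattice L] [DecidableEq L] {S T : Finset L}
    (hS : S.SupIndep id) (htop : S.sup id = ⊤) (hT : T ⊆ S) :
    T.inf (fun s => (S.erase s).sup id) = (S \ T).sup id := by
  induction T using Finset.induction with
  | empty => simp [htop]
  | insert t T ht ih =>
    rw [Finset.inf_insert, ih ((Finset.subset_insert _ _).trans hT)]
    have htS : t ∈ S := hT (Finset.mem_insert_self _ _)
    have h1 : S \ T = insert t (S \ insert t T) := by
      ext s
      simp only [Finset.mem_sdiff, Finset.mem_insert]
      by_cases h : s = t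
      · subst h; simp [htS, ht]
      · simp [h]
    have h2 : (S \ insert t T).sup id ≤ (S.erase t).sup id := by
      refine Finset.sup_mono fun s hs => ?_
      simp only [Finset.mem_sdiff, Finset.mem_insert, not_or] at hs
      exact Finset.mem_erase.2 ⟨hs.2.1, hs.1⟩
    have h3 : Disjoint t ((S.erase t).sup id) :=
      hS (Finset.erase_subset _ _) htS (Finset.notMem_erase _ _)
    rw [h1, Finset.sup_insert, id, inf_comm, sup_comm, sup_inf_assoc_of_le _ h2, h3.eq_bot, sup_bot_eq]

/-- A decomposition of `⊤` gives one of the same size in the dual lattice, with isomorphic upper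
intervals in place of lower intervals. -/
theorem exists_dual_decomposition [IsModularLattice L] {S : Finset L} (hS : S.SupIndep id)
    (htop : S.sup id = ⊤) (hb : ⊥ ∉ S) :
    ∃ S' : Finset Lᵒᵈ, S'.SupIndep id ∧ S'.sup id = ⊤ ∧ S'.card = S.card ∧
      ∀ s' ∈ S', ∃ s ∈ S, IsCompl s (OrderDual.ofDual s') := by
  classical
  have hd : ∀ s ∈ S, Disjoint s ((S.erase s).sup id) := fun s hs =>
    hS (Finset.erase_subset _ _) hs (Finset.notMem_erase _ _)
  have hc : ∀ s ∈ S, s ⊔ (S.erase s).sup id = ⊤ := fun s hs => by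
    rw [← htop, ← Finset.insert_erase hs, Finset.sup_insert, Finset.insert_erase hs]; rfl
  have hinj : Set.InjOn (fun s : L => OrderDual.toDual ((S.erase s).sup id)) S := by
    intro s hs t ht hst
    by_contra hne
    have h1 : s ≤ (S.erase s).sup id := by
      rw [OrderDual.toDual_inj.1 hst]
      exact Finset.le_sup (f := id) (Finset.mem_erase.2 ⟨hne, hs⟩)
    exact hb ((hd s hs).eq_bot_of_le h1 ▸ hs)
  -- Each member is replaced by the join of all the others, which is a complement of it.
  refine ⟨S.image fun s => OrderDual.toDual ((S.erase s).sup id), ?_, ?_,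
    Finset.card_image_of_injOn hinj, ?_⟩
  · rw [Finset.supIndep_iff_disjoint_erase]
    intro i hi
    obtain ⟨s, hs, rfl⟩ := Finset.mem_image.1 hi
    rw [disjoint_iff]
    change (S.erase s).sup id ⊔ OrderDual.ofDual _ = (⊤ : L)
    refine top_le_iff.1 ((hc s hs).symm.le.trans ?_)
    rw [sup_comm]
    refine sup_le_sup_left ?_ _
    change Finset.sup (α := Lᵒᵈ) _ id ≤ OrderDual.toDual s
    refine Finset.sup_le fun j hj => ?_
    obtain ⟨hji, hj⟩ := Finset.mem_erase.1 hj
    obtain ⟨t, ht, rfl⟩ := Finset.mem_image.1 hj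
    have : s ≠ t := fun h => hji (by rw [h])
    change s ≤ (S.erase t).sup id
    exact Finset.le_sup (f := id) (Finset.mem_erase.2 ⟨this, hs⟩)
  · rw [Finset.sup_image]
    have := inf_sup_erase_eq_sup_sdiff hS htop subset_rfl
    rw [Finset.sdiff_self, Finset.sup_empty] at this
    exact this
  · intro i hi
    obtain ⟨s, hs, rfl⟩ := Finset.mem_image.1 hi
    exact ⟨s, hs, hd s hs, codisjoint_iff.2 (hc s hs)⟩

end ModularLattice

namespace QuiverRep

variable {k : Type u} [Field k] {V : Type w} [Quiver.{v} V]

/-! ### The lattice of subrepresentations -/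

section SubLattice

variable {X : QuiverRep k V}

theorem Sub.carrier_injective : Function.Injective (Sub.carrier : Sub X → _) := by
  rintro ⟨A, hA⟩ ⟨B, hB⟩ h
  congr

instance : LE (Sub X) := ⟨fun A B => A.carrier ≤ B.carrier⟩
instance : LT (Sub X) := ⟨fun A B => A.carrier < B.carrier⟩

instance : Max (Sub X) :=
  ⟨fun A B => ⟨fun a => A.carrier a ⊔ B.carrier a, fun f x hx => by
    obtain ⟨y, hy, z, hz, rfl⟩ := Submodule.mem_sup.1 hx
    rw [map_add]
    exact Submodule.add_mem_sup (A.map_mem f y hy) (B.map_mem f z hz)⟩⟩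

instance : Min (Sub X) :=
  ⟨fun A B => ⟨fun a => A.carrier a ⊓ B.carrier a,
    fun f x hx => ⟨A.map_mem f x hx.1, B.map_mem f x hx.2⟩⟩⟩

instance : Top (Sub X) := ⟨⟨fun _ => ⊤, fun _ _ _ => trivial⟩⟩

instance : Bot (Sub X) :=
  ⟨⟨fun _ => ⊥, fun f x hx => by rw [Submodule.mem_bot] at hx ⊢; rw [hx, map_zero]⟩⟩

instance : Lattice (Sub X) :=
  Sub.carrier_injective.lattice _ Iff.rfl Iff.rfl (fun _ _ => rfl) (fun _ _ => rfl)

instance : BoundedOrder (Sub X) :=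
  BoundedOrder.lift Sub.carrier (fun _ _ h => h) rfl rfl

instance : IsModularLattice (Sub X) where
  sup_inf_le_assoc_of_le B _ h := fun a =>
    IsModularLattice.sup_inf_le_assoc_of_le (B.carrier a) (h a)

theorem Sub.eq_bot_iff {A : Sub X} : A = ⊥ ↔ ∀ a, A.carrier a = ⊥ :=
  ⟨fun h a => by rw [h]; rfl, fun h => Sub.carrier_injective (funext h)⟩

theorem Sub.eq_top_iff {A : Sub X} : A = ⊤ ↔ ∀ a, A.carrier a = ⊤ :=
  ⟨fun h a => by rw [h]; rfl, fun h => Sub.carrier_injective (funext h)⟩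

theorem Sub.disjoint_iff {A B : Sub X} :
    Disjoint A B ↔ ∀ a, Disjoint (A.carrier a) (B.carrier a) := by
  rw [_root_.disjoint_iff, Sub.eq_bot_iff]
  exact forall_congr' fun a => _root_.disjoint_iff.symm

theorem Sub.codisjoint_iff {A B : Sub X} :
    Codisjoint A B ↔ ∀ a, Codisjoint (A.carrier a) (B.carrier a) := by
  rw [_root_.codisjoint_iff, Sub.eq_top_iff]
  exact forall_congr' fun a => _root_.codisjoint_iff.symm

theorem Sub.isCompl_iff {A B : Sub X} :
    IsCompl A B ↔ ∀ a, IsCompl (A.carrier a) (B.carrier a) := by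
  simp only [_root_.isCompl_iff, Sub.disjoint_iff, Sub.codisjoint_iff, forall_and]

theorem Sub.carrier_finset_sup {ι : Type*} (T : Finset ι) (f : ι → Sub X) (a : V) :
    (T.sup f).carrier a = T.sup fun i => (f i).carrier a :=
  Finset.apply_sup_eq_sup_comp (fun A : Sub X => A.carrier a) (fun _ _ => rfl) rfl

theorem Sub.supIndep_iff {ι : Type*} (T : Finset ι) (f : ι → Sub X) :
    T.SupIndep f ↔ ∀ a, T.SupIndep fun i => (f i).carrier a := by
  simp only [Finset.SupIndep, Sub.disjoint_iff, Sub.carrier_finset_sup]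
  exact ⟨fun h a t ht i hi hit => h ht hi hit a, fun h t ht i hi hit a => h a ht hi hit⟩

/-- The total dimension of a representation. -/
noncomputable def Sub.dim [Finite V] (A : Sub X) : ℕ :=
  ∑ᶠ a, Module.finrank k (A.carrier a)

theorem Sub.dim_strictMono [Finite V] : StrictMono (Sub.dim : Sub X → ℕ) := by
  intro A B h
  have := Fintype.ofFinite V
  rw [Sub.dim, Sub.dim, finsum_eq_sum_of_fintype, finsum_eq_sum_of_fintype]
  obtain ⟨hle, a, ha⟩ := Pi.lt_def.1 (show A.carrier < B.carrier from h)
  exact Finset.sum_lt_sum (fun b _ => Submodule.finrank_mono (hle b))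
    ⟨a, Finset.mem_univ _, Submodule.finrank_lt_finrank_of_lt ha⟩

instance [Finite V] : WellFoundedLT (Sub X) := Sub.dim_strictMono.wellFoundedLT

theorem isIndecomposable_iff : X.IsIndecomposable ↔ IndecElement (⊤ : Sub X) := by
  refine and_congr ?_ ?_
  · rw [Ne, Sub.eq_bot_iff, not_forall]
    refine exists_congr fun a => ?_
    change _ ↔ ¬ ((⊤ : Submodule k (X.obj a)) = ⊥)
    rw [eq_comm, ← Ne, Ne, subsingleton_iff_bot_eq_top.not, Submodule.subsingleton_iff,
      not_subsingleton_iff_nontrivial]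
  · refine forall₂_congr fun A B => ?_
    rw [← Sub.isCompl_iff, Sub.eq_bot_iff, Sub.eq_bot_iff]
    exact ⟨fun h h1 h2 => h ⟨h1, _root_.codisjoint_iff.2 h2⟩, fun h h' => h h'.1 h'.sup_eq_top⟩

/-! ### Subrepresentations of subrepresentations and of quotients -/

/-- A subrepresentation of a subrepresentation, as a subrepresentation. -/
def Sub.inclusion (U : Sub X) (A : Sub U.rep) : Sub X where
  carrier a := (A.carrier a).map (U.carrier a).subtype
  map_mem f x hx := by
    obtain ⟨y, hy, rfl⟩ := hx
    exact ⟨_, A.map_mem f y hy, rfl⟩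

/-- The subrepresentations of `U` are the subrepresentations of `X` contained in `U`. -/
def Sub.repIso (U : Sub X) : Sub U.rep ≃o Set.Iic U where
  toFun A := ⟨U.inclusion A, fun a => Submodule.map_subtype_le _ _⟩
  invFun B :=
    { carrier := fun a => (B.1.carrier a).comap (U.carrier a).subtype
      map_mem := fun f x hx => B.1.map_mem f x.1 hx }
  left_inv A := Sub.carrier_injective (funext fun a =>
    Submodule.comap_map_eq_of_injective (U.carrier a).subtype_injective _)
  right_inv B := Subtype.ext (Sub.carrier_injective (funext fun a => by
    change Submodule.map _ (Submodule.comap _ _) = _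
    rw [Submodule.map_comap_subtype]
    exact inf_eq_right.2 (B.2 a)))
  map_rel_iff' {A B} := forall_congr' fun a =>
    Submodule.map_le_map_iff_of_injective (U.carrier a).subtype_injective _ _

/-- The subrepresentations of `X / U` are the subrepresentations of `X` containing `U`. -/
def Sub.quotIso (U : Sub X) : Sub U.quot ≃o Set.Ici U where
  toFun A := ⟨⟨fun a => (A.carrier a).comap (U.carrier a).mkQ, fun f x hx => A.map_mem f _ hx⟩,
    fun a => Submodule.le_comap_mkQ _ _⟩
  invFun B :=
    { carrier := fun a => (B.1.carrier a).map (U.carrier a).mkQ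
      map_mem := fun f x hx => by
        obtain ⟨y, hy, rfl⟩ := hx
        exact ⟨_, B.1.map_mem f y hy, rfl⟩ }
  left_inv A := Sub.carrier_injective (funext fun a =>
    Submodule.map_comap_eq_of_surjective (U.carrier a).mkQ_surjective _)
  right_inv B := Subtype.ext (Sub.carrier_injective (funext fun a => by
    change Submodule.comap _ (Submodule.map _ _) = _
    rw [Submodule.comap_map_mkQ]
    exact sup_eq_right.2 (B.2 a)))
  map_rel_iff' {A B} := forall_congr' fun a =>
    Submodule.comap_le_comap_iff_of_surjective (U.carrier a).mkQ_surjective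

end SubLattice

end QuiverRep

/-! ### Indecomposable and uniform elements in lower intervals -/

section Intervals

variable {L : Type*} [Lattice L] [BoundedOrder L]

theorem indecElement_top_Iic {u : L} : IndecElement (⊤ : Set.Iic u) ↔ IndecElement u := by
  constructor
  · rintro ⟨h1, h2⟩
    refine ⟨fun h => h1 (Subtype.ext h), fun b c hbc hs => ?_⟩
    have hb : b ≤ u := by rw [← hs]; exact le_sup_left
    have hc : c ≤ u := by rw [← hs]; exact le_sup_right
    have := h2 ⟨b, hb⟩ ⟨c, hc⟩ (disjoint_iff.2 (Subtype.ext hbc.eq_bot)) (Subtype.ext hs)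
    exact this.imp (congrArg Subtype.val) (congrArg Subtype.val)
  · rintro ⟨h1, h2⟩
    refine ⟨fun h => h1 (congrArg Subtype.val h), fun b c hbc hs => ?_⟩
    have := h2 b.1 c.1 (disjoint_iff.2 (congrArg Subtype.val hbc.eq_bot))
      (congrArg Subtype.val hs)
    exact this.imp (fun h => Subtype.ext h) (fun h => Subtype.ext h)

theorem uniformElement_top_Iic {u : L} : UniformElement (⊤ : Set.Iic u) ↔ UniformElement u := by
  constructor
  · rintro ⟨h1, h2⟩
    refine ⟨fun h => h1 (Subtype.ext h), fun b c hb hc hbc => ?_⟩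
    have := h2 ⟨b, hb⟩ ⟨c, hc⟩ le_top le_top (disjoint_iff.2 (Subtype.ext hbc.eq_bot))
    exact this.imp (congrArg Subtype.val) (congrArg Subtype.val)
  · rintro ⟨h1, h2⟩
    refine ⟨fun h => h1 (congrArg Subtype.val h), fun b c _ _ hbc => ?_⟩
    have := h2 b.1 c.1 b.2 c.2 (disjoint_iff.2 (congrArg Subtype.val hbc.eq_bot))
    exact this.imp (fun h => Subtype.ext h) (fun h => Subtype.ext h)

end Intervals

namespace QuiverRep

variable {k : Type u} [Field k] {V : Type w} [Quiver.{v} V] {X : QuiverRep k V}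

/-! ### The number of indecomposable summands -/

theorem Sub.isIndecomposable_rep_iff {U : Sub X} : U.rep.IsIndecomposable ↔ IndecElement U := by
  rw [isIndecomposable_iff, ← indecElement_top_Iic (u := U)]
  refine ⟨fun h => ?_, fun h => ?_⟩
  · simpa using h.map_orderIso U.repIso
  · simpa using h.map_orderIso U.repIso.symm

/-- An indexed family loses nothing when replaced by the set of its members: two equal members would
be disjoint from each other, hence zero, and indecomposables are nonzero. -/
theorem hasDecomposition_iff {n : ℕ} :
    X.HasDecomposition n ↔ ∃ S : Finset (Sub X), IsDecomposition S ⊤ ∧ S.card = n := by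
  classical
  have key : ∀ U : Fin n → Sub X,
      (∀ a, DirectSum.IsInternal (fun i => (U i).carrier a)) ↔
        Finset.univ.SupIndep U ∧ Finset.univ.sup U = ⊤ := by
    intro U
    simp only [DirectSum.isInternal_submodule_iff_iSupIndep_and_iSup_eq_top,
      iSupIndep_iff_supIndep_univ, Sub.supIndep_iff, Sub.eq_top_iff, Sub.carrier_finset_sup,
      Finset.sup_univ_eq_iSup, forall_and]
  constructor
  · rintro ⟨U, hU, hint⟩
    obtain ⟨h1, h2⟩ := (key U).1 hint
    simp only [Sub.isIndecomposable_rep_iff] at hU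
    have hinj : Function.Injective U := by
      intro i j hij
      by_contra hne
      have hd : Disjoint (U i) (U j) :=
        h1.pairwiseDisjoint (Finset.mem_univ i) (Finset.mem_univ j) hne
      rw [← hij, disjoint_self] at hd
      exact (hU i).1 hd
    refine ⟨Finset.univ.image U, ⟨Finset.SupIndep.image (f := id) h1, ?_, ?_⟩, ?_⟩
    · rwa [Finset.sup_image]
    · simpa using hU
    · rw [Finset.card_image_of_injective _ hinj, Finset.card_fin]
  · rintro ⟨S, ⟨h1, h2, h3⟩, rfl⟩
    let g : Fin S.card ↪ Sub X := S.equivFin.symm.toEmbedding.trans (Function.Embedding.subtype _)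
    have hg : Finset.univ.map g = S := by
      ext s
      simp only [Finset.mem_map, Finset.mem_univ, true_and]
      exact ⟨fun ⟨i, hi⟩ => hi ▸ (S.equivFin.symm i).2,
        fun hs => ⟨S.equivFin ⟨s, hs⟩, by simp [g]⟩⟩
    refine ⟨g, fun i => Sub.isIndecomposable_rep_iff.2 (h3 _ (S.equivFin.symm i).2),
      (key g).2 ⟨?_, ?_⟩⟩
    · rw [← hg, Finset.supIndep_map] at h1
      exact h1
    · rw [← hg, Finset.sup_map] at h2
      exact h2

/-- The infimum defining s(X) is attained. The estimates below hold for whichever decomposition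
attains it, so uniqueness of the number of summands (Krull–Schmidt) is not needed. -/
theorem exists_decomposition [Finite V] (X : QuiverRep k V) :
    ∃ S : Finset (Sub X), IsDecomposition S ⊤ ∧ S.card = X.numSummands := by
  obtain ⟨S, hS⟩ := exists_isDecomposition (⊤ : Sub X)
  have hne : {n | X.HasDecomposition n}.Nonempty := ⟨_, hasDecomposition_iff.2 ⟨S, hS, rfl⟩⟩
  exact hasDecomposition_iff.1 (Nat.sInf_mem hne)

theorem bot_notMem_of_isDecomposition {L : Type*} [Lattice L] [BoundedOrder L] {S : Finset L}
    {a : L} (h : IsDecomposition S a) : ⊥ ∉ S := fun hb => (h.2.2 ⊥ hb).1 rfl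

/-- A representation that is neither zero nor indecomposable has at least two summands. -/
theorem two_le_numSummands [Finite V] {A B : Sub X} (hAB : IsCompl A B) (hA : A ≠ ⊥)
    (hB : B ≠ ⊥) : 2 ≤ X.numSummands := by
  obtain ⟨S, ⟨-, h2, h3⟩, hc⟩ := exists_decomposition X
  rw [← hc]
  by_contra! hlt
  have hcard : S.card = 0 ∨ S.card = 1 := by omega
  rcases hcard with h | h
  · rw [Finset.card_eq_zero.1 h, Finset.sup_empty] at h2
    exact hA (eq_bot_iff.2 (by rw [h2]; exact le_top))
  · obtain ⟨s, rfl⟩ := Finset.card_eq_one.1 h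
    rw [Finset.sup_singleton, id] at h2
    have := h3 s (Finset.mem_singleton_self s)
    rw [h2] at this
    exact (this.2 A B hAB.disjoint hAB.sup_eq_top).elim hA hB

theorem numSummands_le_one (h : IndecElement (⊤ : Sub X)) : X.numSummands ≤ 1 :=
  Nat.sInf_le (hasDecomposition_iff.2 ⟨{⊤}, ⟨by simp, by simp, by simpa using h⟩, by simp⟩)

/-- An isomorphism of representations induces one of the lattices of subrepresentations. -/
def Iso.subIso {Y : QuiverRep k V} (e : Iso X Y) : Sub X ≃o Sub Y where
  toFun A :=
    { carrier := fun a => (A.carrier a).map (e.equiv a).toLinearMap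
      map_mem := fun f x hx => by
        obtain ⟨y, hy, rfl⟩ := hx
        exact ⟨X.map f y, A.map_mem f y hy, e.comm f y⟩ }
  invFun B :=
    { carrier := fun a => (B.carrier a).comap (e.equiv a).toLinearMap
      map_mem := fun {a b} f x hx => by
        change e.equiv b (X.map f x) ∈ B.carrier b
        rw [e.comm]
        exact B.map_mem f _ hx }
  left_inv A := Sub.carrier_injective (funext fun a =>
    Submodule.comap_map_eq_of_injective (e.equiv a).injective _)
  right_inv B := Sub.carrier_injective (funext fun a =>
    Submodule.map_comap_eq_of_surjective (e.equiv a).surjective _)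
  map_rel_iff' {A B} := forall_congr' fun a =>
    Submodule.map_le_map_iff_of_injective (e.equiv a).injective _ _

theorem supIndep_image {L L' : Type*} [Lattice L] [BoundedOrder L] [Lattice L'] [BoundedOrder L']
    [DecidableEq L'] {f : L → L'} (hsup : ∀ a b, f (a ⊔ b) = f a ⊔ f b) (hbot : f ⊥ = ⊥)
    (hd : ∀ a b, Disjoint a b → Disjoint (f a) (f b)) {T : Finset L} (hT : T.SupIndep id) :
    (T.image f).SupIndep id := by
  refine Finset.SupIndep.image fun t ht i hi hit => ?_
  have : t.sup (id ∘ f) = f (t.sup id) := (Finset.apply_sup_eq_sup_comp f hsup hbot).symm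
  rw [this]
  exact hd _ _ (hT ht hi hit)

theorem _root_.IsDecomposition.map_orderIso {L L' : Type*} [Lattice L] [BoundedOrder L] [Lattice L']
    [BoundedOrder L'] [DecidableEq L'] (e : L ≃o L') {S : Finset L} (hS : IsDecomposition S ⊤) :
    IsDecomposition (S.image e) ⊤ := by
  refine ⟨supIndep_image (map_sup e) (map_bot e) (fun _ _ h => (disjoint_map_orderIso_iff e).2 h)
    hS.1, ?_, ?_⟩
  · rw [Finset.sup_image, Function.id_comp]
    have := Finset.apply_sup_eq_sup_comp (s := S) (f := id) e (map_sup e) (map_bot e)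
    rw [hS.2.1, map_top] at this
    exact this.symm
  · intro s hs
    obtain ⟨t, ht, rfl⟩ := Finset.mem_image.1 hs
    exact (hS.2.2 t ht).map_orderIso e

theorem Iso.hasDecomposition {Y : QuiverRep k V} (e : Iso X Y) {n : ℕ}
    (h : X.HasDecomposition n) : Y.HasDecomposition n := by
  classical
  obtain ⟨S, hS, rfl⟩ := hasDecomposition_iff.1 h
  exact hasDecomposition_iff.2 ⟨S.image e.subIso, hS.map_orderIso _,
    Finset.card_image_of_injective _ e.subIso.injective⟩

theorem Iso.numSummands_eq {Y : QuiverRep k V} (e : Iso X Y) : X.numSummands = Y.numSummands := by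
  unfold numSummands
  congr 1
  ext n
  exact ⟨e.hasDecomposition, e.symm.hasDecomposition⟩

/-- If all indecomposable representations are uniform, then subrepresentations have at most as
many summands as the representation. -/
theorem Sub.numSummands_rep_le [Finite V]
    (hV : ∀ Y : QuiverRep k V, IndecElement (⊤ : Sub Y) → UniformElement (⊤ : Sub Y)) (U : Sub X) :
    U.rep.numSummands ≤ X.numSummands := by
  classical
  obtain ⟨S, hS, hSc⟩ := exists_decomposition X
  obtain ⟨T, hT, hTc⟩ := exists_decomposition U.rep
  rw [← hSc, ← hTc]
  have hinj : Function.Injective fun A : Sub U.rep => (U.repIso A : Sub X) :=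
    Subtype.val_injective.comp U.repIso.injective
  rw [← Finset.card_image_of_injective T hinj]
  -- A decomposition of `U` is, inside `X`, an independent set of nonzero elements, to be compared
  -- with the uniform members of a decomposition of `X`.
  refine card_le_card_of_supIndep_of_uniform hS.1 hS.2.1 (fun s hs => ?_)
    (supIndep_image (fun A B => ?_) ?_ (fun A B h => ?_) hT.1) ?_
  · have h1 := hV s.rep (isIndecomposable_iff.1 (Sub.isIndecomposable_rep_iff.2 (hS.2.2 s hs)))
    rw [← uniformElement_top_Iic]
    simpa using h1.map_orderIso s.repIso
  · rw [map_sup]; rfl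
  · rw [map_bot]; rfl
  · exact _root_.disjoint_iff.2
      (congrArg Subtype.val ((disjoint_map_orderIso_iff U.repIso).2 h).eq_bot)
  · rw [Finset.mem_image]
    rintro ⟨A, hA, h⟩
    have : A = ⊥ := hinj (h.trans (congrArg Subtype.val (map_bot U.repIso)).symm)
    exact bot_notMem_of_isDecomposition hT (this ▸ hA)

/-- If all indecomposable representations are uniform for the dual order, then quotients have at
most as many summands as the representation. -/
theorem Sub.numSummands_quot_le [Finite V]
    (hV : ∀ Y : QuiverRep k V, IndecElement (⊤ : Sub Y) → UniformElement (⊤ : (Sub Y)ᵒᵈ))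
    (U : Sub X) : U.quot.numSummands ≤ X.numSummands := by
  classical
  obtain ⟨S, hS, hSc⟩ := exists_decomposition X
  obtain ⟨T, hT, hTc⟩ := exists_decomposition U.quot
  -- Quotients correspond to upper intervals, so both decompositions are moved to the dual lattices,
  -- where upper intervals become lower ones.
  obtain ⟨S', hS1, hS2, hS3, hS4⟩ :=
    exists_dual_decomposition hS.1 hS.2.1 (bot_notMem_of_isDecomposition hS)
  obtain ⟨T', hT1, hT2, hT3, hT4⟩ :=
    exists_dual_decomposition hT.1 hT.2.1 (bot_notMem_of_isDecomposition hT)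
  let f : (Sub U.quot)ᵒᵈ → (Sub X)ᵒᵈ := fun A => OrderDual.toDual (U.quotIso (OrderDual.ofDual A)).1
  have hinj : Function.Injective f := Subtype.val_injective.comp U.quotIso.injective
  rw [← hSc, ← hTc, ← hS3, ← hT3, ← Finset.card_image_of_injective T' hinj]
  have hbot : f ⊥ = ⊥ := by
    change (U.quotIso ⊤).1 = ⊤
    rw [map_top]; rfl
  refine card_le_card_of_supIndep_of_uniform hS1 hS2 (fun s' hs' => ?_)
    (supIndep_image (fun A B => ?_) hbot (fun A B h => ?_) hT1) ?_
  · obtain ⟨s, hs, hss⟩ := hS4 s' hs'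
    obtain ⟨h0, h1⟩ := hV s.rep
      (isIndecomposable_iff.1 (Sub.isIndecomposable_rep_iff.2 (hS.2.2 s hs)))
    -- As `s` is a complement of `s'`, the diamond isomorphism identifies the interval below `s`
    -- with the one above `s'`. This transports uniformity of the dual of `Sub s.rep` to `s'`.
    let e : Sub s.rep ≃o Set.Ici (OrderDual.ofDual s') := s.repIso.trans hss.IicOrderIsoIci
    refine ⟨fun h => ?_, fun b c hb hc hbc => ?_⟩
    · refine h0 ?_
      have h2 : OrderDual.ofDual s' = ⊤ := h
      have : (⊤ : Set.Ici (OrderDual.ofDual s')) = ⊥ := Subtype.ext h2.symm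
      have h3 : (⊤ : Sub s.rep) = ⊥ := e.injective (by rw [map_top, map_bot, this])
      exact h3.symm
    · have := h1 (OrderDual.toDual (e.symm ⟨OrderDual.ofDual b, hb⟩))
        (OrderDual.toDual (e.symm ⟨OrderDual.ofDual c, hc⟩)) le_top le_top ?_
      · refine this.imp (fun h => ?_) (fun h => ?_)
        · have h' : e.symm ⟨OrderDual.ofDual b, hb⟩ = ⊤ := h
          rw [map_eq_top_iff] at h'
          exact congrArg Subtype.val h'
        · have h' : e.symm ⟨OrderDual.ofDual c, hc⟩ = ⊤ := h
          rw [map_eq_top_iff] at h'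
          exact congrArg Subtype.val h'
      · rw [_root_.disjoint_iff]
        change e.symm _ ⊔ e.symm _ = ⊤
        rw [← map_sup, map_eq_top_iff]
        exact Subtype.ext hbc.eq_bot
  · change (U.quotIso (OrderDual.ofDual A ⊓ OrderDual.ofDual B)).1 = _
    rw [map_inf]; rfl
  · rw [_root_.disjoint_iff]
    have h1 : OrderDual.ofDual A ⊔ OrderDual.ofDual B = ⊤ := h.eq_bot
    have h2 := congrArg Subtype.val (congrArg U.quotIso h1)
    rw [map_sup, map_top] at h2
    exact h2
  · rw [Finset.mem_image]
    rintro ⟨A, hA, h⟩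
    have : A = ⊥ := hinj (h.trans hbot.symm)
    subst this
    obtain ⟨t, ht, htt⟩ := hT4 _ hA
    have : t = ⊥ := by simpa using htt.disjoint
    exact bot_notMem_of_isDecomposition hT (this ▸ ht)

/-- The lattice of subrepresentations of a subrepresentation which is the join of two disjoint
nonzero ones. -/
theorem Sub.two_le_numSummands_rep [Finite V] {U A B : Sub X} (hd : A ⊓ B = ⊥) (hs : A ⊔ B = U)
    (hA : A ≠ ⊥) (hB : B ≠ ⊥) : 2 ≤ U.rep.numSummands := by
  let A' : Set.Iic U := ⟨A, by rw [← hs]; exact le_sup_left (a := A)⟩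
  let B' : Set.Iic U := ⟨B, by rw [← hs]; exact le_sup_right (b := B)⟩
  have h : IsCompl A' B' := ⟨_root_.disjoint_iff.2 (Subtype.ext hd),
    _root_.codisjoint_iff.2 (Subtype.ext hs)⟩
  refine two_le_numSummands (U.repIso.symm.isCompl h) ?_ ?_
  · rw [Ne, map_eq_bot_iff]; exact fun h => hA (congrArg Subtype.val h)
  · rw [Ne, map_eq_bot_iff]; exact fun h => hB (congrArg Subtype.val h)

theorem Sub.two_le_numSummands_quot [Finite V] {U A B : Sub X} (hd : A ⊓ B = U) (hs : A ⊔ B = ⊤)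
    (hA : A ≠ U) (hB : B ≠ U) : 2 ≤ U.quot.numSummands := by
  let A' : Set.Ici U := ⟨A, by rw [← hd]; exact inf_le_left (a := A)⟩
  let B' : Set.Ici U := ⟨B, by rw [← hd]; exact inf_le_right (b := B)⟩
  have h : IsCompl A' B' := ⟨_root_.disjoint_iff.2 (Subtype.ext hd),
    _root_.codisjoint_iff.2 (Subtype.ext hs)⟩
  refine two_le_numSummands (U.quotIso.symm.isCompl h) ?_ ?_
  · rw [Ne, map_eq_bot_iff]; exact fun h => hA (congrArg Subtype.val h)
  · rw [Ne, map_eq_bot_iff]; exact fun h => hB (congrArg Subtype.val h)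

end QuiverRep

/-! ### Ideals and subrings of the Hall algebra -/

namespace QuiverRep

variable {k : Type u} [Field k] {V : Type w} [Quiver.{v} V] {X Y : QuiverRep k V}

/-- A subrepresentation is isomorphic to its image under an isomorphism. -/
def Iso.repIso (e : Iso X Y) (U : Sub X) : Iso U.rep (e.subIso U).rep where
  equiv a := (e.equiv a).submoduleMap (U.carrier a)
  comm f x := Subtype.ext (e.comm f x.1)

/-- The quotients by corresponding subrepresentations are isomorphic. -/
def Iso.quotIso (e : Iso X Y) (U : Sub X) : Iso U.quot (e.subIso U).quot where
  equiv a := Submodule.Quotient.equiv (U.carrier a) ((e.subIso U).carrier a) (e.equiv a) rfl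
  comm {a b} f x := by
    obtain ⟨y, rfl⟩ := Submodule.Quotient.mk_surjective _ x
    exact congrArg ((e.subIso U).carrier b).mkQ (e.comm f y)

instance [Finite k] [Finite V] : Finite (Sub X) := by
  have : ∀ a, Finite (X.obj a) := fun a => Module.finite_of_finite k
  have : ∀ a, Finite (Submodule k (X.obj a)) := fun a =>
    Finite.of_injective (fun p => (p : Set (X.obj a))) SetLike.coe_injective
  exact Finite.of_injective _ Sub.carrier_injective

/-- The isomorphism class of a representation. -/
def toClass (X : QuiverRep k V) : IsoClass k V := Quotient.mk (isoSetoid k V) X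

theorem nonempty_iso_out (X : QuiverRep k V) : Nonempty (Iso X.toClass.out X) :=
  Quotient.exact (Quotient.out_eq X.toClass)

theorem exists_sub_of_hallNumber_ne_zero {M N : QuiverRep k V}
    (h : (hallNumber X M N : HallCoeff k) ≠ 0) :
    ∃ U : Sub X, Nonempty (Iso U.rep N) ∧ Nonempty (Iso U.quot M) := by
  have h0 : hallNumber X M N ≠ 0 := fun h' => h (by rw [h', Nat.cast_zero])
  obtain ⟨U⟩ := (Nat.card_ne_zero.1 h0).1
  exact ⟨U.1, U.2⟩

end QuiverRep

namespace HallAlgebra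

open QuiverRep

variable {k : Type u} [Field k] [Finite k] {V : Type w} [Quiver.{v} V] [Finite V]
  [∀ a b : V, Finite (a ⟶ b)]

/-- The classes form a basis and D_r is spanned by part of it, so membership is a condition on the
support. -/
theorem mem_D_iff {r : ℕ} {x : HallAlgebra k V} :
    x ∈ D k V r ↔ ∀ c, coeffs x c ≠ 0 → r + 1 ≤ c.out.numSummands := by
  have h1 : D k V r = (Finsupp.supported (HallCoeff k) (HallCoeff k)
      {c : IsoClass k V | r + 1 ≤ c.out.numSummands}).comap (coeffs (k := k) (V := V)).toLinearMap := by
    rw [Finsupp.supported_eq_span_single (R := HallCoeff k)]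
    change Submodule.span _ _ = Submodule.span _ _
    congr 1
    ext y
    constructor
    · rintro ⟨M, hM, rfl⟩; exact ⟨M, hM, rfl⟩
    · rintro ⟨M, hM, rfl⟩; exact ⟨M, hM, rfl⟩
  rw [h1, Submodule.mem_comap, Finsupp.mem_supported]
  exact ⟨fun h c hc => h (Finsupp.mem_support_iff.2 hc),
    fun h c hc => h c (Finsupp.mem_support_iff.1 hc)⟩

theorem cls_mem_D {r : ℕ} {M : IsoClass k V} (h : r + 1 ≤ M.out.numSummands) : cls M ∈ D k V r :=
  Submodule.subset_span ⟨M, h, rfl⟩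

theorem span_cls : Submodule.span (HallCoeff k) (Set.range (cls : IsoClass k V → _)) = ⊤ := by
  have : Submodule.span (HallCoeff k) (Set.range fun c : IsoClass k V =>
      (Finsupp.single c 1 : IsoClass k V →₀ HallCoeff k)) = ⊤ := by
    have := Finsupp.supported_eq_span_single (R := HallCoeff k)
      (Set.univ : Set (IsoClass k V))
    rw [Set.image_univ, Finsupp.supported_univ] at this
    exact this.symm
  exact this

theorem coeffs_clsMul (M N c : IsoClass k V) :
    coeffs (clsMul M N) c = (hallNumber c.out M.out N.out : HallCoeff k) := rfl

/-- Bilinearity reduces closure statements to products of basis elements. -/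
theorem mul_mem_of_span {S T : Set (HallAlgebra k V)}
    {P : Submodule (HallCoeff k) (HallAlgebra k V)} (h : ∀ x ∈ S, ∀ y ∈ T, x * y ∈ P)
    {x y : HallAlgebra k V} (hx : x ∈ Submodule.span (HallCoeff k) S)
    (hy : y ∈ Submodule.span (HallCoeff k) T) : x * y ∈ P := by
  have h1 : Submodule.span (HallCoeff k) T ≤ P.comap (mulHom k V x) := by
    refine Submodule.span_le.2 fun t ht => ?_
    have h2 : Submodule.span (HallCoeff k) S ≤ P.comap ((mulHom k V).flip t) :=
      Submodule.span_le.2 fun s hs => h s hs t ht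
    exact h2 hx
  exact h1 hy

/-- Every [X] occurring in [M] ⋄ [N] contains a copy of N, so s(X) ≥ s(N) ≥ r + 1. Only the right
factor matters; the next lemma uses the left factor in the same way. -/
theorem isSubring_D_of_rep_le
    (h : ∀ (X : QuiverRep k V) (U : Sub X), U.rep.numSummands ≤ X.numSummands) (r : ℕ) :
    IsSubring (D k V r) := by
  intro x hx y hy
  refine mul_mem_of_span ?_ hx hy
  rintro _ ⟨M, hM, rfl⟩ _ ⟨N, hN, rfl⟩
  rw [cls_mul_cls, mem_D_iff]
  intro c hc
  obtain ⟨U, ⟨e⟩, -⟩ := exists_sub_of_hallNumber_ne_zero hc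
  exact (hN.trans e.numSummands_eq.symm.le).trans (h _ U)

theorem isSubring_D_of_quot_le
    (h : ∀ (X : QuiverRep k V) (U : Sub X), U.quot.numSummands ≤ X.numSummands) (r : ℕ) :
    IsSubring (D k V r) := by
  intro x hx y hy
  refine mul_mem_of_span ?_ hx hy
  rintro _ ⟨M, hM, rfl⟩ _ ⟨N, hN, rfl⟩
  rw [cls_mul_cls, mem_D_iff]
  intro c hc
  obtain ⟨U, -, ⟨e⟩⟩ := exists_sub_of_hallNumber_ne_zero hc
  exact (hM.trans e.numSummands_eq.symm.le).trans (h _ U)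

theorem isIdeal_D
    (h : ∀ (X : QuiverRep k V) (U : Sub X), U.rep.numSummands ≤ X.numSummands)
    (h' : ∀ (X : QuiverRep k V) (U : Sub X), U.quot.numSummands ≤ X.numSummands) (r : ℕ) :
    IsIdeal (D k V r) := by
  intro x hx y
  have hy : y ∈ Submodule.span (HallCoeff k) (Set.range (cls : IsoClass k V → _)) := by
    rw [span_cls]; trivial
  constructor
  · refine mul_mem_of_span ?_ hy hx
    rintro _ ⟨M, rfl⟩ _ ⟨N, hN, rfl⟩
    rw [cls_mul_cls, mem_D_iff]
    intro c hc
    obtain ⟨U, ⟨e⟩, -⟩ := exists_sub_of_hallNumber_ne_zero hc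
    exact (hN.trans e.numSummands_eq.symm.le).trans (h _ U)
  · refine mul_mem_of_span ?_ hx hy
    rintro _ ⟨M, hM, rfl⟩ _ ⟨N, rfl⟩
    rw [cls_mul_cls, mem_D_iff]
    intro c hc
    obtain ⟨U, -, ⟨e⟩⟩ := exists_sub_of_hallNumber_ne_zero hc
    exact (hM.trans e.numSummands_eq.symm.le).trans (h' _ U)

/-- The subrepresentation `U` itself is counted by the Hall number of X in [X/U] ⋄ [U]. As `Sub X`
is finite and the coefficient ring has characteristic zero, this coefficient is nonzero, and so [X]
is seen by D_r. -/
theorem numSummands_of_cls_mul_mem {r : ℕ} {X : QuiverRep k V} (U : Sub X)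
    (h : cls U.quot.toClass * cls U.rep.toClass ∈ D k V r) : r + 1 ≤ X.numSummands := by
  obtain ⟨e⟩ := X.nonempty_iso_out
  obtain ⟨eN⟩ := U.rep.nonempty_iso_out
  obtain ⟨eM⟩ := U.quot.nonempty_iso_out
  rw [← e.numSummands_eq]
  rw [cls_mul_cls, mem_D_iff] at h
  refine h X.toClass ?_
  rw [coeffs_clsMul, Nat.cast_ne_zero]
  exact Nat.card_ne_zero.2 ⟨⟨⟨e.symm.subIso U, ⟨((e.symm.repIso U).symm).trans eN.symm⟩,
    ⟨((e.symm.quotIso U).symm).trans eM.symm⟩⟩⟩, inferInstance⟩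

theorem two_le_numSummands_of_isIdeal (hD : IsIdeal (D k V 1)) {X : QuiverRep k V} (U : Sub X)
    (h : 2 ≤ U.rep.numSummands ∨ 2 ≤ U.quot.numSummands) : 2 ≤ X.numSummands := by
  obtain ⟨eN⟩ := U.rep.nonempty_iso_out
  obtain ⟨eM⟩ := U.quot.nonempty_iso_out
  refine numSummands_of_cls_mul_mem U ?_
  rcases h with h | h
  · exact (hD _ (cls_mem_D (h.trans eN.numSummands_eq.symm.le)) _).1
  · exact (hD _ (cls_mem_D (h.trans eM.numSummands_eq.symm.le)) _).2

theorem two_le_numSummands_of_isSubring (hD : IsSubring (D k V 1)) {X : QuiverRep k V} (U : Sub X)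
    (h : 2 ≤ U.rep.numSummands) (h' : 2 ≤ U.quot.numSummands) : 2 ≤ X.numSummands := by
  obtain ⟨eN⟩ := U.rep.nonempty_iso_out
  obtain ⟨eM⟩ := U.quot.nonempty_iso_out
  exact numSummands_of_cls_mul_mem U (hD _ (cls_mem_D (h'.trans eM.numSummands_eq.symm.le)) _
    (cls_mem_D (h.trans eN.numSummands_eq.symm.le)))

end HallAlgebra

/-! ### Duality -/

section DualLattice

variable {L : Type*} [Lattice L] [BoundedOrder L]

/-- The interval below `a` is a product in a nontrivial way. -/
def SplitsBelow (a : L) : Prop := ∃ b c : L, b ⊓ c = ⊥ ∧ b ⊔ c = a ∧ b ≠ ⊥ ∧ c ≠ ⊥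

/-- The interval above `a` is a product in a nontrivial way. -/
def SplitsAbove (a : L) : Prop := ∃ b c : L, b ⊓ c = a ∧ b ⊔ c = ⊤ ∧ b ≠ ⊤ ∧ c ≠ ⊤

/-- Complementary pairs are the same in a lattice and in its dual, and for them one member is `⊥`
exactly when the other is `⊤`. -/
theorem IndecElement.top_dual (h : IndecElement (⊤ : L)) : IndecElement (⊤ : Lᵒᵈ) := by
  refine ⟨fun h' => h.1 (Eq.symm h'), fun b c hbc hs => ?_⟩
  have h1 : IsCompl (OrderDual.ofDual b) (OrderDual.ofDual c) :=
    ⟨disjoint_iff.2 hs, codisjoint_iff.2 hbc.eq_bot⟩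
  rcases h.2 _ _ h1.disjoint h1.sup_eq_top with h2 | h2
  · exact Or.inr (show OrderDual.ofDual c = ⊤ by simpa [h2] using h1.sup_eq_top)
  · exact Or.inl (show OrderDual.ofDual b = ⊤ by simpa [h2] using h1.sup_eq_top)

theorem SplitsBelow.dual {a : L} (h : SplitsBelow a) : SplitsAbove (OrderDual.toDual a) := by
  obtain ⟨b, c, h⟩ := h
  exact ⟨OrderDual.toDual b, OrderDual.toDual c, h.2.1, h.1, h.2.2.1, h.2.2.2⟩

theorem SplitsAbove.dual {a : L} (h : SplitsAbove a) : SplitsBelow (OrderDual.toDual a) := by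
  obtain ⟨b, c, h⟩ := h
  exact ⟨OrderDual.toDual b, OrderDual.toDual c, h.2.1, h.1, h.2.2.1, h.2.2.2⟩

variable {L' : Type*} [Lattice L'] [BoundedOrder L']

theorem SplitsBelow.map_orderIso (e : L ≃o L') {a : L} (h : SplitsBelow a) :
    SplitsBelow (e a) := by
  obtain ⟨b, c, h1, h2, h3, h4⟩ := h
  exact ⟨e b, e c, by rw [← map_inf, h1, map_bot], by rw [← map_sup, h2],
    by rwa [Ne, map_eq_bot_iff], by rwa [Ne, map_eq_bot_iff]⟩

theorem SplitsAbove.map_orderIso (e : L ≃o L') {a : L} (h : SplitsAbove a) :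
    SplitsAbove (e a) := by
  obtain ⟨b, c, h1, h2, h3, h4⟩ := h
  exact ⟨e b, e c, by rw [← map_inf, h1], by rw [← map_sup, h2, map_top],
    by rwa [Ne, map_eq_top_iff], by rwa [Ne, map_eq_top_iff]⟩

end DualLattice

namespace QuiverRep

open Opposite

variable {k : Type u} [Field k] {V : Type w} [Quiver.{v} V]

/-- The dual representation, of the opposite quiver. -/
abbrev dual (X : QuiverRep k V) : QuiverRep k Vᵒᵖ where
  obj a := Module.Dual k (X.obj a.unop)
  map f := (X.map f.unop).dualMap

/-- The dual of a representation of the opposite quiver. -/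
abbrev unopDual (X : QuiverRep k Vᵒᵖ) : QuiverRep k V where
  obj a := Module.Dual k (X.obj (op a))
  map f := (X.map f.op).dualMap

theorem dualAnnihilator_dualCoannihilator {E : Type*} [AddCommGroup E] [Module k E]
    [FiniteDimensional k E] (W : Submodule k (Module.Dual k E)) :
    W.dualCoannihilator.dualAnnihilator = W :=
  Subspace.dualCoannihilator_dualAnnihilator_eq

/-- Annihilators identify the subrepresentations of a representation with those of its dual. -/
def subDual (X : QuiverRep k V) : Sub X ≃o (Sub X.dual)ᵒᵈ where
  toFun A := OrderDual.toDual
    { carrier := fun a => (A.carrier a.unop).dualAnnihilator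
      map_mem := fun {a b} f φ hφ => by
        exact (Submodule.mem_dualAnnihilator _).2 fun x hx =>
          (Submodule.mem_dualAnnihilator _).1 hφ _ (A.map_mem f.unop x hx) }
  invFun B :=
    { carrier := fun a => ((OrderDual.ofDual B).carrier (op a)).dualCoannihilator
      map_mem := fun {a b} f x hx => by
        exact (Submodule.mem_dualCoannihilator _).2 fun φ hφ =>
          (Submodule.mem_dualCoannihilator _).1 hx _ ((OrderDual.ofDual B).map_mem f.op φ hφ) }
  left_inv A := Sub.carrier_injective (funext fun a =>
    Subspace.dualAnnihilator_dualCoannihilator_eq)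
  right_inv B := Sub.carrier_injective (X := X.dual) (funext fun a =>
    dualAnnihilator_dualCoannihilator _)
  map_rel_iff' {A B} := ⟨fun h a => Subspace.dualAnnihilator_le_dualAnnihilator_iff.1 (h (op a)),
    fun h a => Submodule.dualAnnihilator_anti (h a.unop)⟩

/-- Annihilators identify the subrepresentations of a representation of the opposite quiver with
those of its dual. -/
def subUnopDual (X : QuiverRep k Vᵒᵖ) : Sub X ≃o (Sub X.unopDual)ᵒᵈ where
  toFun A := OrderDual.toDual
    { carrier := fun a => (A.carrier (op a)).dualAnnihilator
      map_mem := fun {a b} f φ hφ => by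
        exact (Submodule.mem_dualAnnihilator _).2 fun x hx =>
          (Submodule.mem_dualAnnihilator _).1 hφ _ (A.map_mem f.op x hx) }
  invFun B :=
    { carrier := fun a => ((OrderDual.ofDual B).carrier a.unop).dualCoannihilator
      map_mem := fun {a b} f x hx => by
        exact (Submodule.mem_dualCoannihilator _).2 fun φ hφ =>
          (Submodule.mem_dualCoannihilator _).1 hx _ ((OrderDual.ofDual B).map_mem f.unop φ hφ) }
  left_inv A := Sub.carrier_injective (funext fun a =>
    Subspace.dualAnnihilator_dualCoannihilator_eq)
  right_inv B := Sub.carrier_injective (X := X.unopDual) (funext fun a =>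
    dualAnnihilator_dualCoannihilator _)
  map_rel_iff' {A B} := ⟨fun h a => Subspace.dualAnnihilator_le_dualAnnihilator_iff.1 (h a.unop),
    fun h a => Submodule.dualAnnihilator_anti (h (op a))⟩

variable (k V) in
/-- All indecomposable representations are uniform. -/
def IndecUniform : Prop :=
  ∀ X : QuiverRep k V, IndecElement (⊤ : Sub X) → UniformElement (⊤ : Sub X)

/-- The lattice of the dual representation is the reversed lattice of X, and indecomposability of
the top is self-dual. This is the form of the hypothesis needed to bound quotients. -/
theorem IndecUniform.dual (h : IndecUniform k Vᵒᵖ) (X : QuiverRep k V)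
    (hX : IndecElement (⊤ : Sub X)) : UniformElement (⊤ : (Sub X)ᵒᵈ) := by
  have h1 : IndecElement (⊤ : (Sub X.dual)ᵒᵈ) := by
    simpa using hX.map_orderIso X.subDual
  have h2 : IndecElement (⊤ : Sub X.dual) := by
    simpa using h1.top_dual.map_orderIso (OrderIso.dualDual (Sub X.dual)).symm
  have e : (Sub X)ᵒᵈ ≃o Sub X.dual := X.subDual.dual.trans (OrderIso.dualDual (Sub X.dual)).symm
  simpa using (h _ h2).map_orderIso e.symm

variable (k V) in
/-- Some indecomposable representation has a subrepresentation that is decomposable or gives a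
decomposable quotient. -/
def HasSplitSubOrQuot : Prop :=
  ∃ X : QuiverRep k V, IndecElement (⊤ : Sub X) ∧ ∃ U : Sub X, SplitsBelow U ∨ SplitsAbove U

variable (k V) in
/-- Some indecomposable representation has a decomposable subrepresentation that gives a
decomposable quotient. -/
def HasSplitSubAndQuot : Prop :=
  ∃ X : QuiverRep k V, IndecElement (⊤ : Sub X) ∧ ∃ U : Sub X, SplitsBelow U ∧ SplitsAbove U

theorem indecElement_top_unopDual {X : QuiverRep k Vᵒᵖ} (hX : IndecElement (⊤ : Sub X)) :
    IndecElement (⊤ : Sub X.unopDual) := by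
  have h1 : IndecElement (⊤ : (Sub X.unopDual)ᵒᵈ) := by
    simpa using hX.map_orderIso X.subUnopDual
  simpa using h1.top_dual.map_orderIso (OrderIso.dualDual (Sub X.unopDual)).symm

/-- Dualising reverses the lattice and so interchanges splitting below and splitting above. Bad
configurations therefore need to be treated in only one orientation. -/
theorem HasSplitSubOrQuot.unop (h : HasSplitSubOrQuot k Vᵒᵖ) : HasSplitSubOrQuot k V := by
  obtain ⟨X, hX, U, hU⟩ := h
  refine ⟨X.unopDual, indecElement_top_unopDual hX, OrderDual.ofDual (X.subUnopDual U), ?_⟩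
  exact hU.symm.imp (fun h => (h.map_orderIso X.subUnopDual).dual)
    (fun h => (h.map_orderIso X.subUnopDual).dual)

theorem HasSplitSubAndQuot.unop (h : HasSplitSubAndQuot k Vᵒᵖ) : HasSplitSubAndQuot k V := by
  obtain ⟨X, hX, U, hU⟩ := h
  refine ⟨X.unopDual, indecElement_top_unopDual hX, OrderDual.ofDual (X.subUnopDual U), ?_⟩
  exact hU.symm.imp (fun h => (h.map_orderIso X.subUnopDual).dual)
    (fun h => (h.map_orderIso X.subUnopDual).dual)

theorem Sub.two_le_numSummands_rep_of_splitsBelow [Finite V] {X : QuiverRep k V} {U : Sub X}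
    (h : SplitsBelow U) : 2 ≤ U.rep.numSummands := by
  obtain ⟨A, B, h1, h2, h3, h4⟩ := h
  exact Sub.two_le_numSummands_rep h1 h2 h3 h4

theorem Sub.two_le_numSummands_quot_of_splitsAbove [Finite V] {X : QuiverRep k V} {U : Sub X}
    (h : SplitsAbove U) : 2 ≤ U.quot.numSummands := by
  obtain ⟨A, B, h1, h2, h3, h4⟩ := h
  refine Sub.two_le_numSummands_quot h1 h2 (fun h => h4 ?_) (fun h => h3 ?_)
  · rw [← h2]; exact (sup_eq_right.2 (by rw [h, ← h1]; exact inf_le_right)).symm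
  · rw [← h2]; exact (sup_eq_left.2 (by rw [h, ← h1]; exact inf_le_left)).symm

variable [Finite k] [Finite V] [∀ a b : V, Finite (a ⟶ b)]

/-- The indecomposable `X` occurs in the product of [X/U] and [U], and one of the factors lies in
D_1. -/
theorem HasSplitSubOrQuot.not_isIdeal (h : HasSplitSubOrQuot k V) :
    ¬ HallAlgebra.IsIdeal (HallAlgebra.D k V 1) := by
  obtain ⟨X, hX, U, hU⟩ := h
  intro hD
  have h1 := HallAlgebra.two_le_numSummands_of_isIdeal hD U
    (hU.imp Sub.two_le_numSummands_rep_of_splitsBelow Sub.two_le_numSummands_quot_of_splitsAbove)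
  exact absurd (h1.trans (numSummands_le_one hX)) (by norm_num)

theorem HasSplitSubAndQuot.not_isSubring (h : HasSplitSubAndQuot k V) :
    ¬ HallAlgebra.IsSubring (HallAlgebra.D k V 1) := by
  obtain ⟨X, hX, U, hU⟩ := h
  intro hD
  have h1 := HallAlgebra.two_le_numSummands_of_isSubring hD U
    (Sub.two_le_numSummands_rep_of_splitsBelow hU.1)
    (Sub.two_le_numSummands_quot_of_splitsAbove hU.2)
  exact absurd (h1.trans (numSummands_le_one hX)) (by norm_num)

end QuiverRep

/-! ### Chains for an endomorphism -/

section Chain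

open Polynomial

variable {k E : Type*} [Field k] [AddCommGroup E] [Module k E] (Φ : Module.End k E)

/-- The subspace spanned by all iterates of a vector. -/
noncomputable def cyclicSpan (u : E) : Submodule k E :=
  LinearMap.range (LinearMap.applyₗ u ∘ₗ (aeval (R := k) Φ).toLinearMap)

/-- The largest invariant subspace in the kernel of a functional. -/
def coreKer (ξ : Module.Dual k E) : Submodule k E := ⨅ s : ℕ, LinearMap.ker (ξ ∘ₗ Φ ^ s)

variable {Φ}

theorem mem_coreKer {ξ : Module.Dual k E} {x : E} : x ∈ coreKer Φ ξ ↔ ∀ s, ξ ((Φ ^ s) x) = 0 := by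
  simp [coreKer]

theorem mem_cyclicSpan {u x : E} : x ∈ cyclicSpan Φ u ↔ ∃ p : k[X], aeval Φ p u = x := Iff.rfl

theorem pow_apply_mem_cyclicSpan (u : E) (t : ℕ) : (Φ ^ t) u ∈ cyclicSpan Φ u :=
  mem_cyclicSpan.2 ⟨X ^ t, by simp⟩

theorem apply_mem_cyclicSpan {u x : E} (h : x ∈ cyclicSpan Φ u) : Φ x ∈ cyclicSpan Φ u := by
  obtain ⟨p, rfl⟩ := h
  exact mem_cyclicSpan.2 ⟨X * p, by simp⟩

theorem apply_mem_coreKer {ξ : Module.Dual k E} {x : E} (h : x ∈ coreKer Φ ξ) :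
    Φ x ∈ coreKer Φ ξ := by
  rw [mem_coreKer] at h ⊢
  intro s
  rw [← Module.End.mul_apply, ← pow_succ]
  exact h (s + 1)

variable {u : E} {ξ : Module.Dual k E} {j : ℕ}

theorem pow_apply_eq_zero_of_lt {t : ℕ} (h : (Φ ^ (j + 1)) u = 0) (ht : j < t) :
    (Φ ^ t) u = 0 := by
  obtain ⟨r, rfl⟩ := Nat.exists_eq_add_of_lt ht
  rw [show j + r + 1 = r + (j + 1) by ring, pow_add, Module.End.mul_apply, h, map_zero]

theorem dual_pow_apply_eq_zero_of_lt {s : ℕ} (h : ∀ x, ξ ((Φ ^ (j + 1)) x) = 0) (hs : j < s)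
    (x : E) : ξ ((Φ ^ s) x) = 0 := by
  obtain ⟨r, rfl⟩ := Nat.exists_eq_add_of_lt hs
  rw [show j + r + 1 = (j + 1) + r by ring, pow_add, Module.End.mul_apply, h]

/-- The matrix of the values of `ξ ∘ Φ ^ s` on `Φ ^ t u`, for s, t ≤ j, is triangular along its
antidiagonal: it is 1 for s + t = j and 0 for s + t > j. So the chain of `u` is in perfect duality
with the functionals whose common kernel is the core. -/
theorem isCompl_cyclicSpan_coreKer (hu : (Φ ^ (j + 1)) u = 0)
    (hξ : ∀ x, ξ ((Φ ^ (j + 1)) x) = 0) (h1 : ξ ((Φ ^ j) u) = 1) :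
    IsCompl (cyclicSpan Φ u) (coreKer Φ ξ) := by
  constructor
  · rw [Submodule.disjoint_def]
    rintro _ ⟨p, rfl⟩ hx
    rw [mem_coreKer] at hx
    change ∀ s, ξ ((Φ ^ s) (aeval Φ p u)) = 0 at hx
    change aeval Φ p u = 0
    rw [aeval_eq_sum_range, LinearMap.sum_apply] at hx ⊢
    -- The coefficients vanish from the lowest upwards: `ξ ∘ Φ ^ (j - m)` kills all terms of degree
    -- above `m` and takes the value 1 on `Φ ^ m u`.
    have hc : ∀ m ≤ j, p.coeff m = 0 := by
      intro m
      induction m using Nat.strong_induction_on with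
      | _ m ih =>
        intro hm
        by_contra hne
        have := hx (j - m)
        rw [map_sum, map_sum, Finset.sum_eq_single m] at this
        · rw [LinearMap.smul_apply, map_smul, map_smul, ← Module.End.mul_apply, ← pow_add,
            Nat.sub_add_cancel hm, h1, smul_eq_mul, mul_one] at this
          exact hne this
        · intro i _ him
          rw [LinearMap.smul_apply, map_smul, map_smul, ← Module.End.mul_apply, ← pow_add]
          rcases lt_or_gt_of_ne him with h | h
          · rw [ih i h (h.le.trans hm), zero_smul]
          · rw [dual_pow_apply_eq_zero_of_lt hξ (by omega), smul_zero]
        · intro hm'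
          rw [Finset.mem_range, not_lt] at hm'
          exact absurd (coeff_eq_zero_of_natDegree_lt (by omega)) hne
    refine Finset.sum_eq_zero fun i _ => ?_
    rcases le_or_gt i j with h | h
    · rw [hc i h, zero_smul, LinearMap.zero_apply]
    · rw [LinearMap.smul_apply, pow_apply_eq_zero_of_lt hu h, smul_zero]
  · rw [codisjoint_iff, eq_top_iff]
    intro x _
    -- Triangular elimination: the multiple of `Φ ^ n u` added at stage `n` corrects `ξ ∘ Φ ^ (j -
    -- n)` and leaves the functionals with higher powers, already zero, unchanged.
    have key : ∀ n ≤ j + 1, ∃ y ∈ cyclicSpan Φ u, ∀ s, j + 1 ≤ s + n → ξ ((Φ ^ s) (x - y)) = 0 := by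
      intro n
      induction n with
      | zero =>
        intro _
        exact ⟨0, zero_mem _, fun s hs => dual_pow_apply_eq_zero_of_lt hξ (by omega) _⟩
      | succ n ih =>
        intro hn
        obtain ⟨y, hy, hys⟩ := ih (by omega)
        refine ⟨y + ξ ((Φ ^ (j - n)) (x - y)) • (Φ ^ n) u,
          add_mem hy (Submodule.smul_mem _ _ (pow_apply_mem_cyclicSpan u n)), fun s hs => ?_⟩
        rw [← sub_sub, map_sub, map_sub, map_smul, map_smul, ← Module.End.mul_apply (Φ ^ s),
          ← pow_add]
        rcases Nat.eq_or_lt_of_le (show j - n ≤ s by omega) with h | h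
        · subst h
          rw [Nat.sub_add_cancel (by omega), h1, smul_eq_mul, mul_one, sub_self]
        · rw [hys s (by omega), pow_apply_eq_zero_of_lt hu (by omega), map_zero, smul_zero, sub_zero]
    obtain ⟨y, hy, hys⟩ := key (j + 1) le_rfl
    rw [← add_sub_cancel y x]
    exact Submodule.add_mem_sup hy (mem_coreKer.2 fun s => hys s (by omega))

/-- If the largest invariant subspace in the kernel of the functional is zero, every nonzero vector
has an iterate that is a nonzero multiple of the end of the chain. -/
theorem exists_pow_apply_eq_smul (hu : (Φ ^ (j + 1)) u = 0)
    (hξ : ∀ x, ξ ((Φ ^ (j + 1)) x) = 0) (h1 : ξ ((Φ ^ j) u) = 1) (hW : coreKer Φ ξ = ⊥) {x : E}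
    (hx : x ≠ 0) : ∃ (s : ℕ) (c : k), c ≠ 0 ∧ (Φ ^ s) x = c • (Φ ^ j) u := by
  classical
  have hx' : x ∉ coreKer Φ ξ := by rwa [hW, Submodule.mem_bot]
  rw [mem_coreKer, not_forall] at hx'
  obtain ⟨s₀, hs₀⟩ := hx'
  have hs₀j : s₀ ≤ j := by
    by_contra! h
    exact hs₀ (dual_pow_apply_eq_zero_of_lt hξ h x)
  -- With `s` the last exponent at which `ξ` sees an iterate of `x`, the difference of `Φ ^ s x` and
  -- the matching multiple of `Φ ^ j u` is killed by all `ξ ∘ Φ ^ r`, hence lies in the core, which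
  -- is zero.
  set s := Nat.findGreatest (fun s => ξ ((Φ ^ s) x) ≠ 0) j with hsdef
  have hs : ξ ((Φ ^ s) x) ≠ 0 := Nat.findGreatest_spec (P := fun s => ξ ((Φ ^ s) x) ≠ 0) hs₀j hs₀
  have hgt : ∀ r, s < r → ξ ((Φ ^ r) x) = 0 := by
    intro r hr
    rcases le_or_gt r j with h | h
    · by_contra hne
      exact Nat.findGreatest_is_greatest (P := fun s => ξ ((Φ ^ s) x) ≠ 0) hr h hne
    · exact dual_pow_apply_eq_zero_of_lt hξ h x
  refine ⟨s, ξ ((Φ ^ s) x), hs, ?_⟩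
  have : (Φ ^ s) x - ξ ((Φ ^ s) x) • (Φ ^ j) u ∈ coreKer Φ ξ := by
    rw [mem_coreKer]
    intro r
    rw [map_sub, map_sub, map_smul, map_smul, ← Module.End.mul_apply, ← Module.End.mul_apply,
      ← pow_add, ← pow_add]
    rcases Nat.eq_zero_or_pos r with rfl | hr
    · rw [zero_add, zero_add, h1, smul_eq_mul, mul_one, sub_self]
    · rw [hgt _ (by omega), pow_apply_eq_zero_of_lt hu (by omega), map_zero, smul_zero, sub_zero]
  rw [hW, Submodule.mem_bot, sub_eq_zero] at this
  exact this

end Chain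

/-! ### The total operator of a representation -/

namespace QuiverRep

open Classical in
/-- The inclusion of the space at a vertex into the product of all the spaces. -/
noncomputable abbrev single {k : Type u} [Field k] {V : Type w} [Quiver.{v} V] (X : QuiverRep k V)
    (a : V) : X.obj a →ₗ[k] (∀ b, X.obj b) := LinearMap.single k X.obj a

variable {k : Type u} [Field k] {V : Type w} [Quiver.{v} V]

section Single

variable (X : QuiverRep k V)

theorem single_same (a : V) (x : X.obj a) : X.single a x a = x := by
  classical
  simp [single]

theorem single_ne {a b : V} (h : b ≠ a) (x : X.obj a) : X.single a x b = 0 := by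
  classical
  simp [single, h]

theorem single_injective (a : V) : Function.Injective (X.single a) := fun x y h => by
  rw [← X.single_same a x, h, single_same]

end Single

section Total

variable {X : QuiverRep k V}

/-- The elements of the product with all components in a subrepresentation. -/
def Sub.total (A : Sub X) : Submodule k (∀ a, X.obj a) := Submodule.pi Set.univ A.carrier

theorem Sub.mem_total {A : Sub X} {x : ∀ a, X.obj a} : x ∈ A.total ↔ ∀ a, x a ∈ A.carrier a := by
  simp [Sub.total, Submodule.mem_pi]

theorem Sub.single_mem_total {A : Sub X} {a : V} {x : X.obj a} (h : x ∈ A.carrier a) :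
    X.single a x ∈ A.total := by
  rw [Sub.mem_total]
  intro b
  by_cases hb : b = a
  · subst hb; rwa [single_same]
  · rw [single_ne X hb]; exact zero_mem _

theorem exists_ne_zero_of_ne_bot {A : Sub X} (h : A ≠ ⊥) : ∃ a, ∃ x ∈ A.carrier a, x ≠ 0 := by
  by_contra! hcon
  exact h (Sub.eq_bot_iff.2 fun a => (Submodule.eq_bot_iff _).2 (hcon a))

/-- If every nonzero subrepresentation contains a fixed nonzero vector, the representation is
uniform. -/
theorem uniformElement_top_of_forall_mem {i : V} {x : X.obj i} (hx : x ≠ 0)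
    (h : ∀ A : Sub X, A ≠ ⊥ → x ∈ A.carrier i) : UniformElement (⊤ : Sub X) := by
  constructor
  · intro h'
    have := (Submodule.eq_bot_iff _).1 (Sub.eq_bot_iff.1 h' i) x trivial
    exact hx this
  · intro A B _ _ hAB
    by_contra! hne
    exact hx (Submodule.disjoint_def.1 (Sub.disjoint_iff.1 hAB i) x (h A hne.1) (h B hne.2))

end Total

variable [Finite V] [∀ a b : V, Finite (a ⟶ b)] (X : QuiverRep k V)

/-- The sum of the maps along all arrows, on the product of all the spaces. -/
noncomputable def totalMap : Module.End k (∀ a, X.obj a) :=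
  letI : ∀ b : V, Fintype (Σ a, (a ⟶ b)) := fun _ => Fintype.ofFinite _
  LinearMap.pi fun b => ∑ p : (Σ a, (a ⟶ b)), X.map p.2 ∘ₗ LinearMap.proj p.1

variable {X}

/-- Every vertex has at most one outgoing arrow. -/
def _root_.OutDegreeLeOne (V : Type w) [Quiver.{v} V] : Prop :=
  ∀ a : V, Subsingleton (Σ b, (a ⟶ b))

theorem totalMap_apply [∀ b : V, Fintype (Σ a, (a ⟶ b))] (x : ∀ a, X.obj a) (b : V) :
    X.totalMap x b = ∑ p : (Σ a, (a ⟶ b)), X.map p.2 (x p.1) := by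
  simp only [totalMap, LinearMap.pi_apply, LinearMap.sum_apply, LinearMap.comp_apply,
    LinearMap.proj_apply]
  congr!

/-- With a single arrow leaving each vertex, Φ maps a vector concentrated at one vertex to one
concentrated at one vertex. This makes invariant subspaces of the product yield subrepresentations.
-/
theorem totalMap_single (hV : OutDegreeLeOne V) {a b : V} (f : a ⟶ b) (x : X.obj a) :
    X.totalMap (X.single a x) = X.single b (X.map f x) := by
  let _ : ∀ b : V, Fintype (Σ a, (a ⟶ b)) := fun _ => Fintype.ofFinite _
  have := hV a
  funext c
  rw [totalMap_apply]
  by_cases hc : c = b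
  · subst hc
    rw [single_same, Finset.sum_eq_single ⟨a, f⟩]
    · rw [single_same]
    · rintro ⟨a', f'⟩ _ hne
      have : a' ≠ a := by
        rintro rfl
        have h : (⟨c, f'⟩ : Σ b, (a' ⟶ b)) = ⟨c, f⟩ := Subsingleton.elim _ _
        rw [Sigma.mk.injEq] at h
        exact hne (by rw [eq_of_heq h.2])
      rw [single_ne X this, map_zero]
    · exact fun h => absurd (Finset.mem_univ _) h
  · rw [single_ne X hc]
    refine Finset.sum_eq_zero fun p _ => ?_
    have : p.1 ≠ a := by
      obtain ⟨a', f'⟩ := p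
      rintro rfl
      have h : (⟨c, f'⟩ : Σ b, (a' ⟶ b)) = ⟨b, f⟩ := Subsingleton.elim _ _
      exact hc (congrArg Sigma.fst h)
    rw [single_ne X this, map_zero]

theorem totalMap_single_of_isEmpty {a : V} (h : IsEmpty (Σ b, (a ⟶ b))) (x : X.obj a) :
    X.totalMap (X.single a x) = 0 := by
  let _ : ∀ b : V, Fintype (Σ a, (a ⟶ b)) := fun _ => Fintype.ofFinite _
  funext c
  rw [totalMap_apply]
  refine Finset.sum_eq_zero fun p _ => ?_
  have : p.1 ≠ a := fun h' => h.false ⟨c, h' ▸ p.2⟩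
  rw [single_ne X this, map_zero]

theorem exists_totalMap_single (hV : OutDegreeLeOne V) (a : V) (x : X.obj a) :
    ∃ (b : V) (y : X.obj b), X.totalMap (X.single a x) = X.single b y := by
  rcases isEmpty_or_nonempty (Σ b, (a ⟶ b)) with h | ⟨⟨b, f⟩⟩
  · exact ⟨a, 0, by rw [totalMap_single_of_isEmpty h, map_zero]⟩
  · exact ⟨b, _, totalMap_single hV f x⟩

theorem exists_totalMap_pow_single (hV : OutDegreeLeOne V) (s : ℕ) (a : V) (x : X.obj a) :
    ∃ (b : V) (y : X.obj b), (X.totalMap ^ s) (X.single a x) = X.single b y := by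
  induction s generalizing a with
  | zero => exact ⟨a, x, rfl⟩
  | succ s ih =>
    obtain ⟨b, y, h⟩ := exists_totalMap_single hV a x
    rw [pow_succ, Module.End.mul_apply, h]
    exact ih b y

/-- An iterate applied to a homogeneous vector is determined by any nonzero component. -/
theorem totalMap_pow_single_eq (hV : OutDegreeLeOne V) {s : ℕ} {a i : V} {x : X.obj a}
    (h : (X.totalMap ^ s) (X.single a x) i ≠ 0) :
    (X.totalMap ^ s) (X.single a x) = X.single i ((X.totalMap ^ s) (X.single a x) i) := by
  obtain ⟨b, y, hy⟩ := exists_totalMap_pow_single hV s a x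
  rw [hy] at h ⊢
  by_cases hb : i = b
  · subst hb; rw [single_same]
  · exact absurd (single_ne X hb y) h

/-- `P` is a set of vertices with at most one incoming arrow that is closed under predecessors. -/
def _root_.InDegreeLeOneOn {V : Type w} [Quiver.{v} V] (P : V → Prop) : Prop :=
  ∀ b, P b → Subsingleton (Σ a, (a ⟶ b)) ∧ ∀ a, (a ⟶ b) → P a

/-- At most one path of length `s` ends at `i`, so the component at `i` after `s` steps depends on
just one component of the input. -/
theorem totalMap_pow_apply_of_inDegree {P : V → Prop} (hP : InDegreeLeOneOn P) (s : ℕ) {i : V}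
    (hi : P i) : ∃ a, ∀ x : ∀ a, X.obj a,
      (X.totalMap ^ s) x i = (X.totalMap ^ s) (X.single a (x a)) i := by
  let _ : ∀ b : V, Fintype (Σ a, (a ⟶ b)) := fun _ => Fintype.ofFinite _
  induction s generalizing i with
  | zero => exact ⟨i, fun x => (single_same X i _).symm⟩
  | succ s ih =>
    obtain ⟨hs, hpre⟩ := hP i hi
    rcases isEmpty_or_nonempty (Σ a, (a ⟶ i)) with h | ⟨⟨b, f⟩⟩
    · refine ⟨i, fun x => ?_⟩
      rw [pow_succ', Module.End.mul_apply, Module.End.mul_apply, totalMap_apply, totalMap_apply,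
        Fintype.sum_empty, Fintype.sum_empty]
    · obtain ⟨a, ha⟩ := ih (hpre b f)
      refine ⟨a, fun x => ?_⟩
      rw [pow_succ', Module.End.mul_apply, Module.End.mul_apply, totalMap_apply, totalMap_apply]
      refine Finset.sum_congr rfl fun p _ => ?_
      obtain rfl : p = ⟨b, f⟩ := Subsingleton.elim _ _
      rw [ha]

/-! ### Invariant subspaces of the product of all the spaces -/

theorem Sub.totalMap_mem_total {A : Sub X} {x : ∀ a, X.obj a} (h : x ∈ A.total) :
    X.totalMap x ∈ A.total := by
  let _ : ∀ b : V, Fintype (Σ a, (a ⟶ b)) := fun _ => Fintype.ofFinite _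
  rw [Sub.mem_total] at h ⊢
  intro b
  rw [totalMap_apply]
  exact Submodule.sum_mem _ fun p _ => A.map_mem p.2 _ (h p.1)

theorem Sub.totalMap_pow_mem_total {A : Sub X} {x : ∀ a, X.obj a} (h : x ∈ A.total) (s : ℕ) :
    (X.totalMap ^ s) x ∈ A.total := by
  induction s with
  | zero => exact h
  | succ s ih =>
    rw [pow_succ', Module.End.mul_apply]
    exact Sub.totalMap_mem_total ih

/-- The subrepresentation given by an invariant subspace of the product. -/
noncomputable def Sub.ofInvariant (hV : OutDegreeLeOne V) (S : Submodule k (∀ a, X.obj a))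
    (hS : ∀ x ∈ S, X.totalMap x ∈ S) : Sub X where
  carrier a := S.comap (X.single a)
  map_mem {a b} f x hx := by
    change X.single b _ ∈ S
    rw [← totalMap_single hV f x]
    exact hS _ hx

/-- A subspace of the product is homogeneous if it contains the components of its elements. -/
def IsHomogeneous (S : Submodule k (∀ a, X.obj a)) : Prop := ∀ x ∈ S, ∀ a, X.single a (x a) ∈ S

theorem Sub.isCompl_ofInvariant {hV : OutDegreeLeOne V} {S T : Submodule k (∀ a, X.obj a)}
    {hS : ∀ x ∈ S, X.totalMap x ∈ S} {hT : ∀ x ∈ T, X.totalMap x ∈ T} (hS' : IsHomogeneous S)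
    (hT' : IsHomogeneous T) (h : IsCompl S T) :
    IsCompl (Sub.ofInvariant hV S hS) (Sub.ofInvariant hV T hT) := by
  rw [Sub.isCompl_iff]
  intro a
  constructor
  · rw [Submodule.disjoint_def]
    intro x hx hx'
    have := Submodule.disjoint_def.1 h.disjoint _ hx hx'
    exact X.single_injective a (by rw [this, map_zero])
  · rw [_root_.codisjoint_iff, _root_.eq_top_iff]
    intro x _
    obtain ⟨y, hy, z, hz, hyz⟩ := Submodule.mem_sup.1
      (h.codisjoint.eq_top ▸ Submodule.mem_top : X.single a x ∈ S ⊔ T)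
    refine Submodule.mem_sup.2 ⟨y a, hS' y hy a, z a, hT' z hz a, ?_⟩
    rw [← Pi.add_apply, hyz, single_same]

theorem Sub.eq_bot_of_ofInvariant_eq_bot {hV : OutDegreeLeOne V}
    {S : Submodule k (∀ a, X.obj a)} {hS : ∀ x ∈ S, X.totalMap x ∈ S} (hS' : IsHomogeneous S)
    (h : Sub.ofInvariant hV S hS = ⊥) : S = ⊥ := by
  rw [_root_.eq_bot_iff]
  intro x hx
  rw [Submodule.mem_bot]
  funext a
  have h1 := Sub.eq_bot_iff.1 h a
  have h2 : x a ∈ (Sub.ofInvariant hV S hS).carrier a := hS' x hx a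
  rw [h1] at h2
  exact h2

/-- A representation of a quiver with at most one arrow out of each vertex, with nilpotent total
operator and a nonzero vector killed by it that sits at a vertex with a unique history, is uniform
if it is indecomposable. -/
theorem uniformElement_top_of_nilpotent (hV : OutDegreeLeOne V)
    (hX : IndecElement (⊤ : Sub X)) (hnil : IsNilpotent X.totalMap) {P : V → Prop}
    (hP : InDegreeLeOneOn P) {i : V} (hi : P i)
    (hv : ∃ x : X.obj i, x ≠ 0 ∧ X.totalMap (X.single i x) = 0) :
    UniformElement (⊤ : Sub X) := by
  set Φ := X.totalMap with hΦ
  have hback := fun s => totalMap_pow_apply_of_inDegree (X := X) hP s hi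
  -- Among the nonzero vectors at `i` killed by Φ, one ending a chain of maximal length is chosen.
  -- Nilpotency bounds the lengths.
  obtain ⟨j, ⟨v, hv0, hvΦ, u₀, hu₀⟩, hmax⟩ : ∃ j,
      (∃ x : X.obj i, x ≠ 0 ∧ Φ (X.single i x) = 0 ∧ X.single i x ∈ LinearMap.range (Φ ^ j)) ∧
      ¬ ∃ x : X.obj i, x ≠ 0 ∧ Φ (X.single i x) = 0 ∧
        X.single i x ∈ LinearMap.range (Φ ^ (j + 1)) := by
    by_contra! hcon
    obtain ⟨N, hN⟩ := hnil
    have : ∀ j, ∃ x : X.obj i, x ≠ 0 ∧ Φ (X.single i x) = 0 ∧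
        X.single i x ∈ LinearMap.range (Φ ^ j) := by
      intro j
      induction j with
      | zero =>
        obtain ⟨x, hx, hx'⟩ := hv
        exact ⟨x, hx, hx', X.single i x, rfl⟩
      | succ j ih => exact hcon j ih
    obtain ⟨x, hx, -, y, hy⟩ := this N
    rw [hN] at hy
    exact hx (X.single_injective i (by rw [← hy, map_zero]; rfl))
  obtain ⟨a, ha⟩ := hback j
  have hΦu : (Φ ^ j) (X.single a (u₀ a)) = X.single i v := by
    have h1 : (Φ ^ j) (X.single a (u₀ a)) i = v := by rw [← ha, hu₀, single_same]
    rw [hΦ, totalMap_pow_single_eq hV (i := i) (by rw [← hΦ, h1]; exact hv0), ← hΦ, h1]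
  set u := X.single a (u₀ a) with hu
  -- Maximality of `j` keeps `v` out of the component at `i` of the image of `Φ ^ (j + 1)`: by
  -- uniqueness of histories, a preimage could be replaced by one of its components, giving a longer
  -- chain ending at `v`.
  obtain ⟨ξ₀, hξv, hξR⟩ : ∃ ξ : Module.Dual k (X.obj i),
      ξ v ≠ 0 ∧ LinearMap.range (LinearMap.proj i ∘ₗ Φ ^ (j + 1)) ≤ LinearMap.ker ξ := by
    refine Submodule.exists_le_ker_of_notMem fun hmem => hmax ?_
    obtain ⟨x, hx⟩ := hmem
    change (Φ ^ (j + 1)) x i = v at hx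
    obtain ⟨b, hb⟩ := hback (j + 1)
    rw [hb] at hx
    refine ⟨v, hv0, hvΦ, X.single b (x b), ?_⟩
    rw [hΦ, totalMap_pow_single_eq hV (i := i) (by rw [← hΦ, hx]; exact hv0), ← hΦ, hx]
  set ξ : Module.Dual k (∀ b, X.obj b) := (ξ₀ v)⁻¹ • (ξ₀ ∘ₗ LinearMap.proj i) with hξdef
  have h1 : (Φ ^ (j + 1)) u = 0 := by
    rw [pow_succ', Module.End.mul_apply, hΦu, hvΦ]
  have h2 : ∀ x, ξ ((Φ ^ (j + 1)) x) = 0 := fun x => by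
    have : ξ₀ ((Φ ^ (j + 1)) x i) = 0 := hξR ⟨x, rfl⟩
    simp [hξdef, this]
  have h3 : ξ ((Φ ^ j) u) = 1 := by
    rw [hΦu]
    simp only [hξdef, LinearMap.smul_apply, LinearMap.comp_apply, LinearMap.proj_apply,
      single_same, smul_eq_mul]
    exact inv_mul_cancel₀ hξv
  have hI : IsHomogeneous (cyclicSpan Φ u) := by
    rintro _ ⟨p, rfl⟩ c
    change X.single c (Polynomial.aeval Φ p u c) ∈ _
    rw [Polynomial.aeval_eq_sum_range, LinearMap.sum_apply, Finset.sum_apply, map_sum]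
    refine Submodule.sum_mem _ fun t _ => ?_
    rw [LinearMap.smul_apply, Pi.smul_apply, map_smul]
    refine Submodule.smul_mem _ _ ?_
    by_cases h0 : (Φ ^ t) u c = 0
    · rw [h0, map_zero]; exact zero_mem _
    · rw [hu, hΦ, ← totalMap_pow_single_eq hV h0]
      exact pow_apply_mem_cyclicSpan _ _
  -- Since `ξ` looks only at the vertex `i`, each condition `ξ (Φ ^ s x) = 0` concerns a single
  -- component of `x`.
  have hW : IsHomogeneous (coreKer Φ ξ) := by
    intro x hx c
    rw [mem_coreKer] at hx ⊢
    intro s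
    obtain ⟨b, hb⟩ := hback s
    have hx' := hx s
    simp only [hξdef, LinearMap.smul_apply, LinearMap.comp_apply, LinearMap.proj_apply] at hx' ⊢
    rw [hb] at hx' ⊢
    by_cases hc : b = c
    · subst hc; rwa [single_same]
    · rw [single_ne X hc]; simp
  have hcompl := Sub.isCompl_ofInvariant (hV := hV) (hS := fun _ => apply_mem_cyclicSpan)
    (hT := fun _ => apply_mem_coreKer) hI hW (isCompl_cyclicSpan_coreKer h1 h2 h3)
  -- The chain contains `v`, so the core must vanish. Then every nonzero vector has an iterate that
  -- is a nonzero multiple of `v`, and `v` lies in every nonzero subrepresentation.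
  rcases hX.2 _ _ hcompl.disjoint hcompl.sup_eq_top with h | h
  · have := Sub.eq_bot_of_ofInvariant_eq_bot hI h
    have hmem := pow_apply_mem_cyclicSpan (Φ := Φ) u j
    rw [this, Submodule.mem_bot, hΦu] at hmem
    exact absurd (X.single_injective i (hmem.trans (map_zero _).symm)) hv0
  · have hbot := Sub.eq_bot_of_ofInvariant_eq_bot hW h
    refine uniformElement_top_of_forall_mem hv0 fun A hA => ?_
    obtain ⟨c, x, hxA, hx0⟩ := exists_ne_zero_of_ne_bot hA
    obtain ⟨s, t, ht, hst⟩ := exists_pow_apply_eq_smul h1 h2 h3 hbot (x := X.single c x)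
      (fun h => hx0 (X.single_injective c (h.trans (map_zero _).symm)))
    have hmem := Sub.totalMap_pow_mem_total (Sub.single_mem_total hxA) s
    rw [← hΦ, hst, hΦu, Submodule.smul_mem_iff _ ht] at hmem
    simpa [single_same] using Sub.mem_total.1 hmem i

end QuiverRep

/-! ### Quivers with two branches running into a sink -/

/-- Integer coordinates on a quiver that consists of two branches running into the vertex with
coordinate `0`. -/
structure IsTwoBranch {V : Type w} [Quiver.{v} V] (c : V → ℤ) : Prop where
  inj : Function.Injective c
  arrow : ∀ {a b : V}, (a ⟶ b) → (c a < 0 ∧ c b = c a + 1) ∨ (0 < c a ∧ c b = c a - 1)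
  subsingleton : ∀ a b : V, Subsingleton (a ⟶ b)
  exists_arrow : ∀ a, c a ≠ 0 → ∃ b, Nonempty (a ⟶ b)
  exists_zero : ∃ a, c a = 0

namespace IsTwoBranch

variable {V : Type w} [Quiver.{v} V] {c : V → ℤ}

theorem natAbs_eq (hc : IsTwoBranch c) {a b : V} (f : a ⟶ b) : (c a).natAbs = (c b).natAbs + 1 := by
  have := hc.arrow f
  omega

theorem outDegreeLeOne (hc : IsTwoBranch c) : OutDegreeLeOne V := by
  intro a
  constructor
  rintro ⟨b, f⟩ ⟨b', f'⟩
  obtain rfl : b = b' := hc.inj (by have := hc.arrow f; have := hc.arrow f'; omega)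
  rw [(hc.subsingleton a b).elim f f']

theorem inDegreeLeOneOn (hc : IsTwoBranch c) : InDegreeLeOneOn fun a => c a ≠ 0 := by
  intro b hb
  constructor
  · constructor
    rintro ⟨a, f⟩ ⟨a', f'⟩
    obtain rfl : a = a' := hc.inj (by have := hc.arrow f; have := hc.arrow f'; omega)
    rw [(hc.subsingleton a b).elim f f']
  · intro a f
    have := hc.arrow f
    omega

end IsTwoBranch

/-! ### A splitting line for two chains of subspaces -/

section TwoChains

variable {k F : Type*} [Field k] [AddCommGroup F] [Module k F]

/-- Given two finite chains of subspaces, there is a line with a complementary hyperplane such that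
each member of the chains contains the line or is contained in the hyperplane. -/
theorem exists_mem_or_le_ker_of_isChain [Nontrivial F] {A B : Set (Submodule k F)}
    (hA : A.Finite) (hB : B.Finite) (hA' : IsChain (· ≤ ·) A) (hB' : IsChain (· ≤ ·) B) :
    ∃ (v : F) (ξ : Module.Dual k F), ξ v = 1 ∧ ∀ S ∈ A ∪ B, v ∈ S ∨ S ≤ LinearMap.ker ξ := by
  -- `P` is the smallest nonzero member of the first chain. Adding `⊤` covers the case that there is
  -- none.
  obtain ⟨P, hP, hPmin⟩ := ((hA.insert ⊤).subset
    (Set.sep_subset _ fun S => S ≠ ⊥)).exists_minimal ⟨⊤, Set.mem_insert _ _, top_ne_bot⟩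
  have hPle : ∀ S ∈ A, S ≠ ⊥ → P ≤ S := by
    intro S hS hS0
    rcases hP.1 with h | h
    · exact hPmin ⟨Set.mem_insert_of_mem _ hS, hS0⟩ (by rw [h]; exact le_top)
    · rcases hA'.total h hS with h | h
      · exact h
      · exact hPmin ⟨Set.mem_insert_of_mem _ hS, hS0⟩ h
  -- In the second chain (with `⊤` and `⊥` added), `Q` is the smallest member meeting `P` and `R`
  -- below is the largest one missing it. A vector of `Q ⊓ P` outside `R` and a functional vanishing
  -- on `R` then serve both chains.
  obtain ⟨Q, hQ, hQmin⟩ := ((hB.insert ⊤).subset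
    (Set.sep_subset _ fun S => S ⊓ P ≠ ⊥)).exists_minimal
      ⟨⊤, Set.mem_insert _ _, by rw [top_inf_eq]; exact hP.2⟩
  have hQle : ∀ S ∈ B, S ⊓ P ≠ ⊥ → Q ≤ S := by
    intro S hS hS0
    rcases hQ.1 with h | h
    · exact hQmin ⟨Set.mem_insert_of_mem _ hS, hS0⟩ (by rw [h]; exact le_top)
    · rcases hB'.total h hS with h | h
      · exact h
      · exact hQmin ⟨Set.mem_insert_of_mem _ hS, hS0⟩ h
  obtain ⟨R, hR, hRmax⟩ := ((hB.insert ⊥).subset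
    (Set.sep_subset _ fun S => S ⊓ P = ⊥)).exists_maximal
      ⟨⊥, Set.mem_insert _ _, bot_inf_eq _⟩
  have hRge : ∀ S ∈ B, S ⊓ P = ⊥ → S ≤ R := by
    intro S hS hS0
    rcases hR.1 with h | h
    · exact hRmax ⟨Set.mem_insert_of_mem _ hS, hS0⟩ (by rw [h]; exact bot_le)
    · rcases hB'.total h hS with h | h
      · exact hRmax ⟨Set.mem_insert_of_mem _ hS, hS0⟩ h
      · exact h
  obtain ⟨v, hv, hv0⟩ := Submodule.exists_mem_ne_zero_of_ne_bot hQ.2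
  have hvR : v ∉ R := fun h => hv0 (by
    have : v ∈ R ⊓ P := ⟨h, hv.2⟩
    rwa [hR.2, Submodule.mem_bot] at this)
  obtain ⟨ξ, hξv, hξR⟩ := Submodule.exists_le_ker_of_notMem hvR
  refine ⟨v, (ξ v)⁻¹ • ξ, inv_mul_cancel₀ hξv, ?_⟩
  have hker : LinearMap.ker ξ ≤ LinearMap.ker ((ξ v)⁻¹ • ξ) := fun x hx => by
    rw [LinearMap.mem_ker] at hx ⊢
    rw [LinearMap.smul_apply, hx, smul_zero]
  rintro S (hS | hS)
  · by_cases h : S = ⊥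
    · exact Or.inr (by rw [h]; exact bot_le)
    · exact Or.inl (hPle S hS h hv.2)
  · by_cases h : S ⊓ P = ⊥
    · exact Or.inr (((hRge S hS h).trans hξR).trans hker)
    · exact Or.inl (hQle S hS h hv.1)

end TwoChains

namespace QuiverRep

variable {k : Type u} [Field k] {V : Type w} [Quiver.{v} V]

section MapsToVertex

variable {X : QuiverRep k V} {o : V} (ψ : ∀ c, X.obj c →ₗ[k] X.obj o)

/-- The preimage of a subspace under compatible maps to the space at a vertex. -/
def Sub.comapFamily (hψ : ∀ {a b : V} (f : a ⟶ b) (x : X.obj a), ψ b (X.map f x) = ψ a x)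
    (S : Submodule k (X.obj o)) : Sub X where
  carrier c := S.comap (ψ c)
  map_mem f x hx := by
    rw [Submodule.mem_comap] at hx ⊢
    rwa [hψ f x]

variable {ψ}

/-- A representation with compatible injective maps to the space at a vertex whose images form two
chains is uniform if it is indecomposable. -/
theorem uniformElement_top_of_two_chains [Finite V] (hX : IndecElement (⊤ : Sub X))
    (hψ : ∀ {a b : V} (f : a ⟶ b) (x : X.obj a), ψ b (X.map f x) = ψ a x)
    (hψo : ∀ x, ψ o x = x) (hinj : ∀ c, Function.Injective (ψ c))
    (hmem : ∀ (A : Sub X) (c : V), ∀ x ∈ A.carrier c, ψ c x ∈ A.carrier o) {P Q : Set V}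
    (hPQ : ∀ c, c ∈ P ∨ c ∈ Q)
    (hP : IsChain (· ≤ ·) ((fun c => LinearMap.range (ψ c)) '' P))
    (hQ : IsChain (· ≤ ·) ((fun c => LinearMap.range (ψ c)) '' Q)) :
    UniformElement (⊤ : Sub X) := by
  have hnt : Nontrivial (X.obj o) := by
    obtain ⟨a, x, -, hx⟩ := exists_ne_zero_of_ne_bot hX.1
    exact ⟨⟨ψ a x, 0, fun h => hx (hinj a (h.trans (map_zero _).symm))⟩⟩
  obtain ⟨v, ξ, hξv, hvξ⟩ := exists_mem_or_le_ker_of_isChain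
    ((Set.toFinite P).image _) ((Set.toFinite Q).image _) hP hQ
  have hvξ' : ∀ c, v ∈ LinearMap.range (ψ c) ∨ LinearMap.range (ψ c) ≤ LinearMap.ker ξ :=
    fun c => hvξ _ ((hPQ c).imp (fun h => ⟨c, h, rfl⟩) (fun h => ⟨c, h, rfl⟩))
  have hv0 : v ≠ 0 := fun h => by rw [h, map_zero] at hξv; exact zero_ne_one hξv
  -- Line and hyperplane are pulled back to all vertices. They stay complementary at `c` because the
  -- image of `ψ c` contains `v` or lies in the hyperplane. Indecomposability then forces the
  -- hyperplane to be zero.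
  set I := Sub.comapFamily ψ hψ (k ∙ v) with hI
  set W := Sub.comapFamily ψ hψ (LinearMap.ker ξ) with hW
  have hIW : IsCompl I W := by
    rw [Sub.isCompl_iff]
    intro c
    constructor
    · rw [Submodule.disjoint_def]
      intro x hx hx'
      obtain ⟨t, ht⟩ := Submodule.mem_span_singleton.1 (show ψ c x ∈ k ∙ v from hx)
      have h0 : ξ (ψ c x) = 0 := hx'
      rw [← ht, map_smul, hξv, smul_eq_mul, mul_one] at h0
      rw [h0, zero_smul] at ht
      exact hinj c (by rw [← ht, map_zero])
    · rw [_root_.codisjoint_iff, _root_.eq_top_iff]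
      intro x _
      rcases hvξ' c with ⟨y, hy⟩ | h
      · rw [← add_sub_cancel (ξ (ψ c x) • y) x]
        refine Submodule.add_mem_sup (Submodule.smul_mem _ _ ?_) ?_
        · change ψ c y ∈ k ∙ v
          rw [hy]; exact Submodule.mem_span_singleton_self v
        · change ξ (ψ c _) = 0
          rw [map_sub, map_smul, map_sub, map_smul, hy, hξv, smul_eq_mul, mul_one, sub_self]
      · exact Submodule.mem_sup_right (h ⟨x, rfl⟩)
  rcases hX.2 _ _ hIW.disjoint hIW.sup_eq_top with h | h
  · have h1 := (Submodule.eq_bot_iff _).1 (Sub.eq_bot_iff.1 h o) v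
      (by change ψ o v ∈ k ∙ v; rw [hψo]; exact Submodule.mem_span_singleton_self v)
    exact absurd h1 hv0
  · refine uniformElement_top_of_forall_mem hv0 fun A hA => ?_
    obtain ⟨c, x, hx, hx0⟩ := exists_ne_zero_of_ne_bot hA
    have h1 := hmem A c x hx
    have h2 : ψ c x - ξ (ψ c x) • v = 0 := (Submodule.eq_bot_iff _).1 (Sub.eq_bot_iff.1 h o) _
      (by
        change ξ (ψ o _) = 0
        rw [hψo, map_sub, map_smul, hξv, smul_eq_mul, mul_one, sub_self])
    rw [sub_eq_zero] at h2
    have h3 : ξ (ψ c x) ≠ 0 := fun h0 => hx0 (hinj c (by rw [h2, h0, zero_smul, map_zero]))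
    rw [h2, Submodule.smul_mem_iff _ h3] at h1
    exact h1

end MapsToVertex

variable [Finite V] [∀ a b : V, Finite (a ⟶ b)]

/-- Either some nonzero vector off the sink dies under its outgoing arrow, and the chain argument
applies, or all maps are injective and the spaces embed in the one at the sink, each branch giving a
chain of subspaces. -/
theorem indecUniform_of_isTwoBranch {c : V → ℤ} (hc : IsTwoBranch c) : IndecUniform k V := by
  intro X hX
  have hV := hc.outDegreeLeOne
  set Φ := X.totalMap with hΦ
  obtain ⟨o, ho⟩ := hc.exists_zero
  have hnil : IsNilpotent Φ := by
    obtain ⟨N, hN⟩ : ∃ N, ∀ a, (c a).natAbs < N := by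
      obtain ⟨N, hN⟩ := (Set.finite_range fun a => (c a).natAbs).bddAbove
      exact ⟨N + 1, fun a => Nat.lt_succ_of_le (hN ⟨a, rfl⟩)⟩
    refine ⟨N, LinearMap.ext fun x => funext fun b => ?_⟩
    have key : ∀ s b, N ≤ (c b).natAbs + s → (Φ ^ s) x b = 0 := by
      intro s
      induction s with
      | zero => intro b hb; exact absurd (hN b) (by omega)
      | succ s ih =>
        intro b hb
        let _ : ∀ b : V, Fintype (Σ a, (a ⟶ b)) := fun _ => Fintype.ofFinite _
        rw [pow_succ', Module.End.mul_apply, hΦ, totalMap_apply]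
        refine Finset.sum_eq_zero fun p _ => ?_
        rw [← hΦ, ih p.1 (by have := hc.natAbs_eq p.2; omega), map_zero]
    exact key N b (by omega)
  -- The sink is excluded, since both branches enter it and histories there are not unique.
  by_cases hker : ∃ i, c i ≠ 0 ∧ ∃ x : X.obj i, x ≠ 0 ∧ Φ (X.single i x) = 0
  · obtain ⟨i, hi, hx⟩ := hker
    exact uniformElement_top_of_nilpotent hV hX hnil hc.inDegreeLeOneOn hi hx
  have hker' : ∀ i, c i ≠ 0 → ∀ x : X.obj i, Φ (X.single i x) = 0 → x = 0 := fun i hi x hx => by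
    by_contra h
    exact hker ⟨i, hi, x, h, hx⟩
  -- The composite along the unique path to the sink, whose length is the absolute value of the
  -- coordinate.
  let ψ : ∀ a, X.obj a →ₗ[k] X.obj o := fun a =>
    LinearMap.proj o ∘ₗ (Φ ^ (c a).natAbs) ∘ₗ X.single a
  have hψ : ∀ {a b : V} (f : a ⟶ b) (x : X.obj a), ψ b (X.map f x) = ψ a x := by
    intro a b f x
    change (Φ ^ (c b).natAbs) (X.single b (X.map f x)) o = (Φ ^ (c a).natAbs) (X.single a x) o
    rw [hc.natAbs_eq f, pow_succ, Module.End.mul_apply, hΦ, totalMap_single hV f]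
  have hψo : ∀ x, ψ o x = x := by
    intro x
    change (Φ ^ (c o).natAbs) (X.single o x) o = x
    rw [ho, Int.natAbs_zero, pow_zero, Module.End.one_apply, single_same]
  have hψ0 : ∀ n a, (c a).natAbs = n → ∀ x, ψ a x = 0 → x = 0 := by
    intro n
    induction n with
    | zero =>
      intro a ha x hx
      obtain rfl : a = o := hc.inj (by omega)
      rwa [hψo] at hx
    | succ n ih =>
      intro a ha x hx
      have ha0 : c a ≠ 0 := by omega
      obtain ⟨b, ⟨f⟩⟩ := hc.exists_arrow a ha0
      rw [← hψ f] at hx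
      have h1 := ih b (by have := hc.natAbs_eq f; omega) _ hx
      exact hker' a ha0 x (by rw [hΦ, totalMap_single hV f, h1, map_zero])
  have hchain : ∀ n a b, (c a).natAbs = n → (c b).natAbs ≤ (c a).natAbs →
      (0 ≤ c a ∧ 0 ≤ c b ∨ c a ≤ 0 ∧ c b ≤ 0) →
      LinearMap.range (ψ a) ≤ LinearMap.range (ψ b) := by
    intro n
    induction n with
    | zero =>
      intro a b ha hb _
      rw [hc.inj (show c a = c b by omega)]
    | succ n ih =>
      intro a b ha hb hs
      rcases hb.eq_or_lt with h | h
      · rw [hc.inj (show c a = c b by omega)]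
      · obtain ⟨a', ⟨f⟩⟩ := hc.exists_arrow a (by omega)
        refine le_trans ?_ (ih a' b (by have := hc.natAbs_eq f; omega)
          (by have := hc.natAbs_eq f; omega) (by have := hc.arrow f; omega))
        rintro _ ⟨x, rfl⟩
        exact ⟨X.map f x, hψ f x⟩
  refine uniformElement_top_of_two_chains (P := {a | 0 ≤ c a}) (Q := {a | c a ≤ 0}) (ψ := ψ) hX hψ
    hψo (fun a => (injective_iff_map_eq_zero (ψ a)).2 (hψ0 _ a rfl)) ?_ (fun a => le_total 0 (c a)) ?_ ?_
  · intro A a x hx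
    exact Sub.mem_total.1 (Sub.totalMap_pow_mem_total (Sub.single_mem_total hx) _) o
  · rintro _ ⟨a, ha, rfl⟩ _ ⟨b, hb, rfl⟩ _
    exact (le_total (c b).natAbs (c a).natAbs).imp
      (fun h => hchain _ a b rfl h (Or.inl ⟨ha, hb⟩)) (fun h => hchain _ b a rfl h (Or.inl ⟨hb, ha⟩))
  · rintro _ ⟨a, ha, rfl⟩ _ ⟨b, hb, rfl⟩ _
    exact (le_total (c b).natAbs (c a).natAbs).imp
      (fun h => hchain _ a b rfl h (Or.inr ⟨ha, hb⟩)) (fun h => hchain _ b a rfl h (Or.inr ⟨hb, ha⟩))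

end QuiverRep

/-! ### Indecomposable modules over a principal ideal domain -/

section PID

open DirectSum

/-- R/(p^e) has a simple socle generated by p^(e-1): a nonzero class is p^a s with a < e and s prime
to p, and s is invertible modulo p^e by Bézout. -/
theorem pow_pred_mem_of_ne_bot {R : Type*} [CommRing R] [IsDomain R] [IsPrincipalIdealRing R]
    {p : R} (hp : Irreducible p) {e : ℕ} {C : Submodule R (R ⧸ R ∙ p ^ e)} (hC : C ≠ ⊥) :
    Submodule.Quotient.mk (p ^ (e - 1)) ∈ C := by
  obtain ⟨x, hxC, hx0⟩ := Submodule.exists_mem_ne_zero_of_ne_bot hC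
  obtain ⟨r, rfl⟩ := Submodule.Quotient.mk_surjective _ x
  have hr : ¬ p ^ e ∣ r := fun h => hx0 ((Submodule.Quotient.mk_eq_zero _).2
    (Ideal.mem_span_singleton.2 h))
  have hr0 : r ≠ 0 := fun h => hr (h ▸ dvd_zero _)
  obtain ⟨a, s, hs, hrs⟩ := WfDvdMonoid.max_power_factor hr0 hp
  have hae : a < e := by
    by_contra! h
    exact hr (hrs ▸ (pow_dvd_pow p h).mul_right s)
  have hcop : IsCoprime (p ^ e) s := IsCoprime.pow_left ((hp.coprime_iff_not_dvd).2 hs)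
  obtain ⟨β, α, hαβ⟩ := hcop
  have hmem := C.smul_mem (p ^ (e - 1 - a) * α) hxC
  rw [← Submodule.Quotient.mk_smul] at hmem
  convert hmem using 1
  rw [Submodule.Quotient.eq]
  refine Ideal.mem_span_singleton.2 ⟨p ^ (e - 1) * β, ?_⟩
  have h1 : p ^ (e - 1) = p ^ (e - 1 - a) * p ^ a := by rw [← pow_add]; congr 1; omega
  rw [smul_eq_mul, hrs]
  linear_combination (-p ^ (e - 1)) * hαβ + (α * s) * h1

/-- By the structure theorem some projection onto a cyclic primary summand is nonzero;
indecomposability makes it injective. All nonzero submodules then contain the preimage of the socle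
generator. -/
theorem not_disjoint_of_indecomposable {R M : Type*} [CommRing R] [IsDomain R]
    [IsPrincipalIdealRing R] [AddCommGroup M] [Module R M] [Module.Finite R M]
    (hM : Module.IsTorsion R M)
    (hind : ∀ P Q : Submodule R M, IsCompl P Q → P = ⊥ ∨ Q = ⊥) {C D : Submodule R M}
    (hC : C ≠ ⊥) (hD : D ≠ ⊥) : ¬ Disjoint C D := by
  classical
  obtain ⟨ι, _, p, hp, e, ⟨φ⟩⟩ := Module.equiv_directSum_of_isTorsion hM
  obtain ⟨x, hxC, hx0⟩ := Submodule.exists_mem_ne_zero_of_ne_bot hC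
  obtain ⟨i, hi⟩ : ∃ i, φ x i ≠ 0 := by
    by_contra! h
    exact hx0 (φ.injective (by rw [map_zero]; exact DFinsupp.ext h))
  let π : M →ₗ[R] R ⧸ R ∙ p i ^ e i := DirectSum.component R ι (fun i => R ⧸ R ∙ p i ^ e i) i ∘ₗ φ.toLinearMap
  let σ : (R ⧸ R ∙ p i ^ e i) →ₗ[R] M := φ.symm.toLinearMap ∘ₗ DirectSum.lof R ι (fun i => R ⧸ R ∙ p i ^ e i) i
  have hπσ : ∀ y, π (σ y) = y := fun y => by
    simp only [π, σ, LinearMap.comp_apply, LinearEquiv.coe_coe, LinearEquiv.apply_symm_apply]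
    exact DirectSum.component.lof_self R (M := fun i => R ⧸ R ∙ p i ^ e i) i y
  have hcompl : IsCompl (LinearMap.ker π) (LinearMap.range σ) := by
    constructor
    · rw [Submodule.disjoint_def]
      rintro _ hy ⟨y, rfl⟩
      rw [LinearMap.mem_ker, hπσ] at hy
      rw [hy, map_zero]
    · rw [codisjoint_iff, eq_top_iff]
      intro y _
      rw [← sub_add_cancel y (σ (π y))]
      refine Submodule.add_mem_sup ?_ ⟨_, rfl⟩
      rw [LinearMap.mem_ker, map_sub, hπσ, sub_self]
  have hinj : Function.Injective π := by
    rcases hind _ _ hcompl with h | h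
    · exact LinearMap.ker_eq_bot.1 h
    · have h1 : σ (π x) = 0 := (Submodule.eq_bot_iff _).1 h _ ⟨_, rfl⟩
      have h2 := hπσ (π x)
      rw [h1, map_zero] at h2
      exact absurd h2.symm hi
  have hmap : ∀ S : Submodule R M, S ≠ ⊥ →
      Submodule.Quotient.mk (p i ^ (e i - 1)) ∈ S.map π := fun S hS =>
    pow_pred_mem_of_ne_bot (hp i) fun h => hS ((Submodule.map_injective_of_injective hinj) (h.trans (Submodule.map_bot π).symm))
  obtain ⟨c, hc, hc'⟩ := hmap C hC
  obtain ⟨d, hd, hd'⟩ := hmap D hD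
  intro hdis
  have hcd : c = d := hinj (hc'.trans hd'.symm)
  have hc0 : c = 0 := Submodule.disjoint_def.1 hdis c hc (hcd ▸ hd)
  -- If the socle generator were zero, the truncated exponent `e i - 1` would force `e i = 0`,
  -- making the summand zero although `φ x i ≠ 0`.
  rw [hc0, map_zero, eq_comm, Submodule.Quotient.mk_eq_zero] at hc'
  have hdvd : p i ^ e i ∣ p i ^ (e i - 1) := Ideal.mem_span_singleton.1 hc'
  rw [pow_dvd_pow_iff (hp i).ne_zero (hp i).not_isUnit] at hdvd
  have he : e i = 0 := by omega
  refine hi ?_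
  obtain ⟨r, hr⟩ := Submodule.Quotient.mk_surjective _ (φ x i)
  rw [← hr, Submodule.Quotient.mk_eq_zero, Ideal.submodule_span_eq, Ideal.mem_span_singleton, he,
    pow_zero]
  exact one_dvd r

/-- For an endomorphism of a finite-dimensional space that admits no nontrivial decomposition, any
two nonzero invariant subspaces meet. -/
theorem not_disjoint_of_invariant {k F : Type*} [Field k] [AddCommGroup F] [Module k F]
    [FiniteDimensional k F] (θ : Module.End k F)
    (hind : ∀ P Q : Submodule k F, (∀ x ∈ P, θ x ∈ P) → (∀ x ∈ Q, θ x ∈ Q) → IsCompl P Q →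
      P = ⊥ ∨ Q = ⊥) {C D : Submodule k F} (hC : C ≠ ⊥) (hD : D ≠ ⊥) (hC' : ∀ x ∈ C, θ x ∈ C)
    (hD' : ∀ x ∈ D, θ x ∈ D) : ¬ Disjoint C D := by
  let Ψ := Module.AEval.mapSubmodule k F θ
  have hinv : ∀ P : (Algebra.lsmul k k F θ).invtSubmodule, ∀ x ∈ P.1, θ x ∈ P.1 :=
    fun P x hx => P.2 hx
  have hbot : ∀ P : (Algebra.lsmul k k F θ).invtSubmodule, P = ⊥ ↔ P.1 = ⊥ := fun P =>
    ⟨fun h => by rw [h]; rfl, fun h => Subtype.ext h⟩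
  -- The endomorphism makes `F` a torsion `k[T]`-module whose submodules are the invariant
  -- subspaces.
  have key := not_disjoint_of_indecomposable (R := Polynomial k) (M := Module.AEval k F θ)
    (Module.AEval.isTorsion_of_finiteDimensional k F θ) (C := Ψ ⟨C, fun x hx => hC' x hx⟩)
    (D := Ψ ⟨D, fun x hx => hD' x hx⟩) ?_ ?_ ?_
  · intro h
    refine key ((disjoint_map_orderIso_iff Ψ).2 ?_)
    rw [disjoint_iff, hbot]
    exact h.eq_bot
  · intro P Q hPQ
    have h1 := Ψ.symm.isCompl hPQ
    have h2 := hind (Ψ.symm P).1 (Ψ.symm Q).1 (hinv _) (hinv _)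
      ⟨disjoint_iff.2 (congrArg Subtype.val h1.inf_eq_bot),
        codisjoint_iff.2 (congrArg Subtype.val h1.sup_eq_top)⟩
    rw [← hbot, ← hbot, map_eq_bot_iff, map_eq_bot_iff] at h2
    exact h2
  · rw [Ne, map_eq_bot_iff, hbot]; exact hC
  · rw [Ne, map_eq_bot_iff, hbot]; exact hD

end PID

/-! ### Cyclic quivers -/

/-- The quiver is an oriented cycle with successor function `nx`. -/
structure IsCycle {V : Type w} [Quiver.{v} V] (nx : V → V) : Prop where
  inj : Function.Injective nx
  arrow : ∀ {a b : V}, (a ⟶ b) → b = nx a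
  subsingleton : ∀ a b : V, Subsingleton (a ⟶ b)
  exists_arrow : ∀ a, Nonempty (a ⟶ nx a)
  exists_iterate : ∀ a b, ∃ s, nx^[s] a = b

namespace IsCycle

variable {V : Type w} [Quiver.{v} V] {nx : V → V}

theorem outDegreeLeOne (h : IsCycle nx) : OutDegreeLeOne V := by
  intro a
  constructor
  rintro ⟨b, f⟩ ⟨b', f'⟩
  obtain rfl : b = b' := (h.arrow f).trans (h.arrow f').symm
  rw [(h.subsingleton a b).elim f f']

theorem inDegreeLeOneOn (h : IsCycle nx) : InDegreeLeOneOn fun _ : V => True := by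
  intro b _
  refine ⟨⟨?_⟩, fun _ _ => trivial⟩
  rintro ⟨a, f⟩ ⟨a', f'⟩
  obtain rfl : a = a' := h.inj ((h.arrow f).symm.trans (h.arrow f'))
  rw [(h.subsingleton a b).elim f f']

end IsCycle

namespace QuiverRep

variable {k : Type u} [Field k] {V : Type w} [Quiver.{v} V] [Finite V]
  [∀ a b : V, Finite (a ⟶ b)] {X : QuiverRep k V} {nx : V → V}

theorem exists_totalMap_pow_single_iterate (hc : IsCycle nx) (s : ℕ) (a : V) (x : X.obj a) :
    ∃ y, (X.totalMap ^ s) (X.single a x) = X.single (nx^[s] a) y := by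
  induction s generalizing a with
  | zero => exact ⟨x, rfl⟩
  | succ s ih =>
    obtain ⟨f⟩ := hc.exists_arrow a
    rw [pow_succ, Module.End.mul_apply, totalMap_single hc.outDegreeLeOne f]
    exact ih _ _

/-- As `nx` is injective, no other vertex reaches `nx^[s] a` in `s` steps. -/
theorem totalMap_pow_apply_iterate (hc : IsCycle nx) (s : ℕ) (a : V) (x : ∀ a, X.obj a) :
    (X.totalMap ^ s) x (nx^[s] a) = (X.totalMap ^ s) (X.single a (x a)) (nx^[s] a) := by
  obtain ⟨b, hb⟩ := totalMap_pow_apply_of_inDegree (X := X) hc.inDegreeLeOneOn s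
    (i := nx^[s] a) trivial
  have := Fintype.ofFinite V
  by_cases hba : b = a
  · rw [hb, hba]
  · have h0 : ∀ y : X.obj b, (X.totalMap ^ s) (X.single b y) (nx^[s] a) = 0 := fun y => by
      obtain ⟨z, hz⟩ := exists_totalMap_pow_single_iterate hc s b y
      rw [hz, single_ne X fun h => hba (hc.inj.iterate s h.symm)]
    rw [hb, hb (X.single a (x a)), h0, h0]

/-- The subspace of all elements of the product with all iterates having their component at a vertex
in a given subspace. -/
noncomputable def iterateComap (X : QuiverRep k V) {o : V} (A : Submodule k (X.obj o)) :
    Submodule k (∀ a, X.obj a) :=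
  ⨅ s : ℕ, A.comap (LinearMap.proj o ∘ₗ (X.totalMap ^ s))

theorem mem_iterateComap {o : V} {A : Submodule k (X.obj o)} {x : ∀ a, X.obj a} :
    x ∈ iterateComap X A ↔ ∀ s, (X.totalMap ^ s) x o ∈ A := by
  simp [iterateComap]

theorem totalMap_mem_iterateComap {o : V} {A : Submodule k (X.obj o)} {x : ∀ a, X.obj a}
    (hx : x ∈ iterateComap X A) : X.totalMap x ∈ iterateComap X A := by
  rw [mem_iterateComap] at hx ⊢
  intro s
  rw [← Module.End.mul_apply, ← pow_succ]
  exact hx (s + 1)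

/-- All information sits at one vertex `o`, in the return map `θ` once around the cycle. A
`θ`-invariant decomposition of the space at `o` spreads to the whole representation by taking the
vectors whose iterates all land in the given summand. So `θ` admits no decomposition, and its
invariant subspaces meet. -/
theorem uniformElement_top_of_bijective (hc : IsCycle nx) (hX : IndecElement (⊤ : Sub X))
    (hinj : Function.Injective X.totalMap) : UniformElement (⊤ : Sub X) := by
  have hV := hc.outDegreeLeOne
  set Φ := X.totalMap with hΦ
  have hinj' : ∀ s : ℕ, Function.Injective ⇑(Φ ^ s) := fun s => by
    rw [Module.End.coe_pow]; exact hinj.iterate s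
  have hsurj' : ∀ s : ℕ, Function.Surjective ⇑(Φ ^ s) := fun s =>
    LinearMap.injective_iff_surjective.1 (hinj' s)
  obtain ⟨o, -⟩ := exists_ne_zero_of_ne_bot hX.1
  have hper : ∃ n, 0 < n ∧ nx^[n] o = o := by
    obtain ⟨s, hs⟩ := hc.exists_iterate (nx o) o
    exact ⟨s + 1, by omega, by rw [Function.iterate_succ_apply, hs]⟩
  -- With the minimal period, every return time to `o` is a multiple of `N`, so every return is by a
  -- power of `θ`.
  set N := Function.minimalPeriod nx o with hN
  have hNo : nx^[N] o = o := Function.iterate_minimalPeriod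
  let θ : Module.End k (X.obj o) := LinearMap.proj o ∘ₗ (Φ ^ N) ∘ₗ X.single o
  have hsingle : ∀ s a, nx^[s] a = o → ∀ x : X.obj a,
      (Φ ^ s) (X.single a x) = X.single o ((Φ ^ s) (X.single a x) o) := by
    intro s a hs x
    obtain ⟨y, hy⟩ := exists_totalMap_pow_single_iterate (X := X) hc s a x
    subst hs
    rw [hΦ, hy, single_same]
  have hzero : ∀ s a, nx^[s] a ≠ o → ∀ x : X.obj a, (Φ ^ s) (X.single a x) o = 0 := by
    intro s a hs x
    obtain ⟨y, hy⟩ := exists_totalMap_pow_single_iterate (X := X) hc s a x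
    rw [hΦ, hy, single_ne X (Ne.symm hs)]
  have hθ : ∀ x, (Φ ^ N) (X.single o x) = X.single o (θ x) := fun x => hsingle N o hNo x
  have hθpow : ∀ n x, (Φ ^ (N * n)) (X.single o x) = X.single o ((θ ^ n) x) := by
    intro n
    induction n with
    | zero => intro x; rfl
    | succ n ih =>
      intro x
      rw [Nat.mul_succ, pow_add, Module.End.mul_apply, hθ, ih, pow_succ, Module.End.mul_apply]
  have hθmem : ∀ A : Submodule k (X.obj o), (∀ x ∈ A, θ x ∈ A) → ∀ n, ∀ x ∈ A, (θ ^ n) x ∈ A := by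
    intro A hA n
    induction n with
    | zero => intro x hx; exact hx
    | succ n ih => intro x hx; rw [pow_succ, Module.End.mul_apply]; exact ih _ (hA x hx)
  have hmemA : ∀ A : Submodule k (X.obj o), (∀ x ∈ A, θ x ∈ A) → ∀ x ∈ A, ∀ s,
      (Φ ^ s) (X.single o x) o ∈ A := by
    intro A hA x hx s
    by_cases hs : nx^[s] o = o
    · obtain ⟨n, rfl⟩ := (Function.isPeriodicPt_iff_minimalPeriod_dvd (f := nx) (x := o)).1 hs
      rw [hθpow, single_same]
      exact hθmem A hA n x hx
    · rw [hzero s o hs]; exact zero_mem _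
  have key : ∀ A B : Submodule k (X.obj o), (∀ x ∈ A, θ x ∈ A) → (∀ x ∈ B, θ x ∈ B) →
      IsCompl A B → A = ⊥ ∨ B = ⊥ := by
    intro A B hA hB hAB
    have hbot : ∀ A : Submodule k (X.obj o), (∀ x ∈ A, θ x ∈ A) →
        Sub.ofInvariant hV (iterateComap X A) (fun _ => totalMap_mem_iterateComap) = ⊥ →
        A = ⊥ := by
      intro A hA h
      refine (Submodule.eq_bot_iff _).2 fun x hx => ?_
      exact (Submodule.eq_bot_iff _).1 (Sub.eq_bot_iff.1 h o) x
        (mem_iterateComap.2 (hmemA A hA x hx))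
    have hcompl : IsCompl
        (Sub.ofInvariant hV (iterateComap X A) (fun _ => totalMap_mem_iterateComap))
        (Sub.ofInvariant hV (iterateComap X B) (fun _ => totalMap_mem_iterateComap)) := by
      rw [Sub.isCompl_iff]
      intro a
      have hex := hc.exists_iterate a o
      constructor
      · rw [Submodule.disjoint_def]
        intro x hxA hxB
        obtain ⟨s, hs⟩ := hex
        have h0 := Submodule.disjoint_def.1 hAB.disjoint _ (mem_iterateComap.1 hxA s)
          (mem_iterateComap.1 hxB s)
        have h1 := hsingle s a hs x
        rw [hΦ, h0, map_zero] at h1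
        exact X.single_injective a (hinj' s (h1.trans (by rw [map_zero, map_zero])))
      · rw [_root_.codisjoint_iff, _root_.eq_top_iff]
        intro x _
        classical
        -- The first arrival time at `o`: earlier iterates have no component there, so only the
        -- iterates from time `s` on impose conditions on a lift.
        set s := Nat.find hex with hsdef
        have hs : nx^[s] a = o := Nat.find_spec hex
        have lift : ∀ (A : Submodule k (X.obj o)), (∀ x ∈ A, θ x ∈ A) → ∀ α ∈ A,
            ∃ y : X.obj a, X.single a y ∈ iterateComap X A ∧
              (Φ ^ s) (X.single a y) = X.single o α := by
          intro A hA α hα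
          obtain ⟨y, hy⟩ := hsurj' s (X.single o α)
          have h1 : (Φ ^ s) (X.single a (y a)) = X.single o α := by
            have h2 := totalMap_pow_apply_iterate hc s a y
            rw [hs, ← hΦ, hy, single_same] at h2
            rw [hsingle s a hs, ← h2]
          refine ⟨y a, mem_iterateComap.2 fun r => ?_, h1⟩
          rcases lt_or_ge r s with hr | hr
          · rw [← hΦ, hzero r a (Nat.find_min hex hr)]
            exact zero_mem _
          · obtain ⟨t, rfl⟩ := Nat.exists_eq_add_of_le' hr
            rw [pow_add, Module.End.mul_apply, ← hΦ, h1]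
            exact hmemA A hA α hα t
        obtain ⟨α, hα, β, hβ, hαβ⟩ := Submodule.mem_sup.1
          (hAB.codisjoint.eq_top ▸ Submodule.mem_top : (Φ ^ s) (X.single a x) o ∈ A ⊔ B)
        obtain ⟨y, hyA, hy⟩ := lift A hA α hα
        obtain ⟨z, hzB, hz⟩ := lift B hB β hβ
        refine Submodule.mem_sup.2 ⟨y, hyA, z, hzB, X.single_injective a (hinj' s ?_)⟩
        rw [map_add, map_add, hy, hz, hsingle s a hs x, ← map_add, hαβ]
    exact (hX.2 _ _ hcompl.disjoint hcompl.sup_eq_top).imp (hbot A hA) (hbot B hB)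
  refine ⟨hX.1, fun C D _ _ hCD => ?_⟩
  by_contra! hne
  have hinv : ∀ C : Sub X, ∀ x ∈ C.carrier o, θ x ∈ C.carrier o := fun C x hx =>
    Sub.mem_total.1 (Sub.totalMap_pow_mem_total (Sub.single_mem_total hx) N) o
  have hne' : ∀ C : Sub X, C ≠ ⊥ → C.carrier o ≠ ⊥ := by
    intro C hC h
    obtain ⟨a, x, hx, hx0⟩ := exists_ne_zero_of_ne_bot hC
    obtain ⟨s, hs⟩ := hc.exists_iterate a o
    have h1 : (Φ ^ s) (X.single a x) o = 0 := (Submodule.eq_bot_iff _).1 h _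
      (Sub.mem_total.1 (Sub.totalMap_pow_mem_total (Sub.single_mem_total hx) s) o)
    have h2 := hsingle s a hs x
    rw [h1, map_zero] at h2
    exact hx0 (X.single_injective a (hinj' s (h2.trans (by rw [map_zero, map_zero]))))
  exact not_disjoint_of_invariant θ key (hne' C hne.1) (hne' D hne.2) (hinv C) (hinv D)
    (Sub.disjoint_iff.1 hCD o)

/-- By Fitting's lemma the kernel and the image of a high power of Φ are complementary, and both are
homogeneous. So Φ is injective, or nilpotent with a kernel vector to which the chain argument
applies. -/
theorem indecUniform_of_isCycle (hc : IsCycle nx) : IndecUniform k V := by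
  intro X hX
  have hV := hc.outDegreeLeOne
  have := Fintype.ofFinite V
  set Φ := X.totalMap with hΦ
  -- Positivity of `n` is what lets injectivity of `Φ ^ n` pass to `Φ`.
  obtain ⟨n, hn, hn0⟩ : ∃ n, IsCompl (LinearMap.ker (Φ ^ n)) (LinearMap.range (Φ ^ n)) ∧ 0 < n :=
    (Φ.eventually_isCompl_ker_pow_range_pow.and (Filter.eventually_gt_atTop 0)).exists
  have hcomm : Φ * Φ ^ n = Φ ^ n * Φ := by rw [← pow_succ, ← pow_succ']
  have hker : ∀ n, IsHomogeneous (LinearMap.ker (Φ ^ n)) := by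
    intro n x hx c
    rw [LinearMap.mem_ker] at hx ⊢
    obtain ⟨y, hy⟩ := exists_totalMap_pow_single_iterate (X := X) hc n c (x c)
    have h1 := totalMap_pow_apply_iterate hc n c x
    rw [← hΦ, hx, hΦ, hy, single_same] at h1
    rw [hΦ, hy, ← h1]
    exact map_zero _
  have hrange : IsHomogeneous (LinearMap.range (Φ ^ n)) := by
    rintro _ ⟨x, rfl⟩ c
    obtain ⟨a, ha⟩ := totalMap_pow_apply_of_inDegree (X := X) hc.inDegreeLeOneOn n (i := c) trivial
    rw [← hΦ] at ha
    by_cases h0 : (Φ ^ n) x c = 0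
    · rw [h0, map_zero]; exact zero_mem _
    · rw [ha] at h0 ⊢
      rw [hΦ, ← totalMap_pow_single_eq hV h0]
      exact ⟨_, rfl⟩
  have hcompl := Sub.isCompl_ofInvariant (hV := hV)
    (hS := fun x hx => by
      rw [LinearMap.mem_ker] at hx ⊢
      rw [← Module.End.mul_apply, ← hΦ, ← hcomm, Module.End.mul_apply, hx, map_zero])
    (hT := by
      rintro _ ⟨x, rfl⟩
      exact ⟨Φ x, by rw [← Module.End.mul_apply, ← hcomm]; rfl⟩) (hker n) hrange hn
  rcases hX.2 _ _ hcompl.disjoint hcompl.sup_eq_top with h | h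
  · refine uniformElement_top_of_bijective hc hX ?_
    have h1 := Sub.eq_bot_of_ofInvariant_eq_bot (hker n) h
    rw [LinearMap.ker_eq_bot, Module.End.coe_pow] at h1
    rw [← hΦ]
    exact Function.Injective.of_comp (f := Φ^[n - 1])
      (by rwa [← Function.iterate_succ, Nat.succ_eq_add_one, Nat.sub_add_cancel hn0])
  · have h1 := Sub.eq_bot_of_ofInvariant_eq_bot hrange h
    rw [LinearMap.range_eq_bot] at h1
    have h2 : LinearMap.ker (Φ ^ 1) ≠ ⊥ := by
      rw [pow_one]
      intro h2
      have h3 : Function.Injective ⇑(Φ ^ n) := by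
        rw [Module.End.coe_pow]
        exact (LinearMap.ker_eq_bot.1 h2).iterate n
      obtain ⟨a, x, -, hx⟩ := exists_ne_zero_of_ne_bot hX.1
      refine hx (X.single_injective a (h3 ?_))
      rw [h1]; rfl
    obtain ⟨x, hx, hx0⟩ := Submodule.exists_mem_ne_zero_of_ne_bot h2
    obtain ⟨i, hi⟩ : ∃ i, x i ≠ 0 := by
      by_contra! h
      exact hx0 (funext h)
    have h3 := hker 1 x hx i
    rw [LinearMap.mem_ker, pow_one] at h3
    exact uniformElement_top_of_nilpotent hV hX ⟨n, h1⟩ hc.inDegreeLeOneOn (i := i) trivial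
      ⟨x i, hi, h3⟩

end QuiverRep

/-! ### Representations on coordinate spaces -/

/-- The type of all arrows of a quiver. -/
abbrev TotalArrow (V : Type w) [Quiver.{v} V] : Type (max w v) := Σ a b : V, (a ⟶ b)

/-- The arrow `f` as a member of the type of all arrows. -/
abbrev arr {V : Type w} [Quiver.{v} V] {a b : V} (f : a ⟶ b) : TotalArrow V := ⟨a, b, f⟩

/-- A representation with a basis `T` whose members sit at vertices, given by the operators of the
arrows on `T → k`. -/
structure CoordRep (k : Type u) [Field k] (V : Type w) [Quiver.{v} V] (T : Type) where
  /-- the vertex of a basis vector -/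
  vertex : T → V
  /-- the operator of an arrow -/
  op : TotalArrow V → Module.End k (T → k)
  op_target : ∀ g e t, vertex t ≠ g.2.1 → op g e t = 0
  op_source : ∀ g e, (∀ t, vertex t = g.1 → e t = 0) → op g e = 0

namespace CoordRep

open QuiverRep

variable {k : Type u} [Field k] {V : Type w} [Quiver.{v} V] {T : Type}
  (R : CoordRep k V T)

/-- The vectors supported at a vertex. -/
def fiber (a : V) : Submodule k (T → k) where
  carrier := {e | ∀ t, R.vertex t ≠ a → e t = 0}
  zero_mem' := fun _ _ => rfl
  add_mem' := fun {x y} hx hy t ht => by rw [Pi.add_apply, hx t ht, hy t ht, add_zero]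
  smul_mem' := fun c x hx t ht => by rw [Pi.smul_apply, hx t ht, smul_zero]

open Classical in
/-- The component of a vector at a vertex. -/
noncomputable def comp (a : V) : Module.End k (T → k) :=
  LinearMap.pi fun t => if R.vertex t = a then LinearMap.proj t else 0

theorem comp_apply (a : V) (e : T → k) (t : T)
    [Decidable (R.vertex t = a)] : R.comp a e t = if R.vertex t = a then e t else 0 := by
  simp only [comp, LinearMap.pi_apply]
  split_ifs <;> rfl

theorem comp_mem_fiber (a : V) (e : T → k) :
    R.comp a e ∈ R.fiber a := fun t ht => by
  classical
  rw [comp_apply, if_neg ht]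

theorem comp_eq_self {a : V} {e : T → k} (h : e ∈ R.fiber a) :
    R.comp a e = e := by
  classical
  funext t
  rw [comp_apply]
  split_ifs with ht
  · rfl
  · exact (h t ht).symm

theorem op_comp (g : TotalArrow V) (e : T → k) :
    R.op g (R.comp g.1 e) = R.op g e := by
  classical
  rw [← sub_eq_zero, ← map_sub]
  refine R.op_source g _ fun t ht => ?_
  rw [Pi.sub_apply, comp_apply, if_pos ht, sub_self]

/-- A subspace that is homogeneous and invariant under all arrows. -/
def IsStable (S : Submodule k (T → k)) : Prop :=
  ∀ e ∈ S, (∀ a, R.comp a e ∈ S) ∧ ∀ g, R.op g e ∈ S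

theorem sum_comp [Fintype V] (e : T → k) : ∑ a, R.comp a e = e := by
  classical
  funext t
  rw [Finset.sum_apply]
  simp [comp_apply]

/-- The vectors with given coordinates zero. -/
def zeroOn (k : Type u) [Field k] {T : Type} (J : Set T) : Submodule k (T → k) where
  carrier := {e | ∀ t ∈ J, e t = 0}
  zero_mem' := fun _ _ => rfl
  add_mem' := fun {x y} hx hy t ht => by rw [Pi.add_apply, hx t ht, hy t ht, add_zero]
  smul_mem' := fun c x hx t ht => by rw [Pi.smul_apply, hx t ht, smul_zero]

/-- The condition on a set of coordinates that makes the vectors with these coordinates zero a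
stable subspace. -/
def IsClosedSet (J : Set T) : Prop :=
  ∀ e : T → k, (∀ t ∈ J, e t = 0) → ∀ g, ∀ t ∈ J, R.op g e t = 0

theorem IsClosedSet.isStable {R : CoordRep k V T} {J : Set T} (hJ : R.IsClosedSet J) : R.IsStable (zeroOn k J) := by
  classical
  intro e he
  refine ⟨fun a t ht => ?_, fun g => hJ e he g⟩
  rw [comp_apply, he t ht, ite_self]

theorem zeroOn_inf (J K : Set T) : zeroOn k J ⊓ zeroOn k K = zeroOn k (J ∪ K) := by
  ext e
  exact ⟨fun h t ht => ht.elim (h.1 t) (h.2 t),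
    fun h => ⟨fun t ht => h t (Or.inl ht), fun t ht => h t (Or.inr ht)⟩⟩

theorem zeroOn_sup (J K : Set T) : zeroOn k J ⊔ zeroOn k K = zeroOn k (J ∩ K) := by
  classical
  refine le_antisymm (sup_le (fun e he t ht => he t ht.1) (fun e he t ht => he t ht.2)) ?_
  intro e he
  refine Submodule.mem_sup.2 ⟨fun t => if t ∈ J then 0 else e t, fun t ht => if_pos ht,
    fun t => if t ∈ J then e t else 0, fun t ht => ?_, ?_⟩
  · by_cases h : t ∈ J
    · exact (if_pos h).trans (he t ⟨h, ht⟩)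
    · exact if_neg h
  · funext t
    rw [Pi.add_apply]
    split_ifs <;> simp

theorem zeroOn_univ : zeroOn k (Set.univ : Set T) = ⊥ :=
  (Submodule.eq_bot_iff _).2 fun _ he => funext fun t => he t trivial

theorem zeroOn_empty : zeroOn k (∅ : Set T) = ⊤ :=
  eq_top_iff.2 fun _ _ _ ht => ht.elim

theorem zeroOn_le {J K : Set T} (h : zeroOn k J ≤ zeroOn k K) : K ⊆ J := by
  classical
  intro t ht
  by_contra htJ
  have h1 : (Pi.single t 1 : T → k) ∈ zeroOn k J := fun s hs =>
    Pi.single_eq_of_ne (fun hst => htJ (by rw [← hst]; exact hs)) _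
  have := h h1 t ht
  rw [Pi.single_eq_same] at this
  exact one_ne_zero this

variable {R} in
theorem isStable_top : R.IsStable ⊤ :=
  fun _ _ => ⟨fun _ => Submodule.mem_top, fun _ => Submodule.mem_top⟩

variable {R} in
theorem isStable_bot : R.IsStable ⊥ := by
  intro e he
  rw [Submodule.mem_bot] at he
  simp [he]

variable [Finite T]

/-- The representation. -/
def rep : QuiverRep k V where
  obj a := R.fiber a
  map f := (R.op (arr f)).restrict fun e _ t ht => R.op_target (arr f) e t ht

/-- The component of a vector at a vertex, in the representation. -/
noncomputable def toObj (a : V) : (T → k) →ₗ[k] R.rep.obj a :=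
  (R.comp a).codRestrict (R.fiber a) (R.comp_mem_fiber a)

/-- The inclusion of the space at a vertex. -/
def ofObj (a : V) : R.rep.obj a →ₗ[k] (T → k) := (R.fiber a).subtype

theorem ofObj_toObj (a : V) (e : T → k) : R.ofObj a (R.toObj a e) = R.comp a e := rfl

theorem ofObj_injective (a : V) : Function.Injective (R.ofObj a) := Subtype.val_injective

theorem toObj_ofObj (a : V) (x : R.rep.obj a) : R.toObj a (R.ofObj a x) = x :=
  Subtype.ext (R.comp_eq_self x.2)

theorem toObj_ofObj_of_ne {a b : V} (h : b ≠ a) (x : R.rep.obj a) :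
    R.toObj b (R.ofObj a x) = 0 := by
  classical
  refine R.ofObj_injective b (funext fun t => ?_)
  rw [ofObj_toObj, comp_apply, map_zero, Pi.zero_apply]
  split_ifs with ht
  · exact x.2 t (ht ▸ h)
  · rfl

variable {R}

/-- The subrepresentation given by a stable subspace. -/
def subOf {S : Submodule k (T → k)} (hS : R.IsStable S) : Sub R.rep where
  carrier a := S.comap (R.ofObj a)
  map_mem f _ hx := (hS _ hx).2 (arr f)

theorem mem_subOf {S : Submodule k (T → k)} {hS : R.IsStable S} {a : V} {x : R.rep.obj a} :
    x ∈ (subOf hS).carrier a ↔ R.ofObj a x ∈ S := Iff.rfl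

/-- The stable subspace given by a subrepresentation. -/
noncomputable def totalOf (A : Sub R.rep) : Submodule k (T → k) :=
  ⨅ a, (A.carrier a).comap (R.toObj a)

theorem mem_totalOf {A : Sub R.rep} {e : T → k} :
    e ∈ totalOf A ↔ ∀ a, R.toObj a e ∈ A.carrier a := by
  simp [totalOf]

theorem ofObj_mem_totalOf {A : Sub R.rep} {a : V} {x : R.rep.obj a} (hx : x ∈ A.carrier a) :
    R.ofObj a x ∈ totalOf A := by
  rw [mem_totalOf]
  intro b
  by_cases h : b = a
  · subst h
    rwa [toObj_ofObj]
  · rw [toObj_ofObj_of_ne R h]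
    exact zero_mem _

theorem isStable_totalOf (A : Sub R.rep) : R.IsStable (totalOf A) := by
  intro e he
  refine ⟨fun a => ofObj_mem_totalOf (mem_totalOf.1 he a), fun g => ?_⟩
  rw [← R.op_comp]
  exact ofObj_mem_totalOf (A.map_mem g.2.2 _ (mem_totalOf.1 he g.1))

theorem isCompl_totalOf [Finite V] {A B : Sub R.rep} (h : IsCompl A B) :
    IsCompl (totalOf A) (totalOf B) := by
  have := Fintype.ofFinite V
  rw [Sub.isCompl_iff] at h
  constructor
  · rw [Submodule.disjoint_def]
    intro e hA hB
    rw [← sum_comp R e]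
    refine Finset.sum_eq_zero fun a _ => ?_
    rw [← ofObj_toObj, Submodule.disjoint_def.1 (h a).disjoint _ (mem_totalOf.1 hA a)
      (mem_totalOf.1 hB a), map_zero]
  · rw [codisjoint_iff, eq_top_iff]
    intro e _
    rw [← sum_comp R e]
    refine Submodule.sum_mem _ fun a _ => ?_
    obtain ⟨x, hx, y, hy, hxy⟩ := Submodule.mem_sup.1 ((h a).codisjoint.eq_top ▸
      Submodule.mem_top : R.toObj a e ∈ A.carrier a ⊔ B.carrier a)
    rw [← ofObj_toObj, ← hxy, map_add]
    exact Submodule.add_mem_sup (ofObj_mem_totalOf hx) (ofObj_mem_totalOf hy)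

theorem eq_bot_of_totalOf_eq_bot {A : Sub R.rep} (h : totalOf A = ⊥) : A = ⊥ := by
  refine Sub.eq_bot_iff.2 fun a => (Submodule.eq_bot_iff _).2 fun x hx => ?_
  exact R.ofObj_injective a (((Submodule.eq_bot_iff _).1 h _ (ofObj_mem_totalOf hx)).trans
    (map_zero _).symm)

theorem subOf_sup {S S' : Submodule k (T → k)} (hS : R.IsStable S) (hS' : R.IsStable S')
    (h : R.IsStable (S ⊔ S')) : subOf hS ⊔ subOf hS' = subOf h := by
  refine Sub.carrier_injective (funext fun a => le_antisymm ?_ ?_)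
  · exact sup_le (fun x hx => Submodule.mem_sup_left hx) (fun x hx => Submodule.mem_sup_right hx)
  · intro x hx
    obtain ⟨y, hy, z, hz, hyz⟩ := Submodule.mem_sup.1 (mem_subOf.1 hx)
    refine Submodule.mem_sup.2 ⟨R.toObj a y, (hS y hy).1 a, R.toObj a z, (hS' z hz).1 a, ?_⟩
    rw [← map_add, hyz, toObj_ofObj]

theorem le_of_subOf_le [Finite V] {S S' : Submodule k (T → k)} {hS : R.IsStable S}
    {hS' : R.IsStable S'} (h : subOf hS ≤ subOf hS') : S ≤ S' := by
  have := Fintype.ofFinite V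
  intro e he
  rw [← sum_comp R e]
  exact Submodule.sum_mem _ fun a _ => mem_subOf.1 (h a (mem_subOf (x := R.toObj a e) |>.2
    ((hS e he).1 a)))

theorem subOf_top : subOf (R := R) isStable_top = ⊤ := rfl

variable [Finite V]

/-- A subrepresentation is determined by the sum of its spaces inside `T → k`, so decompositions can
be sought among stable subspaces of one vector space. -/
theorem indecElement_top [Nonempty T] (hind : ∀ A B : Submodule k (T → k), R.IsStable A →
    R.IsStable B → IsCompl A B → A = ⊥ ∨ B = ⊥) : IndecElement (⊤ : Sub R.rep) := by
  constructor
  · intro h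
    obtain ⟨t⟩ := ‹Nonempty T›
    have h1 : (⊤ : Submodule k (T → k)) ≤ ⊥ := by
      refine le_of_subOf_le (R := R) (hS := isStable_top) (hS' := isStable_bot) ?_
      rw [subOf_top, h]
      exact bot_le
    have := congrFun ((Submodule.mem_bot (R := k)).1 (h1 (trivial : (fun _ => 1 : T → k) ∈ ⊤))) t
    exact one_ne_zero this
  · intro A B hd hs
    exact (hind _ _ (isStable_totalOf A) (isStable_totalOf B)
      (isCompl_totalOf ⟨hd, codisjoint_iff.2 hs⟩)).imp eq_bot_of_totalOf_eq_bot
      eq_bot_of_totalOf_eq_bot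

/-- For coordinate subspaces the lattice operations become set operations on the vanishing
coordinates, with order reversed, so a splitting can be checked on finite sets. -/
theorem splitsBelow_subOf {J K L : Set T} (hJ : R.IsClosedSet J) (hK : R.IsClosedSet K)
    (hL : R.IsClosedSet L) (h1 : ∀ t, t ∈ J ∨ t ∈ K) (h2 : ∀ t, t ∈ L ↔ t ∈ J ∧ t ∈ K)
    (h3 : ∃ t, t ∉ J) (h4 : ∃ t, t ∉ K) : SplitsBelow (subOf hL.isStable) := by
  have e1 : J ∪ K = Set.univ := Set.eq_univ_of_forall h1
  have e2 : L = J ∩ K := Set.ext h2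
  subst e2
  have hne : ∀ {J : Set T} (hJ : R.IsClosedSet J), (∃ t, t ∉ J) → subOf hJ.isStable ≠ ⊥ := by
    rintro J hJ ⟨t, ht⟩ h
    have h5 : subOf hJ.isStable ≤ subOf isStable_bot := by rw [h]; exact bot_le
    have h6 := le_of_subOf_le h5
    rw [← zeroOn_univ] at h6
    exact ht (zeroOn_le h6 trivial)
  refine ⟨subOf hJ.isStable, subOf hK.isStable, ?_, ?_, hne hJ h3, hne hK h4⟩
  · refine Sub.eq_bot_iff.2 fun a => (Submodule.eq_bot_iff _).2 fun x hx => ?_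
    have : R.ofObj a x ∈ zeroOn k J ⊓ zeroOn k K := hx
    rw [zeroOn_inf, e1, zeroOn_univ] at this
    exact R.ofObj_injective a (this.trans (map_zero _).symm)
  · rw [subOf_sup hJ.isStable hK.isStable (by rw [zeroOn_sup]; exact hL.isStable)]
    congr 1
    exact zeroOn_sup J K

theorem splitsAbove_subOf {J K L : Set T} (hJ : R.IsClosedSet J) (hK : R.IsClosedSet K)
    (hL : R.IsClosedSet L) (h1 : ∀ t, ¬ (t ∈ J ∧ t ∈ K)) (h2 : ∀ t, t ∈ L ↔ t ∈ J ∨ t ∈ K)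
    (h3 : ∃ t, t ∈ J) (h4 : ∃ t, t ∈ K) : SplitsAbove (subOf hL.isStable) := by
  have e1 : J ∩ K = ∅ := Set.eq_empty_of_forall_notMem h1
  have e2 : L = J ∪ K := Set.ext h2
  subst e2
  have hne : ∀ {J : Set T} (hJ : R.IsClosedSet J), (∃ t, t ∈ J) → subOf hJ.isStable ≠ ⊤ := by
    rintro J hJ ⟨t, htJ⟩ h
    have h5 : subOf isStable_top ≤ subOf hJ.isStable := by rw [h]; exact le_top
    have h6 := le_of_subOf_le h5
    rw [← zeroOn_empty] at h6
    exact zeroOn_le h6 htJ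
  refine ⟨subOf hJ.isStable, subOf hK.isStable, ?_, ?_, hne hJ h3, hne hK h4⟩
  · refine Sub.carrier_injective (funext fun a => Submodule.ext fun x => ?_)
    rw [mem_subOf, ← zeroOn_inf]
    rfl
  · have h5 : zeroOn k J ⊔ zeroOn k K = ⊤ := by rw [zeroOn_sup, e1, zeroOn_empty]
    rw [subOf_sup hJ.isStable hK.isStable (by rw [h5]; exact isStable_top), ← subOf_top]
    congr 1

end CoordRep

/-! ### Tools for proving indecomposability -/

section Dichotomy

variable {k : Type u} [Field k] {T : Type}

/-- An operator of rank one that preserves two complementary subspaces has its image in one of them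
and vanishes on the other. -/
theorem rank_one_dichotomy [DecidableEq T] {A B : Submodule k (T → k)} (hAB : IsCompl A B)
    (P : (T → k) → (T → k)) (hA : ∀ e ∈ A, P e ∈ A) (hB : ∀ e ∈ B, P e ∈ B) {y : T} {z : T → k}
    (hz : z ≠ 0) (hP : ∀ e, P e = e y • z) :
    (z ∈ A ∧ ∀ e ∈ B, e y = 0) ∨ (z ∈ B ∧ ∀ e ∈ A, e y = 0) := by
  obtain ⟨a, ha, b, hb, hab⟩ := Submodule.mem_sup.1
    (hAB.codisjoint.eq_top ▸ Submodule.mem_top : (Pi.single y 1 : T → k) ∈ A ⊔ B)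
  have hy : a y + b y = 1 := by rw [← Pi.add_apply, hab, Pi.single_eq_same]
  have key : ∀ {A B : Submodule k (T → k)}, Disjoint A B → (∀ e ∈ A, P e ∈ A) →
      (∀ e ∈ B, P e ∈ B) → ∀ a ∈ A, a y ≠ 0 → z ∈ A ∧ ∀ e ∈ B, e y = 0 := by
    intro A B hd hA hB a ha hay
    have hzA : z ∈ A := by
      have := hA a ha
      rwa [hP, Submodule.smul_mem_iff _ hay] at this
    refine ⟨hzA, fun e he => ?_⟩
    by_contra hne
    have := hB e he
    rw [hP, Submodule.smul_mem_iff _ hne] at this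
    exact hz (Submodule.disjoint_def.1 hd z hzA this)
  by_cases h : a y = 0
  · rw [h, zero_add] at hy
    exact Or.inr (key hAB.disjoint.symm hB hA b hb (by rw [hy]; exact one_ne_zero))
  · exact Or.inl (key hAB.disjoint hA hB a ha h)

theorem mem_of_forall_single_mem [DecidableEq T] [Finite T] {A : Submodule k (T → k)} {e : T → k}
    (h : ∀ t, e t ≠ 0 → (Pi.single t 1 : T → k) ∈ A) : e ∈ A := by
  have := Fintype.ofFinite T
  rw [show e = ∑ t, e t • (Pi.single t 1 : T → k) from by
    funext s
    simp [Finset.sum_apply, Pi.single_apply]]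
  refine Submodule.sum_mem _ fun t _ => ?_
  by_cases ht : e t = 0
  · rw [ht, zero_smul]; exact zero_mem _
  · exact Submodule.smul_mem _ _ (h t ht)

/-- The closing move of the indecomposability proofs: once `A` contains every basis vector that can
occur in vectors of `B`, it contains `B`. -/
theorem eq_bot_of_forall_single_mem [DecidableEq T] [Finite T] {A B : Submodule k (T → k)} (hAB : Disjoint A B)
    (h : ∀ e ∈ B, ∀ t, e t ≠ 0 → (Pi.single t 1 : T → k) ∈ A) : B = ⊥ :=
  (Submodule.eq_bot_iff _).2 fun e he =>
    Submodule.disjoint_def.1 hAB e (mem_of_forall_single_mem (h e he)) he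

theorem exists_mem_sub_mem {A B : Submodule k (T → k)} (hAB : IsCompl A B) (e : T → k) :
    ∃ b ∈ B, e - b ∈ A := by
  obtain ⟨a, ha, b, hb, hab⟩ := Submodule.mem_sup.1
    (hAB.codisjoint.eq_top ▸ Submodule.mem_top : e ∈ A ⊔ B)
  exact ⟨b, hb, by rw [← hab, add_sub_cancel_right]; exact ha⟩

end Dichotomy

/-! ### Indecomposable representations with decomposable subrepresentations and quotients -/

section Configurations

open QuiverRep CoordRep

variable {k : Type u} [Field k] {V : Type w} [Quiver.{v} V]

/-! ### Two arrows with the same source -/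

section TwoOut

open Classical in
/-- The representation with basis vectors `0`, `1`, `2` and arrows `f : 0 → 1` and `f' : 0 → 2`. -/
noncomputable def twoOutRep (k : Type u) [Field k] {a b b' : V} (f : a ⟶ b) (f' : a ⟶ b') :
    CoordRep k V (Fin 3) where
  vertex := ![a, b, b']
  op g := LinearMap.pi ![0, if g = arr f then LinearMap.proj 0 else 0,
    if g = arr f' then LinearMap.proj 0 else 0]
  op_target g e t ht := by
    fin_cases t
    · rfl
    · by_cases h : g = arr f
      · subst h; exact absurd rfl ht
      · simp [h]
    · by_cases h : g = arr f'
      · subst h; exact absurd rfl ht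
      · simp [h]
  op_source g e he := by
    funext t
    fin_cases t
    · rfl
    · by_cases h : g = arr f
      · subst h; simpa using he 0 rfl
      · simp [h]
    · by_cases h : g = arr f'
      · subst h; simpa using he 0 rfl
      · simp [h]

theorem twoOutRep_op_apply [DecidableEq (TotalArrow V)] {a b b' : V} (f : a ⟶ b) (f' : a ⟶ b')
    (g : TotalArrow V) (e : Fin 3 → k) : (twoOutRep k f f').op g e =
      ![0, if g = arr f then e 0 else 0, if g = arr f' then e 0 else 0] := by
  funext t
  fin_cases t
  · rfl
  · by_cases h : g = arr f <;> simp [twoOutRep, h]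
  · by_cases h : g = arr f' <;> simp [twoOutRep, h]

/-- The basis vectors 1 and 2 span a decomposable subrepresentation. They are tied together by 0,
which maps to both: a summand containing 1 must contain 2, while the other summand has no component
along 0. -/
theorem hasSplitSubOrQuot_of_two_out [Finite V] {a b b' : V} {f : a ⟶ b} {f' : a ⟶ b'}
    (h : arr f ≠ arr f') : HasSplitSubOrQuot k V := by
  classical
  set R := twoOutRep k f f' with hR
  have hop := twoOutRep_op_apply (k := k) f f'
  have hclosed : ∀ J : Set (Fin 3), 0 ∈ J → R.IsClosedSet J := by
    intro J h0 e he g t _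
    rw [hop, he 0 h0]
    fin_cases t <;> simp
  refine ⟨R.rep, indecElement_top ?_, _, Or.inl (splitsBelow_subOf (J := {0, 1}) (K := {0, 2})
    (L := {0}) (hclosed _ (by simp)) (hclosed _ (by simp)) (hclosed _ (by simp)) ?_ ?_
    ⟨2, by simp⟩ ⟨1, by simp⟩)⟩
  · have claim : ∀ A B : Submodule k (Fin 3 → k), R.IsStable A → R.IsStable B → IsCompl A B →
        (Pi.single 1 1 : Fin 3 → k) ∈ A → (∀ e ∈ B, e 0 = 0) → B = ⊥ := by
      intro A B hA hB hAB h1 h0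
      obtain ⟨y, hy, hyA⟩ := exists_mem_sub_mem hAB (Pi.single 0 1)
      have h2 : (Pi.single 2 1 : Fin 3 → k) ∈ A := by
        have := (hA _ hyA).2 (arr f')
        rw [hop] at this
        convert this using 1
        funext t
        fin_cases t <;> simp [h.symm, h0 y hy]
      refine eq_bot_of_forall_single_mem hAB.disjoint fun e he t ht => ?_
      fin_cases t
      · exact absurd (h0 e he) ht
      · exact h1
      · exact h2
    intro A B hA hB hAB
    rcases rank_one_dichotomy hAB (R.op (arr f)) (fun e he => (hA e he).2 _)
      (fun e he => (hB e he).2 _) (y := 0) (z := Pi.single 1 1) (by simp) (fun e => by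
        rw [hop]; funext t; fin_cases t <;> simp [h]) with ⟨h1, h0⟩ | ⟨h1, h0⟩
    · exact Or.inr (claim A B hA hB hAB h1 h0)
    · exact Or.inl (claim B A hB hA hAB.symm h1 h0)
  · intro t; fin_cases t <;> simp
  · intro t; fin_cases t <;> simp

end TwoOut

/-! ### Three arrows with the same target -/

section ThreeIn

open Classical in
/-- The representation with basis vectors `0`, `1`, `2`, `3`, `4` and maps `f₁ : 0 ↦ 3`,
`f₂ : 1 ↦ 4` and `f₃ : 2 ↦ 3 + 4`. -/
noncomputable def threeInRep (k : Type u) [Field k] {a₁ a₂ a₃ x : V} (f₁ : a₁ ⟶ x) (f₂ : a₂ ⟶ x)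
    (f₃ : a₃ ⟶ x) : CoordRep k V (Fin 5) where
  vertex := ![a₁, a₂, a₃, x, x]
  op g :=
    { toFun := fun e => ![0, 0, 0,
        (if g = arr f₁ then e 0 else 0) + (if g = arr f₃ then e 2 else 0),
        (if g = arr f₂ then e 1 else 0) + (if g = arr f₃ then e 2 else 0)]
      map_add' := fun e e' => by
        funext t
        fin_cases t <;> simp <;> split_ifs <;> ring
      map_smul' := fun c e => by
        funext t
        fin_cases t <;> simp <;> split_ifs <;> ring }
  op_target g e t ht := by
    have h1 : t = 3 ∨ t = 4 → ¬ g = arr f₁ ∧ ¬ g = arr f₂ ∧ ¬ g = arr f₃ := by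
      rintro (rfl | rfl) <;> refine ⟨?_, ?_, ?_⟩ <;> rintro rfl <;> exact ht rfl
    fin_cases t
    · rfl
    · rfl
    · rfl
    · simp [h1 (Or.inl rfl)]
    · simp [h1 (Or.inr rfl)]
  op_source g e he := by
    have h1 : (if g = arr f₁ then e 0 else 0) = 0 :=
      ite_eq_right_iff.2 (by rintro rfl; exact he 0 rfl)
    have h2 : (if g = arr f₂ then e 1 else 0) = 0 :=
      ite_eq_right_iff.2 (by rintro rfl; exact he 1 rfl)
    have h3 : (if g = arr f₃ then e 2 else 0) = 0 :=
      ite_eq_right_iff.2 (by rintro rfl; exact he 2 rfl)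
    funext t
    fin_cases t <;> simp only [LinearMap.coe_mk, AddHom.coe_mk, h1, h2, h3, add_zero] <;> rfl

open Classical in
theorem threeInRep_op_apply {a₁ a₂ a₃ x : V} (f₁ : a₁ ⟶ x)
    (f₂ : a₂ ⟶ x) (f₃ : a₃ ⟶ x) (g : TotalArrow V) (e : Fin 5 → k) :
    (threeInRep k f₁ f₂ f₃).op g e = ![0, 0, 0,
      (if g = arr f₁ then e 0 else 0) + (if g = arr f₃ then e 2 else 0),
      (if g = arr f₂ then e 1 else 0) + (if g = arr f₃ then e 2 else 0)] :=
  rfl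

theorem hasSplitSubAndQuot_of_three_in [Finite V] {a₁ a₂ a₃ x : V} {f₁ : a₁ ⟶ x} {f₂ : a₂ ⟶ x}
    {f₃ : a₃ ⟶ x} (h₁₂ : arr f₁ ≠ arr f₂) (h₁₃ : arr f₁ ≠ arr f₃) (h₂₃ : arr f₂ ≠ arr f₃) :
    HasSplitSubAndQuot k V := by
  classical
  set R := threeInRep k f₁ f₂ f₃ with hR
  have hop := threeInRep_op_apply (k := k) f₁ f₂ f₃
  have hclosed : ∀ J : Set (Fin 5), (0 ∈ J ∧ 1 ∈ J ∧ 2 ∈ J ∨ (3 ∉ J ∧ 4 ∉ J)) →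
      R.IsClosedSet J := by
    rintro J (⟨h0, h1, h2⟩ | ⟨h3, h4⟩) e he g t ht
    · rw [hop, he 0 h0, he 1 h1, he 2 h2]
      fin_cases t <;> simp
    · rw [hop]
      fin_cases t
      · rfl
      · rfl
      · rfl
      · exact absurd ht h3
      · exact absurd ht h4
  have hL : R.IsClosedSet {0, 1, 2} := hclosed _ (by simp)
  refine ⟨R.rep, indecElement_top ?_, subOf hL.isStable,
    splitsBelow_subOf (J := {0, 1, 2, 3}) (K := {0, 1, 2, 4}) (L := {0, 1, 2})
      (hclosed _ (by simp)) (hclosed _ (by simp)) hL ?_ ?_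
      ⟨4, by simp⟩ ⟨3, by simp⟩,
    splitsAbove_subOf (J := {0}) (K := {1, 2}) (hclosed _ (by simp)) (hclosed _ (by simp)) hL ?_ ?_
      ⟨0, by simp⟩ ⟨1, by simp⟩⟩
  · intro A B hA hB hAB
    have hsum : (Pi.single 3 1 + Pi.single 4 1 : Fin 5 → k) ≠ 0 := fun h => by
      have := congrFun h 3
      simp at this
    have d₁ := rank_one_dichotomy hAB (R.op (arr f₁)) (fun e he => (hA e he).2 _)
      (fun e he => (hB e he).2 _) (y := 0) (z := Pi.single 3 1) (by simp) (fun e => by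
        rw [hop]; funext t; fin_cases t <;> simp [h₁₂, h₁₃])
    have d₂ := rank_one_dichotomy hAB (R.op (arr f₂)) (fun e he => (hA e he).2 _)
      (fun e he => (hB e he).2 _) (y := 1) (z := Pi.single 4 1) (by simp) (fun e => by
        rw [hop]; funext t; fin_cases t <;> simp [h₁₂.symm, h₂₃])
    have d₃ := rank_one_dichotomy hAB (R.op (arr f₃)) (fun e he => (hA e he).2 _)
      (fun e he => (hB e he).2 _) (y := 2) (z := Pi.single 3 1 + Pi.single 4 1) hsum (fun e => by
        rw [hop]; funext t; fin_cases t <;> simp [h₁₃.symm, h₂₃.symm])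
    have claim : ∀ A B : Submodule k (Fin 5 → k), Disjoint A B →
        ((Pi.single 3 1 : Fin 5 → k) ∈ A ∧ ∀ e ∈ B, e 0 = 0) →
        ((Pi.single 4 1 : Fin 5 → k) ∈ A ∧ ∀ e ∈ B, e 1 = 0) →
        ((Pi.single 3 1 + Pi.single 4 1 : Fin 5 → k) ∈ A ∧ ∀ e ∈ B, e 2 = 0) → B = ⊥ := by
      intro A B hAB h1 h2 h3
      refine eq_bot_of_forall_single_mem hAB fun e he t ht => ?_
      fin_cases t
      · exact absurd (h1.2 e he) ht
      · exact absurd (h2.2 e he) ht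
      · exact absurd (h3.2 e he) ht
      · exact h1.1
      · exact h2.1
    have no : ∀ A B : Submodule k (Fin 5 → k), Disjoint A B → ∀ z : Fin 5 → k, z ≠ 0 → z ∈ A →
        z ∉ B := fun A B hd z hz hA hB => hz (Submodule.disjoint_def.1 hd z hA hB)
    have h3 : (Pi.single 3 1 : Fin 5 → k) ≠ 0 := by simp
    have h4 : (Pi.single 4 1 : Fin 5 → k) ≠ 0 := by simp
    have mix : ∀ A B : Submodule k (Fin 5 → k), Disjoint A B → (Pi.single 3 1 : Fin 5 → k) ∈ A →
        (Pi.single 4 1 : Fin 5 → k) ∈ B → (Pi.single 3 1 + Pi.single 4 1 : Fin 5 → k) ∈ A →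
        False := fun A B hd h h' h'' => no A B hd _ h4 (by simpa using A.sub_mem h'' h) h'
    have mix' : ∀ A B : Submodule k (Fin 5 → k), Disjoint A B → (Pi.single 3 1 : Fin 5 → k) ∈ A →
        (Pi.single 4 1 : Fin 5 → k) ∈ B → (Pi.single 3 1 + Pi.single 4 1 : Fin 5 → k) ∈ B →
        False := fun A B hd h h' h'' => no A B hd _ h3 h (by simpa using B.sub_mem h'' h')
    -- Each line lies in one of the summands. Any two of 3, 4, 3 + 4 span the plane, so only the two
    -- cases with all lines on the same side survive.
    rcases d₁ with d₁ | d₁ <;> rcases d₂ with d₂ | d₂ <;> rcases d₃ with d₃ | d₃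
    · exact Or.inr (claim A B hAB.disjoint d₁ d₂ d₃)
    · exact absurd d₃.1 (no A B hAB.disjoint _ hsum (A.add_mem d₁.1 d₂.1))
    · exact (mix A B hAB.disjoint d₁.1 d₂.1 d₃.1).elim
    · exact (mix' A B hAB.disjoint d₁.1 d₂.1 d₃.1).elim
    · exact (mix' B A hAB.disjoint.symm d₁.1 d₂.1 d₃.1).elim
    · exact (mix B A hAB.disjoint.symm d₁.1 d₂.1 d₃.1).elim
    · exact absurd d₃.1 (no B A hAB.disjoint.symm _ hsum (B.add_mem d₁.1 d₂.1))
    · exact Or.inl (claim B A hAB.disjoint.symm d₁ d₂ d₃)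
  · intro t; fin_cases t <;> simp
  · intro t; fin_cases t <;> simp
  · intro t; fin_cases t <;> simp
  · intro t; fin_cases t <;> simp

end ThreeIn

/-! ### Two arrows in and one arrow out -/

section TwoInOneOut

open Classical in
/-- The representation with basis vectors `0`, `1`, `2`, `3`, `4` and maps `f₁ : 0 ↦ 2`,
`f₂ : 1 ↦ 2 + 3` and `h : 2 ↦ 4`. -/
noncomputable def twoInOneOutRep (k : Type u) [Field k] {a₁ a₂ x z : V} (f₁ : a₁ ⟶ x)
    (f₂ : a₂ ⟶ x) (h : x ⟶ z) : CoordRep k V (Fin 5) where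
  vertex := ![a₁, a₂, x, x, z]
  op g :=
    { toFun := fun e => ![0, 0,
        (if g = arr f₁ then e 0 else 0) + (if g = arr f₂ then e 1 else 0),
        if g = arr f₂ then e 1 else 0, if g = arr h then e 2 else 0]
      map_add' := fun e e' => by
        funext t
        fin_cases t <;> simp <;> split_ifs <;> ring
      map_smul' := fun c e => by
        funext t
        fin_cases t <;> simp <;> split_ifs <;> ring }
  op_target g e t ht := by
    have h1 : t = 2 ∨ t = 3 → ¬ g = arr f₁ ∧ ¬ g = arr f₂ := by
      rintro (rfl | rfl) <;> refine ⟨?_, ?_⟩ <;> rintro rfl <;> exact ht rfl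
    have h2 : t = 4 → ¬ g = arr h := by
      rintro rfl rfl; exact ht rfl
    fin_cases t
    · rfl
    · rfl
    · simp [h1 (Or.inl rfl)]
    · simp [h1 (Or.inr rfl)]
    · simp [h2 rfl]
  op_source g e he := by
    have h1 : (if g = arr f₁ then e 0 else 0) = 0 :=
      ite_eq_right_iff.2 (by rintro rfl; exact he 0 rfl)
    have h2 : (if g = arr f₂ then e 1 else 0) = 0 :=
      ite_eq_right_iff.2 (by rintro rfl; exact he 1 rfl)
    have h3 : (if g = arr h then e 2 else 0) = 0 :=
      ite_eq_right_iff.2 (by rintro rfl; exact he 2 rfl)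
    funext t
    fin_cases t <;> simp only [LinearMap.coe_mk, AddHom.coe_mk, h1, h2, h3, add_zero] <;> rfl

open Classical in
theorem twoInOneOutRep_op_apply {a₁ a₂ x z : V} (f₁ : a₁ ⟶ x)
    (f₂ : a₂ ⟶ x) (h : x ⟶ z) (g : TotalArrow V) (e : Fin 5 → k) :
    (twoInOneOutRep k f₁ f₂ h).op g e = ![0, 0,
      (if g = arr f₁ then e 0 else 0) + (if g = arr f₂ then e 1 else 0),
      if g = arr f₂ then e 1 else 0, if g = arr h then e 2 else 0] :=
  rfl

/-- The subrepresentation spanned by 2, 3, 4 splits as {2, 4} and {3}, and the quotient as {0} and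
{1}. The outgoing arrow glues: it sends the images of both 0 and 1 to 4. -/
theorem hasSplitSubAndQuot_of_two_in_one_out [Finite V] {a₁ a₂ x z : V} {f₁ : a₁ ⟶ x}
    {f₂ : a₂ ⟶ x} (h₁₂ : arr f₁ ≠ arr f₂) (h : x ⟶ z) : HasSplitSubAndQuot k V := by
  classical
  set R := twoInOneOutRep k f₁ f₂ h with hR
  have hop := twoInOneOutRep_op_apply (k := k) f₁ f₂ h
  have hclosed : ∀ J : Set (Fin 5), (0 ∈ J ∧ 1 ∈ J ∧ (2 ∈ J ∨ 4 ∉ J) ∨ (2 ∉ J ∧ 3 ∉ J ∧ 4 ∉ J)) →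
      R.IsClosedSet J := by
    rintro J (⟨h0, h1, h2⟩ | ⟨h2, h3, h4⟩) e he g t ht
    · rw [hop, he 0 h0, he 1 h1]
      fin_cases t
      · rfl
      · rfl
      · simp
      · simp
      · rcases h2 with h2 | h2
        · simp [he 2 h2]
        · exact absurd ht h2
    · rw [hop]
      fin_cases t
      · rfl
      · rfl
      · exact absurd ht h2
      · exact absurd ht h3
      · exact absurd ht h4
  have hL : R.IsClosedSet {0, 1} := hclosed _ (by simp)
  refine ⟨R.rep, indecElement_top ?_, subOf hL.isStable,
    splitsBelow_subOf (J := {0, 1, 3}) (K := {0, 1, 2, 4}) (L := {0, 1})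
      (hclosed _ (by simp)) (hclosed _ (by simp)) hL ?_ ?_
      ⟨2, by simp⟩ ⟨3, by simp⟩,
    splitsAbove_subOf (J := {0}) (K := {1}) (hclosed _ (by simp)) (hclosed _ (by simp)) hL ?_ ?_
      ⟨0, by simp⟩ ⟨1, by simp⟩⟩
  · have claim : ∀ A B : Submodule k (Fin 5 → k), R.IsStable A → R.IsStable B → IsCompl A B →
        (Pi.single 4 1 : Fin 5 → k) ∈ A → (∀ e ∈ B, e 0 = 0) → (∀ e ∈ B, e 1 = 0) → B = ⊥ := by
      intro A B hA hB hAB h4 h0 h1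
      have key : ∀ g, ∀ y ∈ B, R.op g y ∈ A := by
        intro g y hy
        refine mem_of_forall_single_mem fun t ht => ?_
        rw [hop, h0 y hy, h1 y hy] at ht
        fin_cases t
        · exact absurd rfl ht
        · exact absurd rfl ht
        · simp at ht
        · simp at ht
        · exact h4
      have key' : ∀ g e, R.op g e ∈ A := by
        intro g e
        obtain ⟨y, hy, hyA⟩ := exists_mem_sub_mem hAB e
        have := A.add_mem ((hA _ hyA).2 g) (key g y hy)
        rwa [← map_add, sub_add_cancel] at this
      have h2 : (Pi.single 2 1 : Fin 5 → k) ∈ A := by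
        convert key' (arr f₁) (Pi.single 0 1) using 1
        rw [hop]
        funext t
        fin_cases t <;> simp
      have h23 : (Pi.single 2 1 + Pi.single 3 1 : Fin 5 → k) ∈ A := by
        convert key' (arr f₂) (Pi.single 1 1) using 1
        rw [hop]
        funext t
        fin_cases t <;> simp
      have h3 : (Pi.single 3 1 : Fin 5 → k) ∈ A := by simpa using A.sub_mem h23 h2
      refine eq_bot_of_forall_single_mem hAB.disjoint fun e he t ht => ?_
      fin_cases t
      · exact absurd (h0 e he) ht
      · exact absurd (h1 e he) ht
      · exact h2
      · exact h3
      · exact h4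
    intro A B hA hB hAB
    have h4 : (Pi.single 4 1 : Fin 5 → k) ≠ 0 := by simp
    -- Composites are used because `h` may be a loop equal to `f₁` or `f₂`, when a single arrow need
    -- not act with rank one; the composite through 2 to 4 always does.
    have d₁ := rank_one_dichotomy hAB (fun e => R.op (arr h) (R.op (arr f₁) e))
      (fun e he => (hA _ ((hA e he).2 _)).2 _) (fun e he => (hB _ ((hB e he).2 _)).2 _)
      (y := 0) (z := Pi.single 4 1) h4 (fun e => by
        rw [hop, hop]; funext t; fin_cases t <;> simp [h₁₂])
    have d₂ := rank_one_dichotomy hAB (fun e => R.op (arr h) (R.op (arr f₂) e))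
      (fun e he => (hA _ ((hA e he).2 _)).2 _) (fun e he => (hB _ ((hB e he).2 _)).2 _)
      (y := 1) (z := Pi.single 4 1) h4 (fun e => by
        rw [hop, hop]; funext t; fin_cases t <;> simp [h₁₂.symm])
    rcases d₁ with d₁ | d₁ <;> rcases d₂ with d₂ | d₂
    · exact Or.inr (claim A B hA hB hAB d₁.1 d₁.2 d₂.2)
    · exact absurd (Submodule.disjoint_def.1 hAB.disjoint _ d₁.1 d₂.1) h4
    · exact absurd (Submodule.disjoint_def.1 hAB.disjoint _ d₂.1 d₁.1) h4
    · exact Or.inl (claim B A hB hA hAB.symm d₁.1 d₁.2 d₂.2)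
  · intro t; fin_cases t <;> simp
  · intro t; fin_cases t <;> simp
  · intro t; fin_cases t <;> simp
  · intro t; fin_cases t <;> simp

end TwoInOneOut

/-! ### A path between a branching source and a branching sink -/

section StringModule

variable {n : ℕ} {q : Fin (n + 2) → V} {c d : V}

open Classical in
/-- The representation with basis vectors `p₀, …, p_{n+1}`, `y`, `z` and maps `p_s ↦ p_{s+1}`,
`p₀ ↦ y` and `z ↦ p_{n+1}`. -/
noncomputable def stringRep (k : Type u) [Field k] (f : ∀ s : Fin (n + 1), q s.castSucc ⟶ q s.succ)
    (h : q 0 ⟶ c) (g' : d ⟶ q (Fin.last (n + 1))) : CoordRep k V (Fin (n + 2) ⊕ Bool) where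
  vertex := Sum.elim q fun b => if b = true then d else c
  op g :=
    { toFun := fun e => Sum.elim (Fin.cases 0 fun s =>
        (if g = arr (f s) then e (Sum.inl s.castSucc) else 0) +
          (if s = Fin.last n ∧ g = arr g' then e (Sum.inr true) else 0))
        fun b => if b = false ∧ g = arr h then e (Sum.inl 0) else 0
      map_add' := fun e e' => by
        funext t
        rcases t with t | t
        · refine Fin.cases ?_ (fun s => ?_) t
          · simp
          · simp; split_ifs <;> ring
        · simp; split_ifs <;> ring
      map_smul' := fun a e => by
        funext t
        rcases t with t | t
        · refine Fin.cases ?_ (fun s => ?_) t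
          · simp
          · simp; split_ifs <;> ring
        · simp }
  op_target g e t ht := by
    rcases t with t | t
    · revert ht
      refine Fin.cases (fun _ => rfl) (fun s ht => ?_) t
      have h1 : ¬ g = arr (f s) := by rintro rfl; exact ht rfl
      have h2 : ¬ (s = Fin.last n ∧ g = arr g') := by rintro ⟨rfl, rfl⟩; exact ht rfl
      simp [h1, h2]
    · have h1 : ¬ (t = false ∧ g = arr h) := by rintro ⟨rfl, rfl⟩; exact ht rfl
      simp [h1]
  op_source g e he := by
    have h1 : ∀ s, (if g = arr (f s) then e (Sum.inl s.castSucc) else 0) = 0 := fun s =>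
      ite_eq_right_iff.2 (by rintro rfl; exact he (Sum.inl _) rfl)
    have h2 : ∀ s, (if s = Fin.last n ∧ g = arr g' then e (Sum.inr true) else 0) = 0 := fun s =>
      ite_eq_right_iff.2 (by rintro ⟨-, rfl⟩; exact he (Sum.inr true) rfl)
    have h3 : ∀ b, (if b = false ∧ g = arr h then e (Sum.inl 0) else 0) = 0 := fun b =>
      ite_eq_right_iff.2 (by rintro ⟨-, rfl⟩; exact he (Sum.inl 0) rfl)
    funext t
    rcases t with t | t
    · refine Fin.cases rfl (fun s => ?_) t
      simp only [LinearMap.coe_mk, AddHom.coe_mk, Sum.elim_inl, Fin.cases_succ, h1, h2, add_zero]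
      rfl
    · simp only [LinearMap.coe_mk, AddHom.coe_mk, Sum.elim_inr, h3]
      rfl

variable (f : ∀ s : Fin (n + 1), q s.castSucc ⟶ q s.succ) (h : q 0 ⟶ c)
  (g' : d ⟶ q (Fin.last (n + 1)))

theorem stringRep_op_zero (g : TotalArrow V) (e : Fin (n + 2) ⊕ Bool → k) :
    (stringRep k f h g').op g e (Sum.inl 0) = 0 := rfl

open Classical in
theorem stringRep_op_succ (g : TotalArrow V) (e : Fin (n + 2) ⊕ Bool → k) (s : Fin (n + 1)) :
    (stringRep k f h g').op g e (Sum.inl s.succ) =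
      (if g = arr (f s) then e (Sum.inl s.castSucc) else 0) +
        (if s = Fin.last n ∧ g = arr g' then e (Sum.inr true) else 0) := rfl

open Classical in
theorem stringRep_op_inr (g : TotalArrow V) (e : Fin (n + 2) ⊕ Bool → k) (b : Bool) :
    (stringRep k f h g').op g e (Sum.inr b) =
      if b = false ∧ g = arr h then e (Sum.inl 0) else 0 := rfl

variable {f h g'}

/-- The string is z → p_{n+1} ← ⋯ ← p_0 → y. A summand containing p_1 contains all later p_s, then y
through p_0, and the other summand can have no component along p_0 or z. Vertices of the path are
not assumed distinct; since `q 0` is a source, the first arrow does not recur along the path, so its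
operator has rank one. -/
theorem stringRep_indec (hh : arr h ≠ arr (f 0)) (hg : arr g' ≠ arr (f (Fin.last n)))
    (hin : ∀ a, IsEmpty (a ⟶ q 0)) (hout : ∀ a, IsEmpty (q (Fin.last (n + 1)) ⟶ a))
    {A B : Submodule k (Fin (n + 2) ⊕ Bool → k)} (hA : (stringRep k f h g').IsStable A)
    (hB : (stringRep k f h g').IsStable B) (hAB : IsCompl A B) : A = ⊥ ∨ B = ⊥ := by
  classical
  have src : ∀ s : Fin (n + 1), s ≠ 0 → ∀ g : TotalArrow V, g = arr (f s) → g.1 ≠ q 0 := by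
    rintro s hs _ rfl h0
    obtain ⟨t, rfl⟩ := Fin.exists_succ_eq.2 hs
    have e : q t.castSucc.succ = q 0 := h0
    have := f t.castSucc
    rw [e] at this
    exact (hin _).false this
  -- For a path of length one this is `hg`; for a longer one, equality would make the target of the
  -- first arrow the sink, which the second arrow leaves.
  have f0g : arr (f 0) ≠ arr g' := by
    intro h0
    by_cases hn : Fin.last n = 0
    · exact hg (by rw [hn, h0])
    · obtain ⟨t, ht⟩ := Fin.exists_succ_eq.2 hn
      have ht0 : (0 : Fin (n + 1)) ≠ Fin.last n := Ne.symm hn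
      have hlt : (0 : Fin (n + 1)).val + 1 < n + 1 := by
        have := Fin.val_lt_last ht0
        simpa using this
      have e1 : q (0 : Fin (n + 1)).succ = q (Fin.last (n + 1)) := congrArg (fun g => g.2.1) h0
      have e2 : (⟨1, by omega⟩ : Fin (n + 1)).castSucc = (0 : Fin (n + 1)).succ := by
        ext; simp
      have := f ⟨1, by omega⟩
      rw [e2, e1] at this
      exact (hout _).false this
  have claim : ∀ A B : Submodule k (Fin (n + 2) ⊕ Bool → k), (stringRep k f h g').IsStable A →
      (stringRep k f h g').IsStable B → IsCompl A B →
      (Pi.single (Sum.inl (Fin.succ 0)) 1 : Fin (n + 2) ⊕ Bool → k) ∈ A →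
      (∀ e ∈ B, e (Sum.inl 0) = 0) → B = ⊥ := by
    intro A B hA hB hAB h1 h0
    have hp : ∀ s : Fin (n + 1), (Pi.single (Sum.inl s.succ) 1 : Fin (n + 2) ⊕ Bool → k) ∈ A := by
      intro s
      induction s using Fin.inductionOn with
      | zero => exact h1
      | succ t ih =>
        convert (hA _ ih).2 (arr (f t.succ)) using 1
        funext x
        rcases x with x | x
        · refine Fin.cases ?_ (fun s => ?_) x
          · rw [stringRep_op_zero]
            exact Pi.single_eq_of_ne (by simp [Fin.ext_iff]) _
          · rw [stringRep_op_succ]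
            by_cases hs : s = t.succ
            · subst hs
              simp [-Fin.castSucc_succ, Fin.succ_castSucc]
            · have : s.castSucc ≠ t.castSucc.succ := by
                rw [Fin.succ_castSucc]
                exact fun h => hs (Fin.castSucc_injective _ h)
              simp [-Fin.castSucc_succ, hs, this]
        · rw [stringRep_op_inr]
          simp [Fin.ext_iff]
    have hc : (Pi.single (Sum.inr false) 1 : Fin (n + 2) ⊕ Bool → k) ∈ A := by
      obtain ⟨y, hy, hyA⟩ := exists_mem_sub_mem hAB (Pi.single (Sum.inl 0) 1)
      have hyc : (stringRep k f h g').op (arr h) y ∈ A := by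
        refine mem_of_forall_single_mem fun t ht => ?_
        rcases t with t | t
        · revert ht
          refine Fin.cases (fun ht => absurd (stringRep_op_zero ..) ht) (fun s _ => hp s) t
        · rw [stringRep_op_inr, h0 y hy, ite_self] at ht
          exact absurd rfl ht
      have hsum := A.add_mem ((hA _ hyA).2 (arr h)) hyc
      rw [← map_add, sub_add_cancel] at hsum
      convert hsum using 1
      funext x
      rcases x with x | x
      · refine Fin.cases ?_ (fun s => ?_) x
        · rw [stringRep_op_zero]
          exact Pi.single_eq_of_ne (by simp) _
        · rw [stringRep_op_succ]
          by_cases hs : s = 0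
          · subst hs
            rw [if_neg hh]
            simp
          · have : s.castSucc ≠ 0 := by simpa using hs
            simp [this]
      · rw [stringRep_op_inr]
        cases x <;> simp
    refine eq_bot_of_forall_single_mem hAB.disjoint fun e he t ht => ?_
    rcases t with t | t
    · revert ht
      exact Fin.cases (fun ht => absurd (h0 e he) ht) (fun s _ => hp s) t
    · cases t
      · exact hc
      · refine absurd ?_ ht
        -- With no component along p_0, the image of `e` involves only the p_s in `A`, yet it lies
        -- in `B`. Its last coordinate is the component of `e` along z.
        have hz : (stringRep k f h g').op (arr g') e = 0 := by
          refine Submodule.disjoint_def.1 hAB.disjoint _ ?_ ((hB e he).2 _)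
          refine mem_of_forall_single_mem fun t ht => ?_
          rcases t with t | t
          · revert ht
            refine Fin.cases (fun ht => absurd (stringRep_op_zero ..) ht) (fun s _ => hp s) t
          · rw [stringRep_op_inr, h0 e he, ite_self] at ht
            exact absurd rfl ht
        have := congrFun hz (Sum.inl (Fin.last n).succ)
        rw [stringRep_op_succ, if_neg hg, zero_add, if_pos ⟨rfl, rfl⟩] at this
        exact this
  have hz : (Pi.single (Sum.inl (Fin.succ 0)) 1 : Fin (n + 2) ⊕ Bool → k) ≠ 0 := by simp
  rcases rank_one_dichotomy hAB ((stringRep k f h g').op (arr (f 0))) (fun e he => (hA e he).2 _)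
    (fun e he => (hB e he).2 _) (y := Sum.inl 0) hz (fun e => by
      funext x
      rcases x with x | x
      · refine Fin.cases ?_ (fun s => ?_) x
        · rw [stringRep_op_zero]
          simp
        · rw [stringRep_op_succ, if_neg (c := s = Fin.last n ∧ _) fun hs => f0g hs.2, add_zero]
          by_cases hs : s = 0
          · subst hs
            simp
          · have : ¬ arr (f 0) = arr (f s) := fun hfs => src s hs _ hfs rfl
            rw [if_neg this, Pi.smul_apply, Pi.single_eq_of_ne
              (fun h => hs (Fin.succ_injective _ (Sum.inl_injective h))), smul_zero]
      · rw [stringRep_op_inr, if_neg fun hs => hh hs.2.symm]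
        simp) with ⟨h1, h0⟩ | ⟨h1, h0⟩
  · exact Or.inr (claim A B hA hB hAB h1 h0)
  · exact Or.inl (claim B A hB hA hAB.symm h1 h0)

/-- The subrepresentation spanned by p_{n+1} and y is decomposable, and modulo it z separates from
p_0, …, p_n. -/
theorem hasSplitSubAndQuot_of_path [Finite V] (hh : arr h ≠ arr (f 0))
    (hg : arr g' ≠ arr (f (Fin.last n)))
    (hin : ∀ a, IsEmpty (a ⟶ q 0)) (hout : ∀ a, IsEmpty (q (Fin.last (n + 1)) ⟶ a)) :
    HasSplitSubAndQuot k V := by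
  classical
  have hclosed : ∀ J : Set (Fin (n + 2) ⊕ Bool),
      (Sum.inr true ∈ J ∨ Sum.inl (Fin.last (n + 1)) ∉ J) →
      (∀ s : Fin (n + 1), Sum.inl s.succ ∈ J → Sum.inl s.castSucc ∈ J) →
      (Sum.inr false ∈ J → Sum.inl 0 ∈ J) → (stringRep k f h g').IsClosedSet J := by
    intro J h1 h2 h3 e he g t ht
    rcases t with t | t
    · revert ht
      refine Fin.cases (fun _ => rfl) (fun s ht => ?_) t
      rw [stringRep_op_succ, he _ (h2 s ht), ite_self, zero_add]
      rcases h1 with h1 | h1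
      · rw [he _ h1, ite_self]
      · exact if_neg fun hs => h1 (by rw [← Fin.succ_last, ← hs.1]; exact ht)
    · rw [stringRep_op_inr]
      cases t
      · rw [he _ (h3 ht), ite_self]
      · simp
  have hs : ∀ s : Fin (n + 1), s.castSucc ≠ Fin.last (n + 1) := Fin.castSucc_ne_last
  have h0 : (0 : Fin (n + 2)) ≠ Fin.last (n + 1) := by simp [Fin.ext_iff]
  have hL : (stringRep k f h g').IsClosedSet {Sum.inl (Fin.last (n + 1)), Sum.inr false}ᶜ :=
    hclosed _ (by simp) (by simp [hs]) (by simp)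
  refine ⟨(stringRep k f h g').rep,
    indecElement_top fun A B hA hB hAB => stringRep_indec hh hg hin hout hA hB hAB,
    subOf hL.isStable,
    splitsBelow_subOf (J := {Sum.inl (Fin.last (n + 1))}ᶜ) (K := {Sum.inr false}ᶜ)
      (hclosed _ (by simp) (by simp [hs]) (by simp [h0])) (hclosed _ (by simp) (by simp) (by simp))
      hL ?_ ?_ ⟨Sum.inl (Fin.last (n + 1)), by simp⟩ ⟨Sum.inr false, by simp⟩,
    splitsAbove_subOf (J := {Sum.inr true})
      (K := {Sum.inl (Fin.last (n + 1)), Sum.inr false, Sum.inr true}ᶜ)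
      (hclosed _ (by simp) (by simp) (by simp)) (hclosed _ (by simp) (by simp [hs]) (by simp)) hL
      ?_ ?_ ⟨Sum.inr true, by simp⟩ ⟨Sum.inl 0, by simp [h0]⟩⟩
  · intro t
    rcases t with t | t <;> simp
  · intro t
    rcases t with t | t <;> simp
  · intro t
    rcases t with t | t <;> simp
  · intro t
    rcases t with t | t
    · simp
    · cases t <;> simp

end StringModule

end Configurations

/-! ### Recognising the quivers `L`, `Δ`, `V`, `Λ` -/

section Joined

/-- Every property of vertices that is invariant along arrows is constant. -/
def IsJoined (V : Type w) [Quiver.{v} V] : Prop :=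
  ∀ P : V → Prop, (∀ {a b : V}, (a ⟶ b) → (P a ↔ P b)) → ∀ a b, P a → P b

variable {V : Type w} [Quiver.{v} V]

/-- Induction along a zigzag; this form turns later connectivity arguments into checks on single
arrows. -/
theorem IsConnectedQuiver.isJoined (h : IsConnectedQuiver V) : IsJoined V := by
  intro P hP a b ha
  obtain ⟨p⟩ := (Quiver.WeaklyConnectedComponent.eq a b).1 (h.2.elim _ _)
  induction p with
  | nil => exact ha
  | cons p f ih =>
    rcases f with f | f
    · exact (hP f).1 ih
    · exact (hP f).2 ih

theorem IsJoined.op (h : IsJoined V) : IsJoined Vᵒᵖ := fun P hP a b ha =>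
  h (fun a => P (Opposite.op a)) (fun f => (hP f.op).symm) a.unop b.unop ha

end Joined

section Degrees

variable {V : Type w} [Quiver.{v} V]

theorem arr_inj_right {a b b' : V} {f : a ⟶ b} {f' : a ⟶ b'} (h : arr f = arr f') :
    (⟨b, f⟩ : Σ b, (a ⟶ b)) = ⟨b', f'⟩ := by
  rw [arr, arr, Sigma.mk.injEq] at h
  exact eq_of_heq h.2

theorem arr_op_ne {a b a' b' : V} {f : a ⟶ b} {f' : a' ⟶ b'} (h : arr f ≠ arr f') :
    arr f.op ≠ arr f'.op := fun h' => h <|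
  congrArg (fun g : TotalArrow Vᵒᵖ => arr g.2.2.unop) h'

theorem outDegreeLeOne_of_forall (h : ∀ {a b b' : V} (f : a ⟶ b) (f' : a ⟶ b'), arr f = arr f') :
    OutDegreeLeOne V := fun _ => ⟨fun _ _ => arr_inj_right (h _ _)⟩

end Degrees

/-! ### Coordinates from degree conditions -/

section Coordinates

variable {V : Type w} [Quiver.{v} V] {x : V}

/-- A connected quiver in which all arrows lead to a sink with at most two incoming arrows, and in
which all the other vertices have at most one incoming arrow, consists of two branches. -/
theorem exists_isTwoBranch (hV : IsJoined V) (hx : ∀ a, IsEmpty (x ⟶ a)) (hout : OutDegreeLeOne V)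
    (hin : ∀ {a a' b : V} (_ : a ⟶ b) (_ : a' ⟶ b), b ≠ x → a = a')
    (hin' : ∀ {a₁ a₂ a₃ : V} (_ : a₁ ⟶ x) (_ : a₂ ⟶ x) (_ : a₃ ⟶ x),
      a₁ = a₂ ∨ a₁ = a₃ ∨ a₂ = a₃) : ∃ c : V → ℤ, IsTwoBranch c := by
  classical
  -- The default value `v` makes the sink a fixed point, so iterates stay there.
  let nx : V → V := fun v => if h : ∃ w, Nonempty (v ⟶ w) then h.choose else v
  have nx_eq : ∀ {v w : V}, (v ⟶ w) → nx v = w := by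
    intro v w f
    have h : ∃ w, Nonempty (v ⟶ w) := ⟨w, ⟨f⟩⟩
    have h1 : nx v = h.choose := dif_pos h
    obtain ⟨g⟩ := h.choose_spec
    exact h1.trans (congrArg Sigma.fst ((hout v).elim ⟨_, g⟩ ⟨_, f⟩))
  have hnx : ∀ {v w : V}, (v ⟶ w) → v ≠ x := fun f h => by
    subst h; exact (hx _).false f
  have nx_x : nx x = x := dif_neg fun ⟨w, ⟨f⟩⟩ => (hx w).false f
  have it_x : ∀ n, nx^[n] x = x := fun n => Function.iterate_fixed nx_x n
  have flow : ∀ v, ∃ n, nx^[n] v = x := by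
    intro v
    refine hV (fun v => ∃ n, nx^[n] v = x) (fun {a b} f => ⟨?_, ?_⟩) x v ⟨0, rfl⟩
    · rintro ⟨n, hn⟩
      cases n with
      | zero => exact absurd hn (hnx f)
      | succ n => exact ⟨n, by rwa [Function.iterate_succ_apply, nx_eq f] at hn⟩
    · rintro ⟨n, hn⟩
      exact ⟨n + 1, by rwa [Function.iterate_succ_apply, nx_eq f]⟩
  have hom : ∀ v, v ≠ x → Nonempty (v ⟶ nx v) := by
    intro v hv
    by_contra h
    have h1 : nx v = v := dif_neg fun ⟨w, ⟨f⟩⟩ => h ⟨nx_eq f ▸ f⟩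
    obtain ⟨n, hn⟩ := flow v
    rw [Function.iterate_fixed h1] at hn
    exact hv hn
  let d : V → ℕ := fun v => Nat.find (flow v)
  have d_spec : ∀ v, nx^[d v] v = x := fun v => Nat.find_spec (flow v)
  have d_x : d x = 0 := (Nat.find_eq_zero (flow x)).2 rfl
  have d_pos : ∀ v, d v = 0 → v = x := fun v h => (Nat.find_eq_zero (flow v)).1 h
  have d_nx : ∀ v, v ≠ x → d v = d (nx v) + 1 := by
    intro v hv
    refine le_antisymm (Nat.find_min' _ ?_) ?_
    · rw [Function.iterate_succ_apply]; exact d_spec _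
    · obtain ⟨n, hn⟩ := Nat.exists_eq_succ_of_ne_zero fun h => hv (d_pos v h)
      rw [hn]
      refine Nat.succ_le_succ (Nat.find_min' _ ?_)
      rw [← Function.iterate_succ_apply, ← hn]
      exact d_spec v
  -- One neighbour `a` of the sink is selected; vertices flowing through it will get negative
  -- coordinates. If nothing enters `x`, then `x` is the only vertex and `a = x` is a dummy choice.
  obtain ⟨a, ha⟩ : ∃ a, (a = x ∧ ∀ b, IsEmpty (b ⟶ x)) ∨ Nonempty (a ⟶ x) := by
    by_cases h : ∃ a, Nonempty (a ⟶ x)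
    · exact h.imp fun a ha => Or.inr ha
    · exact ⟨x, Or.inl ⟨rfl, fun b => ⟨fun f => h ⟨b, ⟨f⟩⟩⟩⟩⟩
  let side : V → Prop := fun v => ∃ n, nx^[n] v = a
  have side_a : side a := ⟨0, rfl⟩
  have side_nx : ∀ v, v ≠ a → (side v ↔ side (nx v)) := by
    refine fun v hv => ⟨?_, fun ⟨n, hn⟩ => ⟨n + 1, hn⟩⟩
    rintro ⟨n, hn⟩
    cases n with
    | zero => exact absurd hn hv
    | succ n => exact ⟨n, hn⟩
  have side_x : (∃ b, Nonempty (b ⟶ x)) → ¬ side x := by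
    rintro ⟨b, ⟨f⟩⟩ ⟨n, hn⟩
    rw [it_x] at hn
    rcases ha with ⟨-, ha⟩ | ⟨⟨fa⟩⟩
    · exact (ha b).false f
    · exact hnx fa hn.symm
  let c : V → ℤ := fun v => if side v then -(d v : ℤ) else d v
  have c_cases : ∀ v, side v ∧ c v = -(d v : ℤ) ∨ ¬ side v ∧ c v = d v := fun v => by
    by_cases h : side v
    · exact Or.inl ⟨h, if_pos h⟩
    · exact Or.inr ⟨h, if_neg h⟩
  -- Distance and side determine the vertex. Beyond distance one the successors agree by induction
  -- and in-degree one applies; at distance one the bound on arrows into `x` leaves at most one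
  -- neighbour besides `a`.
  have inj : ∀ n v w, d v = n → d w = n → (side v ↔ side w) → v = w := by
    intro n
    induction n with
    | zero => intro v w hv hw _; rw [d_pos v hv, d_pos w hw]
    | succ n ih =>
      intro v w hv hw hs
      have ne : ∀ v, d v = n + 1 → v ≠ x := by
        rintro v hv rfl
        omega
      obtain ⟨fv⟩ := hom v (ne v hv)
      obtain ⟨fw⟩ := hom w (ne w hw)
      have hv' := d_nx v (ne v hv)
      have hw' := d_nx w (ne w hw)
      by_cases hn : n = 0
      · have ev := d_pos (nx v) (by omega)
        have ew := d_pos (nx w) (by omega)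
        rw [ev] at fv
        rw [ew] at fw
        have sx := side_x ⟨v, ⟨fv⟩⟩
        obtain ⟨fa⟩ : Nonempty (a ⟶ x) := ha.resolve_left fun h => (h.2 v).false fv
        by_cases h : v = a
        · by_contra hvw
          refine sx ?_
          rw [← ew]
          exact (side_nx w fun h' => hvw (h.trans h'.symm)).1 (hs.1 (h ▸ side_a))
        · by_cases h' : w = a
          · refine absurd ?_ sx
            rw [← ev]
            exact (side_nx v h).1 (hs.2 (h' ▸ side_a))
          · rcases hin' fa fv fw with e | e | e
            · exact absurd e.symm h
            · exact absurd e.symm h'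
            · exact e
      · have na : ∀ v, v ≠ x → d v = n + 1 → v ≠ a := by
          rintro v hvx hv rfl
          rcases ha with ⟨ha, -⟩ | ⟨⟨fa⟩⟩
          · exact hvx ha
          · have := d_nx v hvx
            rw [nx_eq fa, d_x] at this
            omega
        have e := ih (nx v) (nx w) (by omega) (by omega) (by
          rw [← side_nx v (na v (ne v hv) hv), ← side_nx w (na w (ne w hw) hw), hs])
        rw [← e] at fw
        refine hin fv fw fun h => ?_
        rw [h] at hv'
        omega
  refine ⟨c, ?_, ?_, ?_, ?_, ?_⟩
  · intro v w hvw
    rcases c_cases v with ⟨sv, cv⟩ | ⟨sv, cv⟩ <;> rcases c_cases w with ⟨sw, cw⟩ | ⟨sw, cw⟩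
    · exact inj (d v) v w rfl (by omega) (by simp [sv, sw])
    · rw [d_pos v (by omega), d_pos w (by omega)]
    · rw [d_pos v (by omega), d_pos w (by omega)]
    · exact inj (d v) v w rfl (by omega) (by simp [sv, sw])
  · intro v w f
    have h1 := d_nx v (hnx f)
    by_cases hva : v = a
    · obtain ⟨fa⟩ : Nonempty (a ⟶ x) := ha.resolve_left fun h => hnx f (hva.trans h.1)
      subst hva
      have h2 : w = x := (nx_eq f).symm.trans (nx_eq fa)
      rw [nx_eq f, h2, d_x] at h1
      rw [h2]
      have h3 : c v = -(d v : ℤ) := if_pos side_a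
      have h4 := c_cases x
      rw [d_x] at h4
      omega
    · have h2 := side_nx v hva
      rw [nx_eq f] at h1 h2
      rcases c_cases v with ⟨sv, cv⟩ | ⟨sv, cv⟩ <;> rcases c_cases w with ⟨sw, cw⟩ | ⟨sw, cw⟩
      · omega
      · exact absurd (h2.1 sv) sw
      · exact absurd (h2.2 sw) sv
      · omega
  · intro v w
    constructor
    intro f f'
    have := (hout v).elim ⟨w, f⟩ ⟨w, f'⟩
    simpa using this
  · intro v hv
    have : v ≠ x := by
      rintro rfl
      have h4 := c_cases v
      rw [d_x] at h4
      omega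
    exact ⟨_, hom v this⟩
  · refine ⟨x, ?_⟩
    have h4 := c_cases x
    rw [d_x] at h4
    omega

/-- A finite connected quiver all of whose vertices have exactly one outgoing arrow and at most one
incoming arrow is an oriented cycle. -/
theorem exists_isCycle [Finite V] (hV : IsJoined V) (hout : OutDegreeLeOne V)
    (hin : ∀ {a a' b : V} (_ : a ⟶ b) (_ : a' ⟶ b), a = a') (hex : ∀ a : V, ∃ b, Nonempty (a ⟶ b)) :
    ∃ nx : V → V, IsCycle nx := by
  choose nx hnx using hex
  have arrow : ∀ {a b : V}, (a ⟶ b) → b = nx a := fun {a b} f =>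
    congrArg Sigma.fst ((hout a).elim ⟨b, f⟩ ⟨_, (hnx a).some⟩)
  have inj : Function.Injective nx := fun a b h => hin (hnx a).some (h ▸ (hnx b).some)
  refine ⟨nx, inj, arrow, ?_, hnx, ?_⟩
  · intro v w
    constructor
    intro f f'
    have := (hout v).elim ⟨w, f⟩ ⟨w, f'⟩
    simpa using this
  · intro a b
    refine hV (fun b => ∃ s, nx^[s] a = b) (fun {v w} f => ?_) a b ⟨0, rfl⟩
    obtain rfl := arrow f
    refine ⟨fun ⟨s, hs⟩ => ⟨s + 1, by rw [Function.iterate_succ_apply', hs]⟩, ?_⟩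
    rintro ⟨s, hs⟩
    cases s with
    | succ s => exact ⟨s, inj ((Function.iterate_succ_apply' nx s a).symm.trans hs)⟩
    -- Here the target of the arrow is `a` itself. It is periodic, so its predecessor is reached one
    -- step before a full period.
    | zero =>
      have hp : Function.IsPeriodicPt nx (Function.minimalPeriod nx a) a :=
        Function.isPeriodicPt_minimalPeriod _ _
      have hpos : 0 < Function.minimalPeriod nx a :=
        Function.minimalPeriod_pos_of_mem_periodicPts
          (Function.Injective.mem_periodicPts inj a)
      obtain ⟨p, hp'⟩ := Nat.exists_eq_succ_of_ne_zero hpos.ne'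
      refine ⟨p, inj ?_⟩
      rw [← Function.iterate_succ_apply' nx p a, ← hs, ← hp']
      exact hp

end Coordinates

/-! ### From coordinates to the named quivers and their opposites -/

section Forms

/-- The coordinates `0, …, m - 1` identify the quiver with two branches running into the vertex
with coordinate `x`. -/
structure IsBranchEquiv {V : Type w} [Quiver.{v} V] {m : ℕ} (e : V ≃ Fin m) (x : ℕ) : Prop where
  lt : x < m
  subsingleton : ∀ a b : V, Subsingleton (a ⟶ b)
  nonempty_iff : ∀ a b : V, Nonempty (a ⟶ b) ↔
    ((e b).val = (e a).val + 1 ∧ (e b).val ≤ x) ∨ ((e a).val = (e b).val + 1 ∧ x ≤ (e b).val)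

theorem nonempty_equiv_plift {α : Sort*} [Subsingleton α] {p : Prop} (h : Nonempty α ↔ p) :
    Nonempty (α ≃ PLift p) :=
  ⟨{ toFun := fun a => ⟨h.1 ⟨a⟩⟩
     invFun := fun b => (h.2 b.down).some
     left_inv := fun _ => Subsingleton.elim _ _
     right_inv := fun _ => rfl }⟩

theorem subsingleton_and_nonempty_iff {α : Sort*} {p : Prop} (h : Nonempty (α ≃ PLift p)) :
    Subsingleton α ∧ (Nonempty α ↔ p) := by
  obtain ⟨e⟩ := h
  refine ⟨e.subsingleton, fun ⟨a⟩ => (e a).down, fun h => ⟨e.symm ⟨h⟩⟩⟩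

variable {V : Type w} [Quiver.{v} V]

theorem IsBranchEquiv.isTwoBranch {m x : ℕ} {e : V ≃ Fin m} (h : IsBranchEquiv e x) :
    IsTwoBranch fun a => ((e a).val : ℤ) - x where
  inj a b hab := e.injective (Fin.ext (by simp only at hab; omega))
  arrow {a b} f := by
    have := (h.nonempty_iff a b).1 ⟨f⟩
    omega
  subsingleton := h.subsingleton
  exists_arrow a ha := by
    have hm := (e a).isLt
    have hx := h.lt
    rcases lt_or_gt_of_ne ha with h1 | h1
    · refine ⟨e.symm ⟨(e a).val + 1, by omega⟩, (h.nonempty_iff _ _).2 (Or.inl ?_)⟩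
      rw [e.apply_symm_apply]
      exact ⟨rfl, by simp only; omega⟩
    · refine ⟨e.symm ⟨(e a).val - 1, by omega⟩, (h.nonempty_iff _ _).2 (Or.inr ?_)⟩
      rw [e.apply_symm_apply]
      exact ⟨by simp only; omega, by simp only; omega⟩
  exists_zero := ⟨e.symm ⟨x, h.lt⟩, by simp⟩

/-- Walking along arrows from the extreme vertices to the sink shows that the coordinates fill an
interval; subtracting the minimum numbers the vertices from 0. -/
theorem IsTwoBranch.exists_isBranchEquiv [Finite V] {c : V → ℤ} (hc : IsTwoBranch c) :
    ∃ (m x : ℕ) (e : V ≃ Fin m), IsBranchEquiv e x := by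
  obtain ⟨o, ho⟩ := hc.exists_zero
  have : Nonempty V := ⟨o⟩
  obtain ⟨l, hl⟩ := Finite.exists_min c
  obtain ⟨r, hr⟩ := Finite.exists_max c
  have hlo : c l ≤ 0 := ho ▸ hl o
  have hro : 0 ≤ c r := ho ▸ hr o
  have left : ∀ n : ℕ, c l + n ≤ 0 → ∃ a, c a = c l + n := by
    intro n
    induction n with
    | zero => exact fun _ => ⟨l, by simp⟩
    | succ n ih =>
      intro hn
      push_cast at hn
      obtain ⟨a, ha⟩ := ih (by omega)
      obtain ⟨b, ⟨f⟩⟩ := hc.exists_arrow a (by omega)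
      have := hc.arrow f
      exact ⟨b, by push_cast; omega⟩
  have right : ∀ n : ℕ, 0 ≤ c r - n → ∃ a, c a = c r - n := by
    intro n
    induction n with
    | zero => exact fun _ => ⟨r, by simp⟩
    | succ n ih =>
      intro hn
      push_cast at hn
      obtain ⟨a, ha⟩ := ih (by omega)
      obtain ⟨b, ⟨f⟩⟩ := hc.exists_arrow a (by omega)
      have := hc.arrow f
      exact ⟨b, by push_cast; omega⟩
  have surj : ∀ z, c l ≤ z → z ≤ c r → ∃ a, c a = z := by
    intro z h1 h2
    rcases le_total z 0 with h | h
    · obtain ⟨a, ha⟩ := left (z - c l).toNat (by omega)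
      exact ⟨a, by omega⟩
    · obtain ⟨a, ha⟩ := right (c r - z).toNat (by omega)
      exact ⟨a, by omega⟩
  let e₀ : V → Fin ((c r - c l).toNat + 1) := fun a => ⟨(c a - c l).toNat, by
    have := hl a
    have := hr a
    omega⟩
  have he₀ : Function.Bijective e₀ := by
    constructor
    · intro a b hab
      have h1 : (c a - c l).toNat = (c b - c l).toNat := congrArg Fin.val hab
      have := hl a
      have := hl b
      exact hc.inj (by omega)
    · intro i
      have := i.isLt
      obtain ⟨a, ha⟩ := surj (c l + i.val) (by omega) (by omega)
      exact ⟨a, Fin.ext (by simp only [e₀]; omega)⟩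
  refine ⟨_, (-c l).toNat, Equiv.ofBijective e₀ he₀, by omega, hc.subsingleton, fun a b => ?_⟩
  have hla := hl a
  have hlb := hl b
  simp only [Equiv.ofBijective_apply, e₀]
  constructor
  · rintro ⟨f⟩
    have := hc.arrow f
    omega
  · intro h
    obtain ⟨b', ⟨f⟩⟩ := hc.exists_arrow a (by omega)
    have := hc.arrow f
    obtain rfl : b' = b := hc.inj (by omega)
    exact ⟨f⟩

/-- A sink at either end gives L, with the numbering reversed if it is first; an interior sink gives
V. The inequalities are kept so that both neighbours of an interior sink can be named. -/
theorem IsBranchEquiv.isOfFormL_or_isOfFormV {m x : ℕ} {e : V ≃ Fin m} (h : IsBranchEquiv e x) :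
    IsOfFormL V ∨ x + 1 < m ∧ 0 < x ∧ IsOfFormV V := by
  have hx := h.lt
  by_cases h0 : x = 0
  · refine Or.inl ⟨m, by omega, e.trans Fin.revPerm, fun a b => ?_⟩
    have := h.subsingleton a b
    refine nonempty_equiv_plift ((h.nonempty_iff a b).trans ?_)
    change _ ↔ (Fin.rev (e b)).val = (Fin.rev (e a)).val + 1
    have h1 := (e a).isLt
    have h2 := (e b).isLt
    simp only [Fin.val_rev]
    omega
  · by_cases hm : x + 1 = m
    · refine Or.inl ⟨m, by omega, e, fun a b => ?_⟩
      have := h.subsingleton a b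
      refine nonempty_equiv_plift ((h.nonempty_iff a b).trans ?_)
      change _ ↔ (e b).val = (e a).val + 1
      have h1 := (e a).isLt
      have h2 := (e b).isLt
      omega
    -- Coordinates start at 0 and labels at 1, so the sink has label `x + 1`.
    · refine Or.inr ⟨by omega, by omega, m, x + 1, by omega, by omega, e, fun a b => ?_⟩
      have := h.subsingleton a b
      refine nonempty_equiv_plift ((h.nonempty_iff a b).trans ?_)
      change _ ↔ ((e b).val = (e a).val + 1 ∧ (e b).val + 1 ≤ x + 1) ∨
        ((e a).val = (e b).val + 1 ∧ x + 1 ≤ (e b).val + 1)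
      omega

theorem IsOfFormV.exists_isTwoBranch (h : IsOfFormV V) : ∃ c : V → ℤ, IsTwoBranch c := by
  obtain ⟨m, x, hx, hm, e, he⟩ := h
  refine ⟨_, IsBranchEquiv.isTwoBranch (e := (e : V ≃ Fin m)) (x := x - 1) ⟨by omega,
    fun a b => (subsingleton_and_nonempty_iff (he a b)).1, fun a b =>
      (subsingleton_and_nonempty_iff (he a b)).2.trans ?_⟩⟩
  have : ∀ i j : Fin m, ((j.val = i.val + 1 ∧ j.val + 1 ≤ x) ∨ (i.val = j.val + 1 ∧ x ≤ j.val + 1)) ↔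
      ((j.val = i.val + 1 ∧ j.val ≤ x - 1) ∨ (i.val = j.val + 1 ∧ x - 1 ≤ j.val)) := by
    intro i j
    omega
  exact this _ _

theorem IsOfFormL.exists_isTwoBranch (h : IsOfFormL V) : ∃ c : V → ℤ, IsTwoBranch c := by
  obtain ⟨m, hm, e, he⟩ := h
  refine ⟨_, IsBranchEquiv.isTwoBranch (e := (e : V ≃ Fin m)) (x := m - 1) ⟨by omega,
    fun a b => (subsingleton_and_nonempty_iff (he a b)).1, fun a b =>
      (subsingleton_and_nonempty_iff (he a b)).2.trans ?_⟩⟩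
  have : ∀ i j : Fin m, j.val = i.val + 1 ↔
      ((j.val = i.val + 1 ∧ j.val ≤ m - 1) ∨ (i.val = j.val + 1 ∧ m - 1 ≤ j.val)) := by
    intro i j
    omega
  exact this _ _

/-- The arrows of the opposite quiver. -/
theorem nonempty_hom_op_iff {a b : Vᵒᵖ} : Nonempty (a ⟶ b) ↔ Nonempty (b.unop ⟶ a.unop) :=
  ⟨fun ⟨f⟩ => ⟨f.unop⟩, fun ⟨f⟩ => ⟨f.op⟩⟩

theorem subsingleton_hom_op {a b : Vᵒᵖ} (h : Subsingleton (b.unop ⟶ a.unop)) :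
    Subsingleton (a ⟶ b) := ⟨fun f g => Quiver.Hom.unop_inj (h.elim f.unop g.unop)⟩

theorem IsOfFormL.op (h : IsOfFormL V) : IsOfFormL Vᵒᵖ := by
  obtain ⟨m, hm, e, he⟩ := h
  refine ⟨m, hm, Opposite.equivToOpposite.symm.trans ((e : V ≃ Fin m).trans Fin.revPerm),
    fun a b => ?_⟩
  have h1 := subsingleton_and_nonempty_iff (he b.unop a.unop)
  have := subsingleton_hom_op h1.1
  refine nonempty_equiv_plift ((nonempty_hom_op_iff.trans h1.2).trans ?_)
  have : ∀ i j : Fin m, i.val = j.val + 1 ↔ (Fin.rev j).val = (Fin.rev i).val + 1 := by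
    intro i j
    simp only [Fin.val_rev]
    omega
  exact this _ _

/-- With the same numbering, reversing the arrows of Λ gives literally the arrow condition of V. -/
theorem IsOfFormWedge.op (h : IsOfFormWedge V) : IsOfFormV Vᵒᵖ := by
  obtain ⟨n, y, hy, hn, e, he⟩ := h
  refine ⟨n, y, hy, hn, Opposite.equivToOpposite.symm.trans e, fun a b => ?_⟩
  have h1 := subsingleton_and_nonempty_iff (he b.unop a.unop)
  have := subsingleton_hom_op h1.1
  exact nonempty_equiv_plift (nonempty_hom_op_iff.trans h1.2)

theorem subsingleton_hom_of_op {a b : V}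
    (h : Subsingleton (Opposite.op b ⟶ Opposite.op a)) : Subsingleton (a ⟶ b) :=
  ⟨fun f g => Quiver.Hom.op_inj (h.elim f.op g.op)⟩

theorem IsOfFormV.unop (h : IsOfFormV Vᵒᵖ) : IsOfFormWedge V := by
  obtain ⟨n, y, hy, hn, e, he⟩ := h
  refine ⟨n, y, hy, hn, Opposite.equivToOpposite.trans e, fun a b => ?_⟩
  have h1 := subsingleton_and_nonempty_iff (he (Opposite.op b) (Opposite.op a))
  have := subsingleton_hom_of_op h1.1
  exact nonempty_equiv_plift (nonempty_hom_op_iff.symm.trans h1.2)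

theorem IsOfFormL.unop (h : IsOfFormL Vᵒᵖ) : IsOfFormL V := by
  obtain ⟨m, hm, e, he⟩ := h
  refine ⟨m, hm, Opposite.equivToOpposite.trans ((e : Vᵒᵖ ≃ Fin m).trans Fin.revPerm),
    fun a b => ?_⟩
  have h1 := subsingleton_and_nonempty_iff (he (Opposite.op b) (Opposite.op a))
  have := subsingleton_hom_of_op h1.1
  refine nonempty_equiv_plift ((nonempty_hom_op_iff.symm.trans h1.2).trans ?_)
  have : ∀ i j : Fin m, i.val = j.val + 1 ↔ (Fin.rev j).val = (Fin.rev i).val + 1 := by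
    intro i j
    simp only [Fin.val_rev]
    omega
  exact this _ _

theorem IsOfFormDelta.exists_isCycle (h : IsOfFormDelta V) : ∃ nx : V → V, IsCycle nx := by
  obtain ⟨n, e', he⟩ := h
  let e : V ≃ Fin (n + 1) := e'
  have h1 : ∀ a b : V, Subsingleton (a ⟶ b) ∧ (Nonempty (a ⟶ b) ↔
    (e b).val = ((e a).val + 1) % (n + 1)) := fun a b => subsingleton_and_nonempty_iff (he a b)
  let nx : V → V := fun a => e.symm ⟨((e a).val + 1) % (n + 1), Nat.mod_lt _ n.succ_pos⟩
  have e_nx : ∀ a, (e (nx a)).val = ((e a).val + 1) % (n + 1) := fun a => by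
    simp only [nx, e.apply_symm_apply]
  have e_it : ∀ s a, (e (nx^[s] a)).val = ((e a).val + s) % (n + 1) := by
    intro s a
    induction s with
    | zero => exact (Nat.mod_eq_of_lt (e a).isLt).symm
    | succ s ih => rw [Function.iterate_succ_apply', e_nx, ih, Nat.mod_add_mod, add_assoc]
  have it_surj : ∀ a b, ∃ s, nx^[s] a = b := by
    intro a b
    have ha := (e a).isLt
    refine ⟨(e b).val + (n + 1 - (e a).val), e.injective (Fin.ext ?_)⟩
    rw [e_it, show (e a).val + ((e b).val + (n + 1 - (e a).val)) = (e b).val + (n + 1) by omega,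
      Nat.add_mod_right, Nat.mod_eq_of_lt (e b).isLt]
  refine ⟨nx, ?_, ?_, fun a b => (h1 a b).1, fun a => (h1 a _).2.2 (e_nx a), it_surj⟩
  · have := Finite.of_equiv _ e.symm
    refine Finite.injective_iff_surjective.2 fun b => ?_
    obtain ⟨s, hs⟩ := it_surj (nx b) b
    exact ⟨nx^[s] b, by rw [← Function.iterate_succ_apply' nx, Function.iterate_succ_apply, hs]⟩
  · exact fun {a b} f => e.injective (Fin.ext (((h1 a b).2.1 ⟨f⟩).trans (e_nx a).symm))

theorem IsCycle.op [Finite V] {nx : V → V} (h : IsCycle nx) : ∃ nx' : Vᵒᵖ → Vᵒᵖ, IsCycle nx' := by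
  let σ := Equiv.ofBijective nx (Finite.injective_iff_bijective.1 h.inj)
  have hσ : ∀ a, nx (σ.symm a) = a := σ.apply_symm_apply
  have it : ∀ s (a : Vᵒᵖ), ((fun a : Vᵒᵖ => Opposite.op (σ.symm a.unop))^[s] a).unop =
      σ.symm^[s] a.unop := by
    intro s
    induction s with
    | zero => intro a; rfl
    | succ s ih => intro a; rw [Function.iterate_succ_apply, ih, Function.iterate_succ_apply]
  refine ⟨fun a => Opposite.op (σ.symm a.unop), ?_, ?_, ?_, ?_, ?_⟩
  · intro a b hab
    exact Opposite.unop_injective (σ.symm.injective (Opposite.op_injective hab))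
  · intro a b f
    refine Opposite.unop_injective (σ.injective ?_)
    exact (h.arrow f.unop).symm.trans (hσ _).symm
  · exact fun a b => subsingleton_hom_op (h.subsingleton _ _)
  · intro a
    refine nonempty_hom_op_iff.2 ?_
    have := h.exists_arrow (σ.symm a.unop)
    rwa [hσ] at this
  · intro a b
    obtain ⟨s, hs⟩ := h.exists_iterate b.unop a.unop
    refine ⟨s, Opposite.unop_injective ?_⟩
    rw [it, ← hs]
    exact Function.LeftInverse.iterate (g := σ.symm) (f := nx) σ.symm_apply_apply s _

/-- The iterates of one vertex below its minimal period list every vertex once, in cyclic order. -/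
theorem IsCycle.isOfFormDelta [Finite V] [Nonempty V] {nx : V → V} (h : IsCycle nx) :
    IsOfFormDelta V := by
  obtain ⟨o⟩ := ‹Nonempty V›
  have hmem := h.inj.mem_periodicPts o
  obtain ⟨n, hn⟩ := Nat.exists_eq_add_one_of_ne_zero
    (Function.minimalPeriod_pos_of_mem_periodicPts hmem).ne'
  have it_mod : ∀ s, nx^[s % (n + 1)] o = nx^[s] o := fun s => by
    rw [← hn, Function.iterate_mod_minimalPeriod_eq]
  let e₀ : Fin (n + 1) → V := fun i => nx^[i.val] o
  have he₀ : Function.Bijective e₀ := by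
    constructor
    · intro i j hij
      exact Fin.ext (Function.iterate_injOn_Iio_minimalPeriod (Set.mem_Iio.2 (i.isLt.trans_eq hn.symm))
        (Set.mem_Iio.2 (j.isLt.trans_eq hn.symm)) hij)
    · intro b
      obtain ⟨s, hs⟩ := h.exists_iterate o b
      refine ⟨⟨s % (n + 1), Nat.mod_lt _ n.succ_pos⟩, ?_⟩
      exact (it_mod s).trans hs
  let e := Equiv.ofBijective e₀ he₀
  refine ⟨n, e.symm, fun a b => ?_⟩
  have := h.subsingleton a b
  refine nonempty_equiv_plift ?_
  have key : ∀ i j : Fin (n + 1), Nonempty (e i ⟶ e j) ↔ j.val = (i.val + 1) % (n + 1) := by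
    intro i j
    have h1 : e ⟨(i.val + 1) % (n + 1), Nat.mod_lt _ n.succ_pos⟩ = nx (e i) := by
      change nx^[(i.val + 1) % (n + 1)] o = nx (nx^[i.val] o)
      rw [it_mod, Function.iterate_succ_apply']
    constructor
    · rintro ⟨f⟩
      have h2 := h.arrow f
      rw [← h1] at h2
      exact congrArg Fin.val (e.injective h2)
    · intro hj
      have : j = ⟨(i.val + 1) % (n + 1), Nat.mod_lt _ n.succ_pos⟩ := Fin.ext hj
      rw [this, h1]
      exact h.exists_arrow _
  have := key (e.symm a) (e.symm b)
  rwa [e.apply_symm_apply, e.apply_symm_apply] at this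

end Forms

/-! ### The quivers without bad configurations -/

section Classification

open QuiverRep

variable {k : Type u} [Field k] {V : Type w} [Quiver.{v} V]

instance finite_op [Finite V] : Finite Vᵒᵖ := Finite.of_equiv V Opposite.equivToOpposite

instance finite_hom_op [∀ a b : V, Finite (a ⟶ b)] (a b : Vᵒᵖ) : Finite (a ⟶ b) :=
  Finite.of_injective (fun f : a ⟶ b => f.unop) Quiver.Hom.unop_inj

/-- An interior sink would receive arrows from its two distinct neighbours. -/
theorem isOfFormL_of_isTwoBranch [Finite V] {c : V → ℤ} (hc : IsTwoBranch c)
    (hin : ∀ {a a' b : V} (_ : a ⟶ b) (_ : a' ⟶ b), a = a') : IsOfFormL V := by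
  obtain ⟨m, x, e, h⟩ := hc.exists_isBranchEquiv
  refine h.isOfFormL_or_isOfFormV.resolve_right ?_
  rintro ⟨hm, hx, -⟩
  obtain ⟨f⟩ : Nonempty (e.symm ⟨x - 1, by omega⟩ ⟶ e.symm ⟨x, by omega⟩) :=
    (h.nonempty_iff _ _).2 (by
      rw [e.apply_symm_apply, e.apply_symm_apply]
      exact Or.inl ⟨(Nat.sub_add_cancel hx).symm, le_rfl⟩)
  obtain ⟨f'⟩ : Nonempty (e.symm ⟨x + 1, by omega⟩ ⟶ e.symm ⟨x, by omega⟩) := (h.nonempty_iff _ _).2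
    (by rw [e.apply_symm_apply, e.apply_symm_apply]; exact Or.inr ⟨rfl, le_rfl⟩)
  have := congrArg Fin.val (e.symm.injective (hin f f'))
  simp only at this
  omega

/-- A finite connected quiver whose vertices have at most one outgoing and at most one incoming
arrow. -/
theorem isOfFormL_or_isOfFormDelta [Finite V] [Nonempty V] (hV : IsJoined V) (hout : OutDegreeLeOne V)
    (hin : ∀ {a a' b : V} (_ : a ⟶ b) (_ : a' ⟶ b), a = a') : IsOfFormL V ∨ IsOfFormDelta V := by
  by_cases h : ∀ a : V, ∃ b, Nonempty (a ⟶ b)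
  · obtain ⟨nx, hnx⟩ := exists_isCycle hV hout hin h
    exact Or.inr hnx.isOfFormDelta
  · push Not at h
    obtain ⟨x, hx⟩ := h
    obtain ⟨c, hc⟩ := exists_isTwoBranch hV (x := x) (fun a => hx a) hout
      (fun f f' _ => hin f f') (fun f f' _ => Or.inl (hin f f'))
    exact Or.inl (isOfFormL_of_isTwoBranch hc hin)

/-- Two arrows out of a vertex are excluded directly, two arrows into a vertex by duality, so all
in- and out-degrees are at most one. -/
theorem isOfFormL_or_isOfFormDelta_of_not_hasSplitSubOrQuot [Finite V] [Nonempty V]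
    (hV : IsJoined V) (h : ¬ HasSplitSubOrQuot k V) : IsOfFormL V ∨ IsOfFormDelta V := by
  refine isOfFormL_or_isOfFormDelta hV (outDegreeLeOne_of_forall fun f f' => ?_) fun f f' => ?_
  · by_contra hf
    exact h (hasSplitSubOrQuot_of_two_out hf)
  · by_contra hne
    refine h (HasSplitSubOrQuot.unop (hasSplitSubOrQuot_of_two_out (f := f.op) (f' := f'.op) ?_))
    exact fun hf => hne (congrArg (fun g : TotalArrow Vᵒᵖ => g.2.1.unop) hf)

theorem exists_path_of_reflTransGen {v x : V}
    (h : Relation.ReflTransGen (fun a b : V => Nonempty (a ⟶ b)) v x) :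
    v = x ∨ ∃ (n : ℕ) (q : Fin (n + 2) → V), (∀ s : Fin (n + 1), Nonempty (q s.castSucc ⟶ q s.succ)) ∧
      q 0 = v ∧ q (Fin.last (n + 1)) = x := by
  induction h using Relation.ReflTransGen.head_induction_on with
  | refl => exact Or.inl rfl
  | @head a b hab _ ih =>
    right
    rcases ih with rfl | ⟨n, q, hq, rfl, rfl⟩
    · refine ⟨0, ![a, b], fun s => ?_, rfl, rfl⟩
      obtain rfl : s = 0 := Fin.fin_one_eq_zero s
      exact hab
    · refine ⟨n + 1, Fin.cons a q, fun s => ?_, rfl, ?_⟩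
      · refine Fin.cases hab (fun t => ?_) s
        exact hq t
      · rw [← Fin.succ_last, Fin.cons_succ]

/-- In a quiver without bad configurations that contains two different arrows with the same
target, everything flows into this target. -/
theorem exists_isTwoBranch_of_not_hasSplitSubAndQuot [Finite V] (hV : IsJoined V)
    (h : ¬ HasSplitSubAndQuot k V) {a₁ a₂ x : V} {f₁ : a₁ ⟶ x} {f₂ : a₂ ⟶ x} (hf : arr f₁ ≠ arr f₂) :
    ∃ c : V → ℤ, IsTwoBranch c := by
  have sink : ∀ {a a' b : V} {f : a ⟶ b} {f' : a' ⟶ b}, arr f ≠ arr f' → ∀ d, IsEmpty (b ⟶ d) :=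
    fun hne d => ⟨fun g => h (hasSplitSubAndQuot_of_two_in_one_out hne g)⟩
  have source : ∀ {a b b' : V} {f : a ⟶ b} {f' : a ⟶ b'}, arr f ≠ arr f' → ∀ d, IsEmpty (d ⟶ a) :=
    fun hne d => ⟨fun g => h (HasSplitSubAndQuot.unop
      (hasSplitSubAndQuot_of_two_in_one_out (arr_op_ne hne) g.op))⟩
  -- A vertex with two outgoing arrows is a source and `x` is a sink, so a path from one to the
  -- other would be the third bad configuration.
  have out : ∀ v, Relation.ReflTransGen (fun a b : V => Nonempty (a ⟶ b)) v x →
      ∀ {b b' : V} (f : v ⟶ b) (f' : v ⟶ b'), arr f = arr f' := by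
    intro v hv b b' f f'
    by_contra hne
    rcases exists_path_of_reflTransGen hv with rfl | ⟨n, q, hq, rfl, rfl⟩
    · exact (sink hf b).false f
    · choose g hg using fun s => (⟨(hq s).some, trivial⟩ : ∃ g : q s.castSucc ⟶ q s.succ, True)
      -- Of two different arrows at an end of the path, at least one is not the arrow used by the
      -- path.
      have h1 : ∃ (c : V) (h : q 0 ⟶ c), arr h ≠ arr (g 0) := by
        by_cases hfg : arr f = arr (g 0)
        · exact ⟨b', f', fun h' => hne (hfg.trans h'.symm)⟩
        · exact ⟨b, f, hfg⟩
      have h2 : ∃ (d : V) (g' : d ⟶ q (Fin.last (n + 1))), arr g' ≠ arr (g (Fin.last n)) := by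
        by_cases hfg : arr f₁ = arr (g (Fin.last n))
        · exact ⟨a₂, f₂, fun h' => hf (hfg.trans h'.symm)⟩
        · exact ⟨a₁, f₁, hfg⟩
      obtain ⟨c, h₁, hh₁⟩ := h1
      obtain ⟨d, g', hg'⟩ := h2
      exact h (hasSplitSubAndQuot_of_path hh₁ hg' (source hne) (sink hf))
  -- Leading to `x` passes back along arrows trivially, and forward because the only arrow out of a
  -- vertex leading to `x` is the first arrow of its path.
  have reach : ∀ v, Relation.ReflTransGen (fun a b : V => Nonempty (a ⟶ b)) v x := by
    intro v
    refine hV (fun v => Relation.ReflTransGen (fun a b : V => Nonempty (a ⟶ b)) v x)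
      (fun {a b} f => ⟨fun ha => ?_, fun hb => .head ⟨f⟩ hb⟩) x v .refl
    rcases Relation.ReflTransGen.cases_head ha with rfl | ⟨b', ⟨f'⟩, hb'⟩
    · exact ((sink hf b).false f).elim
    · obtain rfl : b = b' := congrArg (fun g : TotalArrow V => g.2.1) (out a ha f f')
      exact hb'
  refine exists_isTwoBranch hV (sink hf) (outDegreeLeOne_of_forall fun {a b b'} f f' =>
    out a (reach a) f f') (fun {a a' b} f f' hb => ?_) (fun {b₁ b₂ b₃} g₁ g₂ g₃ => ?_)
  · by_contra hne
    rcases Relation.ReflTransGen.cases_head (reach b) with hbx | ⟨d, ⟨g⟩, -⟩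
    · exact hb hbx
    · exact (sink (f := f) (f' := f')
        (fun hff => hne (congrArg (fun g : TotalArrow V => g.1) hff)) d).false g
  · by_contra hne
    push Not at hne
    exact h (hasSplitSubAndQuot_of_three_in (f₁ := g₁) (f₂ := g₂) (f₃ := g₃)
      (fun hff => hne.1 (congrArg (fun g : TotalArrow V => g.1) hff))
      (fun hff => hne.2.1 (congrArg (fun g : TotalArrow V => g.1) hff))
      (fun hff => hne.2.2 (congrArg (fun g : TotalArrow V => g.1) hff)))

/-- Two arrows into some vertex force two branches into a sink; two arrows out force the same for
the opposite quiver. If neither occurs, all degrees are at most one. -/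
theorem isOfForm_of_not_hasSplitSubAndQuot [Finite V] [Nonempty V] (hV : IsJoined V)
    (h : ¬ HasSplitSubAndQuot k V) :
    IsOfFormL V ∨ IsOfFormDelta V ∨ IsOfFormV V ∨ IsOfFormWedge V := by
  by_cases hin : ∃ (a₁ a₂ x : V) (f₁ : a₁ ⟶ x) (f₂ : a₂ ⟶ x), arr f₁ ≠ arr f₂
  · obtain ⟨a₁, a₂, x, f₁, f₂, hf⟩ := hin
    obtain ⟨c, hc⟩ := exists_isTwoBranch_of_not_hasSplitSubAndQuot hV h hf
    obtain ⟨m, x, e, he⟩ := hc.exists_isBranchEquiv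
    exact he.isOfFormL_or_isOfFormV.imp id fun h => Or.inr (Or.inl h.2.2)
  by_cases hout : ∃ (x b₁ b₂ : V) (f₁ : x ⟶ b₁) (f₂ : x ⟶ b₂), arr f₁ ≠ arr f₂
  · obtain ⟨x, b₁, b₂, f₁, f₂, hf⟩ := hout
    obtain ⟨c, hc⟩ := exists_isTwoBranch_of_not_hasSplitSubAndQuot hV.op
      (fun h' => h (HasSplitSubAndQuot.unop h')) (arr_op_ne hf)
    obtain ⟨m, x, e, he⟩ := hc.exists_isBranchEquiv
    exact he.isOfFormL_or_isOfFormV.imp IsOfFormL.unop fun h => Or.inr (Or.inr h.2.2.unop)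
  · push Not at hin hout
    refine (isOfFormL_or_isOfFormDelta hV (outDegreeLeOne_of_forall fun f f' => hout _ _ _ f f')
      fun f f' => congrArg (fun g : TotalArrow V => g.1) (hin _ _ _ f f')).imp_right Or.inl

variable [Finite V] [∀ a b : V, Finite (a ⟶ b)]

theorem IsOfFormL.indecUniform (h : IsOfFormL V) : IndecUniform k V :=
  have ⟨_, hc⟩ := h.exists_isTwoBranch
  indecUniform_of_isTwoBranch hc

theorem IsOfFormV.indecUniform (h : IsOfFormV V) : IndecUniform k V :=
  have ⟨_, hc⟩ := h.exists_isTwoBranch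
  indecUniform_of_isTwoBranch hc

theorem IsOfFormDelta.indecUniform (h : IsOfFormDelta V) : IndecUniform k V :=
  have ⟨_, hc⟩ := h.exists_isCycle
  indecUniform_of_isCycle hc

theorem IsOfFormDelta.indecUniform_op (h : IsOfFormDelta V) : IndecUniform k Vᵒᵖ :=
  have ⟨_, hc⟩ := h.exists_isCycle
  have ⟨_, hc'⟩ := hc.op
  indecUniform_of_isCycle hc'

end Classification

/-! ### The two equivalences -/

theorem theoremT {k : Type u} [Field k] [Finite k]
    {V : Type w} [Quiver.{v} V] [Finite V] [∀ a b : V, Finite (a ⟶ b)]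
    (hV : IsConnectedQuiver V) :
    List.TFAE
      [HallAlgebra.IsIdeal (HallAlgebra.D k V 1),
       ∀ r : ℕ, 1 ≤ r → HallAlgebra.IsIdeal (HallAlgebra.D k V r),
       IsOfFormL V ∨ IsOfFormDelta V] ∧
    List.TFAE
      [HallAlgebra.IsSubring (HallAlgebra.D k V 1),
       ∀ r : ℕ, 1 ≤ r → HallAlgebra.IsSubring (HallAlgebra.D k V r),
       IsOfFormL V ∨ IsOfFormDelta V ∨ IsOfFormV V ∨ IsOfFormWedge V] := by
  have := hV.1
  constructor
  · tfae_have 1 → 3 := fun h =>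
      isOfFormL_or_isOfFormDelta_of_not_hasSplitSubOrQuot (k := k) hV.isJoined fun h' =>
        h'.not_isIdeal h
    tfae_have 3 → 2 := by
      intro h r _
      have h1 : QuiverRep.IndecUniform k V := h.elim (·.indecUniform) (·.indecUniform)
      have h2 : QuiverRep.IndecUniform k Vᵒᵖ := h.elim (·.op.indecUniform) (·.indecUniform_op)
      exact HallAlgebra.isIdeal_D (fun _ U => U.numSummands_rep_le h1)
        (fun _ U => U.numSummands_quot_le h2.dual) r
    tfae_have 2 → 1 := fun h => h 1 le_rfl
    tfae_finish
  · tfae_have 1 → 3 := fun h =>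
      isOfForm_of_not_hasSplitSubAndQuot (k := k) hV.isJoined fun h' => h'.not_isSubring h
    tfae_have 3 → 2 := by
      intro h r _
      -- For Λ the opposite quiver is of type V, so it is the quotients that have at most as many
      -- summands; in the other cases subrepresentations are bounded.
      by_cases hW : IsOfFormWedge V
      · exact HallAlgebra.isSubring_D_of_quot_le
          (fun _ U => U.numSummands_quot_le (QuiverRep.IndecUniform.dual hW.op.indecUniform)) r
      · refine HallAlgebra.isSubring_D_of_rep_le (fun _ U => U.numSummands_rep_le ?_) r
        rcases h with h | h | h | h
        · exact h.indecUniform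
        · exact h.indecUniform
        · exact h.indecUniform
        · exact absurd h hW
    tfae_have 2 → 1 := fun h => h 1 le_rfl
    tfae_finish
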